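/- Let $M$ be a connected smooth surface (a connected smooth two-dimensional manifold without boundary), let $f\colon M\to\mathbb{R}^4$ be a smooth immersion, and let $\Pi\subset\mathbb{R}^4$ be a two-dimensional linear subspace. For two-dimensional subspaces $V,W\subset\mathbb{R}^4$ the principal angles $0\le\theta_1\le\theta_2\le\pi/2$ are defined by $$\cos\theta_1=\langle v_1,w_1\rangle=\max\{\langle v,w\rangle : v\in V,\ w\in W,\ |v|=|w|=1\},$$ $$\cos\theta_2=\max\{\langle v,w\rangle : v\in V,\ w\in W,\ v\perp v_1,\ w\perp w_1,\ |v|=|w|=1\}.$$ Assume that $f$ has constant principal angles with respect to $\Pi$, i.e. that the principal angles between $df_p(T_pM)$ and $\Pi$ do not depend on $p\in M$. Call an immersion $h\colon N\to\mathbb{R}^4$ of a surface an *extrinsic product* if there are an orthogonal decomposition $\mathbb{R}^4=V\oplus V^\perp$, one-dimensional smooth manifolds $N_1,N_2$, smooth immersions $h_1\colon N_1\to V$, $h_2\colon N_2\to V^\perp$ and a diffeomorphism $\Phi\colon N_1\times N_2\to N$ with $h(\Phi(x,y))=h_1(x)+h_2(y)$ for all $x,y$. 1. The metric induced by $f$ has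 zero Gauss curvature, and the normal bundle of $f$ is flat (the curvature of the normal connection vanishes). 2. Suppose that $M$ is complete for the induced Riemannian distance. Then there is a smooth covering map $\pi\colon\mathbb{R}^2\to M$ such that $f\circ\pi$ is an extrinsic product. If moreover $f$ is injective (so that $M$ is a surface $\Sigma=f(M)\subset\mathbb{R}^4$ without self-intersections), then $f$ itself is an extrinsic product. 3. Suppose that $M$ is compact. Then $M$ is diffeomorphic to the torus $S^1\times S^1$, and there are a two-dimensional subspace $P\subset\mathbb{R}^4$, smooth closed regular curves $c_1\colon S^1\to P$, $c_2\colon S^1\to P^\perp$, and a smooth covering map $\pi=(\pi_1,\pi_2)\colon M\to S^1\times S^1$ with $f(p)=c_1(\pi_1(p))+c_2(\pi_2(p))$ for all $p\in M$. If moreover $f$ is injective, then $f$ is an embedding, and there are such a $P$, such closed curves $c_1,c_2$ that are moreover simple (injective), and a diffeomorphism $\Phi\colon S^1\times S^1\to M$ with $f(\Phi(z,w))=c_1(z)+c_2(w)$ for all $z,w$; that is, $\Sigma=f(M)$ is a torus embedded as the product of two simple closed plane curves lying in orthogonal planes. -/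

import Mathlib

open scoped Manifold ContDiff ENNReal Topology RealInnerProductSpace

noncomputable section

/-- Euclidean `n`-space; all surfaces below lie in `Eucl 4`. -/
abbrev Eucl (n : ℕ) : Type := EuclideanSpace ℝ (Fin n)

/-! ### Principal angles -/

/-- `θ₁ ≤ θ₂` are the principal angles between the planes `V` and `W`: `cos θ₁` is the maximum of
`⟪v, w⟫` over unit vectors `v ∈ V`, `w ∈ W`, attained at `(v₁, w₁)`, and `cos θ₂` is the maximum
of `⟪v, w⟫` over those unit vectors that moreover satisfy `v ⊥ v₁` and `w ⊥ w₁`. -/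
def ArePrincipalAngles (V W : Submodule ℝ (Eucl 4)) (θ₁ θ₂ : ℝ) : Prop :=
  0 ≤ θ₁ ∧ θ₁ ≤ θ₂ ∧ θ₂ ≤ Real.pi / 2 ∧
  ∃ v₁ ∈ V, ∃ w₁ ∈ W, ‖v₁‖ = 1 ∧ ‖w₁‖ = 1 ∧ ⟪v₁, w₁⟫ = Real.cos θ₁ ∧
    IsGreatest {r : ℝ | ∃ v ∈ V, ∃ w ∈ W, ‖v‖ = 1 ∧ ‖w‖ = 1 ∧ r = ⟪v, w⟫} (Real.cos θ₁) ∧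
    IsGreatest {r : ℝ | ∃ v ∈ V, ∃ w ∈ W, ⟪v, v₁⟫ = 0 ∧ ⟪w, w₁⟫ = 0 ∧
      ‖v‖ = 1 ∧ ‖w‖ = 1 ∧ r = ⟪v, w⟫} (Real.cos θ₂)

/-! ### Immersions into Euclidean four-space -/

/-- A smooth immersion of an `n`-dimensional manifold into `ℝ⁴`: a smooth map all of whose
differentials are injective. -/
def IsSmoothImmersion (n : ℕ) {N : Type*} [TopologicalSpace N] [ChartedSpace (Eucl n) N]
    (f : N → Eucl 4) : Prop :=
  ContMDiff (𝓡 n) 𝓘(ℝ, Eucl 4) ∞ f ∧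
    ∀ p : N, Function.Injective (mfderiv (𝓡 n) 𝓘(ℝ, Eucl 4) f p)

/-- The tangent plane `df_p (T_p M)` of an immersed surface, as a linear subspace of `ℝ⁴`. -/
def tangentPlane {M : Type*} [TopologicalSpace M] [ChartedSpace (Eucl 2) M]
    (f : M → Eucl 4) (p : M) : Submodule ℝ (Eucl 4) :=
  LinearMap.range
    (show Eucl 2 →L[ℝ] Eucl 4 from mfderiv (𝓡 2) 𝓘(ℝ, Eucl 4) f p).toLinearMap

/-- The principal angles between the tangent planes and `Plane` do not depend on the point. -/
def HasConstantPrincipalAngles {M : Type*} [TopologicalSpace M] [ChartedSpace (Eucl 2) M]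
    (f : M → Eucl 4) (Plane : Submodule ℝ (Eucl 4)) : Prop :=
  ∃ θ₁ θ₂ : ℝ, ∀ p : M, ArePrincipalAngles (tangentPlane f p) Plane θ₁ θ₂

/-! ### Gauss curvature and normal curvature of a parametrized surface -/

/-- The partial derivative `∂ᵢ h`. -/
def partialD {F : Type*} [NormedAddCommGroup F] [NormedSpace ℝ F]
    (i : Fin 2) (h : Eucl 2 → F) (x : Eucl 2) : F :=
  fderiv ℝ h x (EuclideanSpace.single i 1)

/-- The metric coefficients `gᵢⱼ = ⟪∂ᵢφ, ∂ⱼφ⟫` of a parametrized surface `φ`. -/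
def metricMatrix (φ : Eucl 2 → Eucl 4) (x : Eucl 2) : Matrix (Fin 2) (Fin 2) ℝ :=
  Matrix.of fun i j => ⟪partialD i φ x, partialD j φ x⟫

/-- The Christoffel symbol `Γᵏᵢⱼ = ½ ∑ₗ gᵏˡ (∂ᵢ gⱼₗ + ∂ⱼ gᵢₗ - ∂ₗ gᵢⱼ)` of the induced metric. -/
def christoffelSymbol (φ : Eucl 2 → Eucl 4) (k i j : Fin 2) (x : Eucl 2) : ℝ :=
  (1 / 2 : ℝ) * ∑ l : Fin 2, (metricMatrix φ x)⁻¹ k l *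
    (partialD i (fun y => metricMatrix φ y j l) x + partialD j (fun y => metricMatrix φ y i l) x
      - partialD l (fun y => metricMatrix φ y i j) x)

/-- The component `Rˡ` of `R(∂ᵢ, ∂ⱼ) ∂ₖ = ∇ᵢ ∇ⱼ ∂ₖ - ∇ⱼ ∇ᵢ ∂ₖ = ∑ₗ Rˡ ∂ₗ`, for the Levi-Civita
connection of the induced metric. -/
def riemannCoeff (φ : Eucl 2 → Eucl 4) (l i j k : Fin 2) (x : Eucl 2) : ℝ :=
  partialD i (christoffelSymbol φ l j k) x - partialD j (christoffelSymbol φ l i k) x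
    + ∑ m : Fin 2, (christoffelSymbol φ l i m x * christoffelSymbol φ m j k x
        - christoffelSymbol φ l j m x * christoffelSymbol φ m i k x)

/-- The Gauss curvature `⟨R(∂₁, ∂₂) ∂₂, ∂₁⟩ / det g` of the induced metric. -/
def gaussCurvature (φ : Eucl 2 → Eucl 4) (x : Eucl 2) : ℝ :=
  (∑ l : Fin 2, metricMatrix φ x 0 l * riemannCoeff φ l 0 1 1 x) / (metricMatrix φ x).det

/-- The normal plane of a parametrized surface. -/
def normalPlane (φ : Eucl 2 → Eucl 4) (x : Eucl 2) : Submodule ℝ (Eucl 4) :=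
  (LinearMap.range (fderiv ℝ φ x).toLinearMap)ᗮ

/-- The normal connection: `∇^⊥ᵢ ξ` is the normal part of `∂ᵢ ξ`. -/
def normalDeriv (φ : Eucl 2 → Eucl 4) (i : Fin 2) (ξ : Eucl 2 → Eucl 4) (x : Eucl 2) : Eucl 4 :=
  (normalPlane φ x).starProjection (partialD i ξ x)

/-- The normal curvature `R^⊥(∂₁, ∂₂) ξ = ∇^⊥₁ ∇^⊥₂ ξ - ∇^⊥₂ ∇^⊥₁ ξ`. -/
def normalCurvature (φ ξ : Eucl 2 → Eucl 4) (x : Eucl 2) : Eucl 4 :=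
  normalDeriv φ 0 (normalDeriv φ 1 ξ) x - normalDeriv φ 1 (normalDeriv φ 0 ξ) x

/-- An immersed surface has zero Gauss curvature (computed in every chart of the smooth
structure). -/
def HasZeroGaussCurvature {M : Type*} [TopologicalSpace M] [ChartedSpace (Eucl 2) M]
    (f : M → Eucl 4) : Prop :=
  ∀ e ∈ IsManifold.maximalAtlas (𝓡 2) ∞ M, ∀ x ∈ e.target, gaussCurvature (f ∘ e.symm) x = 0

/-- An immersed surface has flat normal bundle: the curvature of the normal connection vanishes
on all smooth local normal fields. -/
def HasFlatNormalBundle {M : Type*} [TopologicalSpace M] [ChartedSpace (Eucl 2) M]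
    (f : M → Eucl 4) : Prop :=
  ∀ e ∈ IsManifold.maximalAtlas (𝓡 2) ∞ M, ∀ ξ : Eucl 2 → Eucl 4,
    ContDiffOn ℝ ∞ ξ e.target → (∀ x ∈ e.target, ξ x ∈ normalPlane (f ∘ e.symm) x) →
    ∀ x ∈ e.target, normalCurvature (f ∘ e.symm) ξ x = 0

/-! ### Completeness -/

/-- The Riemannian distance of the induced metric: the infimum of the lengths (measured in `ℝ⁴`)
of `C¹` paths in `M` from `p` to `q`. -/
def inducedEDist {M : Type*} [TopologicalSpace M] [ChartedSpace (Eucl 2) M]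
    (f : M → Eucl 4) (p q : M) : ℝ≥0∞ :=
  letI : ∀ x : M, ENorm (TangentSpace (𝓡 2) x) := fun x =>
    ⟨fun v => ‖(show Eucl 4 from mfderiv (𝓡 2) 𝓘(ℝ, Eucl 4) f x v)‖ₑ⟩
  Manifold.riemannianEDist (𝓡 2) p q

/-- The immersed surface is complete: every sequence that is Cauchy for the induced Riemannian
distance converges in `M`. -/
def IsCompleteSurface {M : Type*} [TopologicalSpace M] [ChartedSpace (Eucl 2) M]
    (f : M → Eucl 4) : Prop :=
  ∀ u : ℕ → M,
    (∀ ε : ℝ≥0∞, 0 < ε → ∃ N : ℕ, ∀ m ≥ N, ∀ n ≥ N, inducedEDist f (u m) (u n) < ε) →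
    ∃ p : M, Filter.Tendsto u Filter.atTop (𝓝 p)

/-! ### Products -/

/-- `f` is an extrinsic product: `M` is diffeomorphic to a product `M₁ × M₂` of one-dimensional
manifolds, `ℝ⁴ = V ⊕ Vᗮ` orthogonally, and `f` is the product of two immersions `M₁ → V` and
`M₂ → Vᗮ`. -/
def IsExtrinsicProduct {M : Type*} [TopologicalSpace M] [ChartedSpace (Eucl 2) M]
    (f : M → Eucl 4) : Prop :=
  ∃ (V : Submodule ℝ (Eucl 4))
    (M₁ : Type) (_ : TopologicalSpace M₁) (_ : ChartedSpace (Eucl 1) M₁)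
    (_ : IsManifold (𝓡 1) ∞ M₁)
    (M₂ : Type) (_ : TopologicalSpace M₂) (_ : ChartedSpace (Eucl 1) M₂)
    (_ : IsManifold (𝓡 1) ∞ M₂)
    (f₁ : M₁ → Eucl 4) (f₂ : M₂ → Eucl 4)
    (Φ : Diffeomorph ((𝓡 1).prod (𝓡 1)) (𝓡 2) (M₁ × M₂) M ∞),
    IsSmoothImmersion 1 f₁ ∧ (∀ x, f₁ x ∈ V) ∧
    IsSmoothImmersion 1 f₂ ∧ (∀ y, f₂ y ∈ Vᗮ) ∧
    ∀ (x : M₁) (y : M₂), f (Φ (x, y)) = f₁ x + f₂ y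

/-- After passing to a smooth covering of `M` by `ℝ²`, `f` becomes an extrinsic product. -/
def IsCoveredByExtrinsicProduct {M : Type*} [TopologicalSpace M] [ChartedSpace (Eucl 2) M]
    (f : M → Eucl 4) : Prop :=
  ∃ π : Eucl 2 → M, IsCoveringMap π ∧ Function.Surjective π ∧
    IsLocalDiffeomorph (𝓡 2) (𝓡 2) ∞ π ∧ IsExtrinsicProduct (f ∘ π)

/-- A closed regular curve in the linear plane `P`. -/
def IsClosedPlaneCurve (P : Submodule ℝ (Eucl 4)) (c : Circle → Eucl 4) : Prop :=
  Module.finrank ℝ P = 2 ∧ IsSmoothImmersion 1 c ∧ ∀ z, c z ∈ P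

/-- `M` is a torus, and `f` is a covering of the torus `S¹ × S¹` followed by the product of two
closed regular curves lying in orthogonal planes. -/
def IsImmersedProductTorus {M : Type*} [TopologicalSpace M] [ChartedSpace (Eucl 2) M]
    (f : M → Eucl 4) : Prop :=
  Nonempty (Diffeomorph ((𝓡 1).prod (𝓡 1)) (𝓡 2) (Circle × Circle) M ∞) ∧
  ∃ (P : Submodule ℝ (Eucl 4)) (c₁ c₂ : Circle → Eucl 4) (π : M → Circle × Circle),
    IsClosedPlaneCurve P c₁ ∧ IsClosedPlaneCurve Pᗮ c₂ ∧
    IsCoveringMap π ∧ Function.Surjective π ∧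
    IsLocalDiffeomorph (𝓡 2) ((𝓡 1).prod (𝓡 1)) ∞ π ∧
    ∀ p : M, f p = c₁ (π p).1 + c₂ (π p).2

/-- `f` embeds `M` as the product of two simple closed regular curves lying in orthogonal planes;
in particular `M` is a torus. -/
def IsEmbeddedProductTorus {M : Type*} [TopologicalSpace M] [ChartedSpace (Eucl 2) M]
    (f : M → Eucl 4) : Prop :=
  Topology.IsEmbedding f ∧
  ∃ (P : Submodule ℝ (Eucl 4)) (c₁ c₂ : Circle → Eucl 4)
    (Φ : Diffeomorph ((𝓡 1).prod (𝓡 1)) (𝓡 2) (Circle × Circle) M ∞),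
    IsClosedPlaneCurve P c₁ ∧ Function.Injective c₁ ∧
    IsClosedPlaneCurve Pᗮ c₂ ∧ Function.Injective c₂ ∧
    ∀ z w : Circle, f (Φ (z, w)) = c₁ z + c₂ w

end

/-! ### Linear algebra of principal angles -/

section PrincipalAngles

/-! Let `Q` be the orthogonal projector onto the fixed plane. Diagonalizing the compression of `Q`
to a tangent plane gives an orthonormal pair X₁, X₂ with eigenvalues cᵢ² = cos²θᵢ, and each Xᵢ has a
unit normal partner Nᵢ such that `Q` preserves span(Xᵢ, Nᵢ) (`exists_adaptedNormals`). Since the cᵢ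
are constant, these relations can be differentiated, and the outcome is that dXᵢ never has a
component along Nᵢ (`IsPrincipalPair.deriv`). So the second fundamental form satisfies II(X₁, ·) ∥
N₂ and II(X₂, ·) ∥ N₁. By symmetry II(X₁, X₂) = 0, while II(X₁, X₁) ⊥ II(X₂, X₂). The Gauss equation
gives K = 0, and the shape operators are simultaneously diagonal, so the normal bundle is flat.

For the product structure suppose first that c₁² ≠ c₂². The principal lines are then well defined,
and the remaining differentiated relation expresses A = ⟨D₁X₁, X₂⟩ as a constant multiple of the
N₂-component of D₁X₁. Combined with a commutator computation of Codazzi type this yields the Riccati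
equation X₂(A) = A² (`PrincipalFrame.riccati`), and likewise with the indices exchanged. On a
complete or compact surface the curves of both families are defined for all time, and a global
solution of k' = k² vanishes (`eq_zero_of_riccati`). Hence D₂X₁ = 0 = D₁X₂: there are coordinates
(s, t) with ∂ₛ = X₁ and ∂ₜ = X₂, where X₁ depends on s alone and X₂ on t alone, so f splits locally
as a sum of two curves. If c₁² = c₂², the tangent plane is constant (`tangentPlane_eq`), and a
constant frame has all these properties. Frame systems (`IsFrameSystem`) treat both cases at once.

Following a curve of the first family and then curves of the second develops ℝ² onto M
(`IsFrameSystem.exists_development`). The development is a surjective local diffeomorphism whose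
fibres are the orbits of a discrete group of translations, and f pulls back to h₁(s) + h₂(t), with
h₁ in the span V of all first velocities and h₂ in Vᗮ. These facts form `PlaneCover`, and everything
global is read off from the deck group. If f is injective the group is a product of subgroups of the
two axes. If M is compact the group is a lattice, which makes M a torus and forces both curves to be
periodic. A closed regular curve does not lie in a line, so V and Vᗮ are both planes. -/

/-- The first-order condition at a maximum on the unit circle: testing in the direction of (a, b)
gives √(a² + b²) ≤ a. -/
theorem eq_zero_of_sqrt_bound {a b : ℝ}
    (h : ∀ x y : ℝ, x ^ 2 + y ^ 2 = 1 → x * a + y * b ≤ a) : b = 0 := by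
  by_contra hb
  have hpos : 0 < a ^ 2 + b ^ 2 := by positivity
  set r := Real.sqrt (a ^ 2 + b ^ 2) with hr
  have hr0 : 0 < r := Real.sqrt_pos.2 hpos
  have hr2 : r ^ 2 = a ^ 2 + b ^ 2 := Real.sq_sqrt hpos.le
  have h1 := h (a / r) (b / r) (by field_simp; linarith)
  have h2 : a / r * a + b / r * b = r := by field_simp; linarith
  rw [h2] at h1
  have : 0 < b ^ 2 := by positivity
  nlinarith

theorem inner_comb_self {E : Type*} [NormedAddCommGroup E] [InnerProductSpace ℝ E] {a b : E}
    (ha : ‖a‖ = 1) (hb : ‖b‖ = 1) (hab : ⟪a, b⟫ = 0) {x y : ℝ} (h : x ^ 2 + y ^ 2 = 1) :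
    ‖x • a + y • b‖ = 1 := by
  have h1 : ‖x • a + y • b‖ ^ 2 = 1 := by
    rw [← real_inner_self_eq_norm_sq]
    simp only [inner_add_left, inner_add_right, inner_smul_left, inner_smul_right, hab,
      real_inner_comm a b, real_inner_self_eq_norm_sq, ha, hb, RCLike.conj_to_real]
    linarith
  nlinarith [norm_nonneg (x • a + y • b)]

theorem starProjection_eq_of_orthonormal_pair {W : Submodule ℝ (Eucl 4)}
    (hW : Module.finrank ℝ W = 2) {w₁ w₂ : Eucl 4} (h₁ : w₁ ∈ W) (h₂ : w₂ ∈ W)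
    (n₁ : ‖w₁‖ = 1) (n₂ : ‖w₂‖ = 1) (h₁₂ : ⟪w₁, w₂⟫ = 0) (u : Eucl 4) :
    W.starProjection u = ⟪w₁, u⟫ • w₁ + ⟪w₂, u⟫ • w₂ := by
  have hon : Orthonormal ℝ (![⟨w₁, h₁⟩, ⟨w₂, h₂⟩] : Fin 2 → W) := by
    constructor
    · intro i; fin_cases i <;> simp [n₁, n₂]
    · intro i j hij
      fin_cases i <;> fin_cases j <;> simp_all [real_inner_comm]
  let b := (OrthonormalBasis.mk hon (by
    rw [hon.linearIndependent.span_eq_top_of_card_eq_finrank (by simp [hW])]))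
  have := b.orthogonalProjectionOnto_apply_eq_sum u
  rw [Submodule.starProjection_apply, this]
  simp [b, Fin.sum_univ_two]

/-- The singular value decomposition behind the principal angles. -/
theorem ArePrincipalAngles.exists_orthonormal_pair {V W : Submodule ℝ (Eucl 4)} {θ₁ θ₂ : ℝ}
    (h : ArePrincipalAngles V W θ₁ θ₂) (hW : Module.finrank ℝ W = 2) :
    ∃ X₁ ∈ V, ∃ X₂ ∈ V, ‖X₁‖ = 1 ∧ ‖X₂‖ = 1 ∧ ⟪X₁, X₂⟫ = 0 ∧
      ⟪W.starProjection X₁, X₁⟫ = Real.cos θ₁ ^ 2 ∧ ⟪W.starProjection X₂, X₂⟫ = Real.cos θ₂ ^ 2 ∧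
      ⟪W.starProjection X₁, X₂⟫ = 0 := by
  obtain ⟨-, -, -, v₁, hv₁, w₁, hw₁, nv₁, nw₁, e₁, g₁, g₂⟩ := h
  obtain ⟨v₂, hv₂, w₂, hw₂, o₁, o₂, nv₂, nw₂, e₂⟩ := g₂.1
  have ho₁ : ⟪v₁, v₂⟫ = 0 := by rw [real_inner_comm]; exact o₁
  have ho₂ : ⟪w₁, w₂⟫ = 0 := by rw [real_inner_comm]; exact o₂
  -- Rotating w₁ towards w₂ cannot exceed the maximum attained at (v₁, w₁), so the mixed product
  -- vanishes. The same argument with v₁ and v₂ gives `c₂`, so the projector sends vᵢ to cos θᵢ •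
  -- wᵢ.
  have c₁ : ⟪v₁, w₂⟫ = 0 := by
    refine eq_zero_of_sqrt_bound (a := Real.cos θ₁) fun x y hxy => ?_
    have := g₁.2 ⟨v₁, hv₁, x • w₁ + y • w₂, W.add_mem (W.smul_mem _ hw₁) (W.smul_mem _ hw₂), nv₁,
      inner_comb_self nw₁ nw₂ ho₂ hxy, rfl⟩
    rwa [inner_add_right, inner_smul_right, inner_smul_right, e₁] at this
  have c₂ : ⟪v₂, w₁⟫ = 0 := by
    refine eq_zero_of_sqrt_bound (a := Real.cos θ₁) fun x y hxy => ?_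
    have := g₁.2 ⟨x • v₁ + y • v₂, V.add_mem (V.smul_mem _ hv₁) (V.smul_mem _ hv₂), w₁, hw₁,
      inner_comb_self nv₁ nv₂ ho₁ hxy, nw₁, rfl⟩
    rwa [inner_add_left, inner_smul_left, inner_smul_left, e₁] at this
  have Q := starProjection_eq_of_orthonormal_pair hW hw₁ hw₂ nw₁ nw₂ ho₂
  refine ⟨v₁, hv₁, v₂, hv₂, nv₁, nv₂, ho₁, ?_, ?_, ?_⟩ <;>
    simp only [Q, real_inner_comm _ w₁, real_inner_comm _ w₂, c₁, c₂, e₁, ← e₂, inner_add_left,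
      inner_smul_left, RCLike.conj_to_real, sq] <;>
    simp

/-- Only the vectors with nonzero coefficient can be normalized; a zero coefficient leaves the
direction free, to be filled in by completing to an orthonormal basis of `W`. The zero case is
needed for principal angles equal to 0 or π/2. -/
theorem exists_orthonormal_of_orthogonal {W : Submodule ℝ (Eucl 4)}
    (hW : Module.finrank ℝ W = 2) {a₁ a₂ : Eucl 4} (h₁ : a₁ ∈ W) (h₂ : a₂ ∈ W) {r₁ r₂ : ℝ}
    (n₁ : ⟪a₁, a₁⟫ = r₁ ^ 2) (n₂ : ⟪a₂, a₂⟫ = r₂ ^ 2) (h₁₂ : ⟪a₁, a₂⟫ = 0) :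
    ∃ e₁ ∈ W, ∃ e₂ ∈ W, ‖e₁‖ = 1 ∧ ‖e₂‖ = 1 ∧ ⟪e₁, e₂⟫ = 0 ∧ a₁ = r₁ • e₁ ∧ a₂ = r₂ • e₂ := by
  let r : Fin 2 → ℝ := ![r₁, r₂]
  let a : Fin 2 → W := ![⟨a₁, h₁⟩, ⟨a₂, h₂⟩]
  have ha : ∀ i, ‖a i‖ = |r i| := by
    have key : ∀ (b : Eucl 4) (t : ℝ), ⟪b, b⟫ = t ^ 2 → ‖b‖ = |t| := fun b t hb => by
      rw [real_inner_self_eq_norm_sq] at hb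
      rw [← abs_norm]; exact (sq_eq_sq_iff_abs_eq_abs _ _).1 hb
    intro i; fin_cases i
    · exact key _ _ n₁
    · exact key _ _ n₂
  have hon : Orthonormal ℝ (({i | r i ≠ 0} : Set (Fin 2)).domRestrict fun i => (r i)⁻¹ • a i) := by
    constructor
    · rintro ⟨i, hi⟩
      have hi : r i ≠ 0 := hi
      rw [Set.domRestrict_apply, norm_smul, ha, norm_inv, Real.norm_eq_abs,
        inv_mul_cancel₀ (abs_ne_zero.2 hi)]
    · rintro ⟨i, hi⟩ ⟨j, hj⟩ hij
      have hij : i ≠ j := fun h => hij (Subtype.ext h)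
      have : ⟪(a i : Eucl 4), (a j : Eucl 4)⟫ = 0 := by
        fin_cases i <;> fin_cases j <;> simp_all [a, real_inner_comm]
      change ⟪(r i)⁻¹ • (a i : Eucl 4), (r j)⁻¹ • (a j : Eucl 4)⟫ = 0
      rw [real_inner_smul_left, real_inner_smul_right, this]; simp
  obtain ⟨b, hb⟩ := hon.exists_orthonormalBasis_extension_of_card_eq (by simp [hW])
  have hab : ∀ i, (a i : Eucl 4) = r i • (b i : Eucl 4) := by
    intro i
    by_cases hi : r i = 0
    · have := ha i
      rw [hi, abs_zero, norm_eq_zero] at this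
      simp [this, hi]
    · rw [hb i hi]; simp [hi]
  refine ⟨b 0, (b 0).2, b 1, (b 1).2, ?_, ?_, ?_, hab 0, hab 1⟩
  · exact b.orthonormal.1 0
  · exact b.orthonormal.1 1
  · exact b.orthonormal.2 (zero_ne_one (α := Fin 2))

/-- `N₁, N₂` complete `X₁, X₂` to an orthonormal basis in which the projector `Q` is block
diagonal, with blocks in the planes spanned by `Xᵢ, Nᵢ`. -/
structure AdaptedNormals (Q : Eucl 4 →L[ℝ] Eucl 4) (c₁ s₁ c₂ s₂ : ℝ)
    (X₁ X₂ N₁ N₂ : Eucl 4) : Prop where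
  on : Orthonormal ℝ ![X₁, N₁, X₂, N₂]
  map_X₁ : Q X₁ = c₁ ^ 2 • X₁ + (c₁ * s₁) • N₁
  map_N₁ : Q N₁ = (c₁ * s₁) • X₁ + s₁ ^ 2 • N₁
  map_X₂ : Q X₂ = c₂ ^ 2 • X₂ + (c₂ * s₂) • N₂
  map_N₂ : Q N₂ = (c₂ * s₂) • X₂ + s₂ ^ 2 • N₂

/-- Decompose Xᵢ = cᵢ wᵢ + sᵢ zᵢ along `W` and `Wᗮ`. The hypotheses say that the projections are
orthogonal with lengths |cᵢ| and |sᵢ|. The partner Nᵢ = sᵢ wᵢ − cᵢ zᵢ is Xᵢ rotated by a right angle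
in span(wᵢ, zᵢ), a plane that the projector preserves. -/
theorem exists_adaptedNormals {W : Submodule ℝ (Eucl 4)} (hW : Module.finrank ℝ W = 2)
    {X₁ X₂ : Eucl 4} {c₁ s₁ c₂ s₂ : ℝ} (h₁ : c₁ ^ 2 + s₁ ^ 2 = 1) (h₂ : c₂ ^ 2 + s₂ ^ 2 = 1)
    (n₁ : ‖X₁‖ = 1) (n₂ : ‖X₂‖ = 1) (h₁₂ : ⟪X₁, X₂⟫ = 0)
    (q₁ : ⟪W.starProjection X₁, X₁⟫ = c₁ ^ 2) (q₂ : ⟪W.starProjection X₂, X₂⟫ = c₂ ^ 2)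
    (q₁₂ : ⟪W.starProjection X₁, X₂⟫ = 0) :
    ∃ N₁ N₂, AdaptedNormals W.starProjection c₁ s₁ c₂ s₂ X₁ X₂ N₁ N₂ := by
  set Q := W.starProjection with hQ
  have hmem : ∀ u, Q u ∈ W := fun u => W.starProjection_apply_mem u
  have hsym : ∀ u v, ⟪Q u, v⟫ = ⟪u, Q v⟫ := fun u v => W.inner_starProjection_left_eq_right u v
  have hid : ∀ u ∈ W, Q u = u := fun u hu => W.starProjection_eq_self_iff.2 hu
  have hQQ : ∀ u v, ⟪Q u, Q v⟫ = ⟪Q u, v⟫ := fun u v => by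
    rw [hsym, hid _ (hmem v), hsym]
  have hperp : ∀ u, u - Q u ∈ Wᗮ := fun u => W.sub_starProjection_mem_orthogonal u
  have hWp : Module.finrank ℝ Wᗮ = 2 := by
    have := W.finrank_add_finrank_orthogonal
    simp only [hW, finrank_euclideanSpace, Fintype.card_fin] at this
    omega
  have hkill : ∀ u ∈ Wᗮ, Q u = 0 := fun u hu => by
    rw [hQ, Submodule.starProjection_apply_eq_zero_iff]; exact hu
  have i₁ : ⟪X₁, X₁⟫ = 1 := by rw [real_inner_self_eq_norm_sq, n₁]; norm_num
  have i₂ : ⟪X₂, X₂⟫ = 1 := by rw [real_inner_self_eq_norm_sq, n₂]; norm_num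
  obtain ⟨w₁, hw₁, w₂, hw₂, nw₁, nw₂, ow, ew₁, ew₂⟩ :=
    exists_orthonormal_of_orthogonal hW (hmem X₁) (hmem X₂) (r₁ := c₁) (r₂ := c₂)
      (by rw [hQQ, q₁]) (by rw [hQQ, q₂]) (by rw [hQQ, q₁₂])
  have expand : ∀ u v, ⟪u - Q u, v - Q v⟫ = ⟪u, v⟫ - ⟪Q u, v⟫ := fun u v => by
    simp only [inner_sub_left, inner_sub_right, hQQ]
    rw [← hsym]; ring
  obtain ⟨z₁, hz₁, z₂, hz₂, nz₁, nz₂, oz, ez₁, ez₂⟩ :=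
    exists_orthonormal_of_orthogonal hWp (hperp X₁) (hperp X₂) (r₁ := s₁) (r₂ := s₂)
      (by rw [expand, i₁, q₁]; linarith) (by rw [expand, i₂, q₂]; linarith)
      (by rw [expand, h₁₂, q₁₂]; ring)
  have ex₁ : X₁ = c₁ • w₁ + s₁ • z₁ := by rw [← ew₁, ← ez₁]; abel
  have ex₂ : X₂ = c₂ • w₂ + s₂ • z₂ := by rw [← ew₂, ← ez₂]; abel
  have hwz : ∀ w ∈ W, ∀ z ∈ Wᗮ, ⟪w, z⟫ = 0 := fun w hw z hz =>
    Submodule.inner_right_of_mem_orthogonal hw hz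
  have a₁ := hwz _ hw₁ _ hz₁
  have a₂ := hwz _ hw₁ _ hz₂
  have a₃ := hwz _ hw₂ _ hz₁
  have a₄ := hwz _ hw₂ _ hz₂
  have b₁ := real_inner_comm w₁ z₁
  have b₂ := real_inner_comm w₁ z₂
  have b₃ := real_inner_comm w₂ z₁
  have b₄ := real_inner_comm w₂ z₂
  have b₅ := real_inner_comm w₁ w₂
  have b₆ := real_inner_comm z₁ z₂
  refine ⟨s₁ • w₁ - c₁ • z₁, s₂ • w₂ - c₂ • z₂, ?_, ?_, ?_, ?_, ?_⟩
  · have m₁ : ‖s₁ • w₁ - c₁ • z₁‖ = 1 := by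
      rw [sub_eq_add_neg, ← neg_smul]
      exact inner_comb_self nw₁ nz₁ a₁ (by linarith)
    have m₂ : ‖s₂ • w₂ - c₂ • z₂‖ = 1 := by
      rw [sub_eq_add_neg, ← neg_smul]
      exact inner_comb_self nw₂ nz₂ a₄ (by linarith)
    refine ⟨fun i => by fin_cases i <;> simp [n₁, n₂, m₁, m₂], fun i j hij => ?_⟩
    fin_cases i <;> fin_cases j <;> first | exact absurd rfl hij | skip
    all_goals
      simp [ex₁, ex₂, inner_add_left, inner_add_right, inner_sub_left, inner_sub_right,
        inner_smul_left, inner_smul_right, nw₁, nw₂, nz₁, nz₂, a₁, a₂, a₃, a₄, b₁, b₂, b₃, b₄,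
        b₅, b₆, ow, oz]
      try ring
  · rw [ew₁, ex₁]
    have : c₁ = c₁ ^ 2 * c₁ + c₁ * s₁ * s₁ := by linear_combination -c₁ * h₁
    nth_rw 1 [this]; module
  · rw [map_sub, map_smul, map_smul, hid _ hw₁, hkill _ hz₁, ex₁]
    have : s₁ = c₁ * s₁ * c₁ + s₁ ^ 2 * s₁ := by linear_combination -s₁ * h₁
    nth_rw 1 [this]; module
  · rw [ew₂, ex₂]
    have : c₂ = c₂ ^ 2 * c₂ + c₂ * s₂ * s₂ := by linear_combination -c₂ * h₂
    nth_rw 1 [this]; module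
  · rw [map_sub, map_smul, map_smul, hid _ hw₂, hkill _ hz₂, ex₂]
    have : s₂ = c₂ * s₂ * c₂ + s₂ ^ 2 * s₂ := by linear_combination -s₂ * h₂
    nth_rw 1 [this]; module

/-- Expansion of a vector in an orthonormal basis of `ℝ⁴`. -/
theorem Orthonormal.expand_four {a b c d : Eucl 4} (h : Orthonormal ℝ ![a, b, c, d])
    (u : Eucl 4) : u = ⟪a, u⟫ • a + ⟪b, u⟫ • b + ⟪c, u⟫ • c + ⟪d, u⟫ • d := by
  let B := OrthonormalBasis.mk h (by
    rw [h.linearIndependent.span_eq_top_of_card_eq_finrank (by simp)])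
  have := B.sum_repr' u
  simp only [B, OrthonormalBasis.coe_mk, Fin.sum_univ_four, Matrix.cons_val] at this
  exact this.symm

theorem Orthonormal.inner_four {a b c d : Eucl 4} (h : Orthonormal ℝ ![a, b, c, d]) :
    (⟪a, a⟫ = 1 ∧ ⟪b, b⟫ = 1 ∧ ⟪c, c⟫ = 1 ∧ ⟪d, d⟫ = 1) ∧
    (⟪a, b⟫ = 0 ∧ ⟪a, c⟫ = 0 ∧ ⟪a, d⟫ = 0 ∧ ⟪b, c⟫ = 0 ∧ ⟪b, d⟫ = 0 ∧ ⟪c, d⟫ = 0) ∧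
    (⟪b, a⟫ = 0 ∧ ⟪c, a⟫ = 0 ∧ ⟪d, a⟫ = 0 ∧ ⟪c, b⟫ = 0 ∧ ⟪d, b⟫ = 0 ∧ ⟪d, c⟫ = 0) := by
  have := orthonormal_iff_ite.1 h
  refine ⟨⟨?_, ?_, ?_, ?_⟩, ⟨?_, ?_, ?_, ?_, ?_, ?_⟩, ?_, ?_, ?_, ?_, ?_, ?_⟩
  · simpa using this 0 0
  · simpa using this 1 1
  · simpa using this 2 2
  · simpa using this 3 3
  · simpa using this 0 1
  · simpa using this 0 2
  · simpa using this 0 3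
  · simpa using this 1 2
  · simpa using this 1 3
  · simpa using this 2 3
  · simpa using this 1 0
  · simpa using this 2 0
  · simpa using this 3 0
  · simpa using this 2 1
  · simpa using this 3 1
  · simpa using this 3 2

end PrincipalAngles

/-! ### Principal pairs and their infinitesimal rigidity -/

section PrincipalPairs

/-- An orthonormal pair that diagonalizes the compression of the projector onto `W`, with
eigenvalues `c₁ ^ 2` and `c₂ ^ 2`. -/
structure IsPrincipalPair (W : Submodule ℝ (Eucl 4)) (c₁ c₂ : ℝ) (X₁ X₂ : Eucl 4) : Prop where
  norm_left : ‖X₁‖ = 1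
  norm_right : ‖X₂‖ = 1
  ortho : ⟪X₁, X₂⟫ = 0
  left_left : ⟪W.starProjection X₁, X₁⟫ = c₁ ^ 2
  right_right : ⟪W.starProjection X₂, X₂⟫ = c₂ ^ 2
  left_right : ⟪W.starProjection X₁, X₂⟫ = 0

theorem IsPrincipalPair.swap {W : Submodule ℝ (Eucl 4)} {c₁ c₂ : ℝ} {X₁ X₂ : Eucl 4}
    (h : IsPrincipalPair W c₁ c₂ X₁ X₂) : IsPrincipalPair W c₂ c₁ X₂ X₁ where
  norm_left := h.norm_right
  norm_right := h.norm_left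
  ortho := by rw [real_inner_comm]; exact h.ortho
  left_left := h.right_right
  right_right := h.left_left
  left_right := by
    rw [W.inner_starProjection_left_eq_right, real_inner_comm]; exact h.left_right

theorem AdaptedNormals.swap {Q : Eucl 4 →L[ℝ] Eucl 4} {c₁ s₁ c₂ s₂ : ℝ} {X₁ X₂ N₁ N₂ : Eucl 4}
    (h : AdaptedNormals Q c₁ s₁ c₂ s₂ X₁ X₂ N₁ N₂) :
    AdaptedNormals Q c₂ s₂ c₁ s₁ X₂ X₁ N₂ N₁ where
  on := by
    have := h.on.comp ![2, 3, 0, 1] (by decide)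
    convert this using 1
    ext i j; fin_cases i <;> rfl
  map_X₁ := h.map_X₂
  map_N₁ := h.map_N₂
  map_X₂ := h.map_X₁
  map_N₂ := h.map_N₁

theorem inner_deriv_of_eventually_const {F E : Type*} [NormedAddCommGroup F] [NormedSpace ℝ F]
    [NormedAddCommGroup E] [InnerProductSpace ℝ E] {U V : F → E} {x : F} {c : ℝ}
    (L : E →L[ℝ] E) (hU : DifferentiableAt ℝ U x) (hV : DifferentiableAt ℝ V x)
    (h : ∀ᶠ y in 𝓝 x, ⟪L (U y), V y⟫ = c) (v : F) :
    ⟪L (fderiv ℝ U x v), V x⟫ + ⟪L (U x), fderiv ℝ V x v⟫ = 0 := by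
  have h1 : HasFDerivAt (fun y => ⟪L (U y), V y⟫) _ x :=
    (L.hasFDerivAt.comp x hU.hasFDerivAt).inner ℝ hV.hasFDerivAt
  have h2 : HasFDerivAt (fun y => ⟪L (U y), V y⟫) (0 : F →L[ℝ] ℝ) x :=
    (hasFDerivAt_const c x).congr_of_eventuallyEq h
  have := DFunLike.congr_fun (h1.unique h2) v
  simp at this
  linarith

variable {F : Type*} [NormedAddCommGroup F] [NormedSpace ℝ F]
  {W : Submodule ℝ (Eucl 4)} {c₁ s₁ c₂ s₂ : ℝ} {X₁ X₂ : F → Eucl 4} {x : F} {N₁ N₂ : Eucl 4}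

/-- If c₁s₁ ≠ 0, differentiating ⟨QX₁, X₁⟩ = c₁² gives c₁s₁⟨N₁, dX₁⟩ = 0, because ⟨X₁, dX₁⟩ = 0. If
c₁s₁ = 0 that relation is empty, but X₁ is then an eigenvector of `Q` at every nearby point. So dX₁
stays in the eigenspace of c₁², whereas N₁ has the other eigenvalue s₁² ∈ {0, 1}. -/
theorem IsPrincipalPair.deriv_left_normal (hW : Module.finrank ℝ W = 2)
    (h₁ : c₁ ^ 2 + s₁ ^ 2 = 1) (h₂ : c₂ ^ 2 + s₂ ^ 2 = 1)
    (h : ∀ᶠ y in 𝓝 x, IsPrincipalPair W c₁ c₂ (X₁ y) (X₂ y))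
    (d₁ : DifferentiableAt ℝ X₁ x)
    (hN : AdaptedNormals W.starProjection c₁ s₁ c₂ s₂ (X₁ x) (X₂ x) N₁ N₂) (v : F) :
    ⟪N₁, fderiv ℝ X₁ x v⟫ = 0 := by
  set Q := W.starProjection with hQ
  have hsym : ∀ u v, ⟪Q u, v⟫ = ⟪u, Q v⟫ := fun u v => W.inner_starProjection_left_eq_right u v
  have hX := inner_deriv_of_eventually_const (ContinuousLinearMap.id ℝ (Eucl 4)) d₁ d₁
    (c := 1) (h.mono fun y hy => by simp [hy.norm_left]) v
  simp only [ContinuousLinearMap.id_apply, real_inner_comm (X₁ x)] at hX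
  by_cases hk : c₁ * s₁ = 0
  · have hev : ∀ᶠ y in 𝓝 x, Q (X₁ y) = c₁ ^ 2 • X₁ y := by
      filter_upwards [h] with y hy
      obtain ⟨M₁, M₂, hM⟩ := exists_adaptedNormals hW h₁ h₂ hy.norm_left hy.norm_right hy.ortho
        hy.left_left hy.right_right hy.left_right
      rw [hM.map_X₁, hk, zero_smul, add_zero]
    have e1 : HasFDerivAt (fun y => Q (X₁ y)) (Q.comp (fderiv ℝ X₁ x)) x :=
      Q.hasFDerivAt.comp x d₁.hasFDerivAt
    have e2 : HasFDerivAt (fun y => Q (X₁ y)) (c₁ ^ 2 • fderiv ℝ X₁ x) x :=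
      (d₁.hasFDerivAt.const_smul (c₁ ^ 2)).congr_of_eventuallyEq hev
    have e3 := DFunLike.congr_fun (e1.unique e2) v
    simp only [ContinuousLinearMap.comp_apply, smul_apply] at e3
    have e4 : ⟪N₁, Q (fderiv ℝ X₁ x v)⟫ = s₁ ^ 2 * ⟪N₁, fderiv ℝ X₁ x v⟫ := by
      rw [← hsym, hN.map_N₁, hk, zero_smul, zero_add, real_inner_smul_left]
    rw [e3, real_inner_smul_right] at e4
    rcases mul_eq_zero.1 hk with hc | hs
    · rw [hc] at e4 h₁
      have : s₁ ^ 2 = 1 := by linarith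
      rw [this] at e4; linarith
    · rw [hs] at e4 h₁
      have : c₁ ^ 2 = 1 := by linarith
      rw [this] at e4; linarith
  · have hq := inner_deriv_of_eventually_const Q d₁ d₁ (h.mono fun y hy => hy.left_left) v
    rw [hsym, real_inner_comm, hN.map_X₁, inner_add_left, real_inner_smul_left,
      real_inner_smul_left] at hq
    have : c₁ * s₁ * ⟪N₁, fderiv ℝ X₁ x v⟫ = 0 := by
      linear_combination hq / 2 - c₁ ^ 2 / 2 * hX
    exact (mul_eq_zero.1 this).resolve_left hk

/-- The derivative of a field of principal pairs. -/
theorem IsPrincipalPair.deriv (hW : Module.finrank ℝ W = 2)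
    (h₁ : c₁ ^ 2 + s₁ ^ 2 = 1) (h₂ : c₂ ^ 2 + s₂ ^ 2 = 1)
    (h : ∀ᶠ y in 𝓝 x, IsPrincipalPair W c₁ c₂ (X₁ y) (X₂ y))
    (d₁ : DifferentiableAt ℝ X₁ x) (d₂ : DifferentiableAt ℝ X₂ x)
    (hN : AdaptedNormals W.starProjection c₁ s₁ c₂ s₂ (X₁ x) (X₂ x) N₁ N₂) (v : F) :
    ⟪X₁ x, fderiv ℝ X₁ x v⟫ = 0 ∧ ⟪X₂ x, fderiv ℝ X₂ x v⟫ = 0 ∧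
    ⟪X₁ x, fderiv ℝ X₂ x v⟫ = -⟪X₂ x, fderiv ℝ X₁ x v⟫ ∧
    ⟪N₁, fderiv ℝ X₁ x v⟫ = 0 ∧ ⟪N₂, fderiv ℝ X₂ x v⟫ = 0 ∧
    (c₁ ^ 2 - c₂ ^ 2) * ⟪X₂ x, fderiv ℝ X₁ x v⟫ =
      c₂ * s₂ * ⟪N₂, fderiv ℝ X₁ x v⟫ + c₁ * s₁ * ⟪N₁, fderiv ℝ X₂ x v⟫ := by
  have hsym : ∀ u v, ⟪W.starProjection u, v⟫ = ⟪u, W.starProjection v⟫ :=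
    fun u v => W.inner_starProjection_left_eq_right u v
  have e₁ := inner_deriv_of_eventually_const (ContinuousLinearMap.id ℝ (Eucl 4)) d₁ d₁
    (c := 1) (h.mono fun y hy => by simp [hy.norm_left]) v
  have e₂ := inner_deriv_of_eventually_const (ContinuousLinearMap.id ℝ (Eucl 4)) d₂ d₂
    (c := 1) (h.mono fun y hy => by simp [hy.norm_right]) v
  have e₃ := inner_deriv_of_eventually_const (ContinuousLinearMap.id ℝ (Eucl 4)) d₁ d₂
    (h.mono fun y hy => hy.ortho) v
  simp only [ContinuousLinearMap.id_apply] at e₁ e₂ e₃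
  rw [real_inner_comm] at e₁ e₂ e₃
  have hq := inner_deriv_of_eventually_const W.starProjection d₁ d₂
    (h.mono fun y hy => hy.left_right) v
  rw [hsym, real_inner_comm, hN.map_X₁, hN.map_X₂, inner_add_left, inner_add_left] at hq
  simp only [real_inner_smul_left] at hq
  refine ⟨by linarith, by linarith, by linarith,
    IsPrincipalPair.deriv_left_normal hW h₁ h₂ h d₁ hN v,
    IsPrincipalPair.deriv_left_normal hW h₂ h₁ (h.mono fun y hy => hy.swap) d₂ hN.swap v, ?_⟩
  linear_combination (-1 : ℝ) * hq + c₁ ^ 2 * e₃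

end PrincipalPairs

/-! ### Partial derivatives of smooth maps on the plane -/

section PartialDerivatives

variable {F : Type*} [NormedAddCommGroup F] [NormedSpace ℝ F] {h : Eucl 2 → F} {U : Set (Eucl 2)}

theorem ContDiffOn.fderiv_apply_const (hh : ContDiffOn ℝ ∞ h U) (hU : IsOpen U) (v : Eucl 2) :
    ContDiffOn ℝ ∞ (fun x => fderiv ℝ h x v) U :=
  (hh.fderiv_of_isOpen hU (m := ∞) (by simp)).clm_apply contDiffOn_const

theorem ContDiffOn.partialD (hh : ContDiffOn ℝ ∞ h U) (hU : IsOpen U) (i : Fin 2) :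
    ContDiffOn ℝ ∞ (partialD i h) U :=
  hh.fderiv_apply_const hU _

theorem ContDiffOn.differentiableAt_of_isOpen (hh : ContDiffOn ℝ ∞ h U) (hU : IsOpen U)
    {x : Eucl 2} (hx : x ∈ U) : DifferentiableAt ℝ h x :=
  (hh.contDiffAt (hU.mem_nhds hx)).differentiableAt (by simp)

theorem ContDiffOn.fderiv_fderiv_comm (hh : ContDiffOn ℝ ∞ h U) (hU : IsOpen U)
    {x : Eucl 2} (hx : x ∈ U) (v w : Eucl 2) :
    fderiv ℝ (fderiv ℝ h) x v w = fderiv ℝ (fderiv ℝ h) x w v :=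
  ((hh.contDiffAt (hU.mem_nhds hx)).isSymmSndFDerivAt (by simpa using ENat.LEInfty.out)).eq v w

theorem ContDiffOn.fderiv_fderiv_apply (hh : ContDiffOn ℝ ∞ h U) (hU : IsOpen U)
    {x : Eucl 2} (hx : x ∈ U) (v w : Eucl 2) :
    fderiv ℝ (fun y => fderiv ℝ h y w) x v = fderiv ℝ (fderiv ℝ h) x v w := by
  have hd : DifferentiableAt ℝ (fderiv ℝ h) x :=
    (hh.fderiv_of_isOpen hU (m := ∞) (by simp)).differentiableAt_of_isOpen hU hx
  rw [fderiv_clm_apply hd (differentiableAt_const w)]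
  simp

theorem ContDiffOn.partialD_comm (hh : ContDiffOn ℝ ∞ h U) (hU : IsOpen U)
    {x : Eucl 2} (hx : x ∈ U) (i j : Fin 2) :
    _root_.partialD i (_root_.partialD j h) x = _root_.partialD j (_root_.partialD i h) x := by
  have := hh.fderiv_fderiv_comm hU hx (EuclideanSpace.single i 1) (EuclideanSpace.single j 1)
  rw [← hh.fderiv_fderiv_apply hU hx, ← hh.fderiv_fderiv_apply hU hx] at this
  exact this

theorem partialD_inner {u v : Eucl 2 → Eucl 4} {x : Eucl 2} (hu : DifferentiableAt ℝ u x)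
    (hv : DifferentiableAt ℝ v x) (i : Fin 2) :
    partialD i (fun y => ⟪u y, v y⟫) x = ⟪partialD i u x, v x⟫ + ⟪u x, partialD i v x⟫ := by
  unfold partialD
  rw [fderiv_inner_apply ℝ hu hv]; ring

theorem partialD_mul {u v : Eucl 2 → ℝ} {x : Eucl 2} (hu : DifferentiableAt ℝ u x)
    (hv : DifferentiableAt ℝ v x) (i : Fin 2) :
    partialD i (fun y => u y * v y) x = partialD i u x * v x + u x * partialD i v x := by
  unfold partialD
  rw [fderiv_fun_mul hu hv]
  simp; ring

theorem partialD_smul {u : Eucl 2 → ℝ} {v : Eucl 2 → F} {x : Eucl 2}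
    (hu : DifferentiableAt ℝ u x) (hv : DifferentiableAt ℝ v x) (i : Fin 2) :
    partialD i (fun y => u y • v y) x = partialD i u x • v x + u x • partialD i v x := by
  unfold partialD
  rw [fderiv_fun_smul hu hv]
  simp [add_comm]

theorem partialD_add {u v : Eucl 2 → F} {x : Eucl 2} (hu : DifferentiableAt ℝ u x)
    (hv : DifferentiableAt ℝ v x) (i : Fin 2) :
    partialD i (fun y => u y + v y) x = partialD i u x + partialD i v x := by
  unfold partialD
  rw [fderiv_fun_add hu hv]; rfl

theorem partialD_sub {u v : Eucl 2 → F} {x : Eucl 2} (hu : DifferentiableAt ℝ u x)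
    (hv : DifferentiableAt ℝ v x) (i : Fin 2) :
    partialD i (fun y => u y - v y) x = partialD i u x - partialD i v x := by
  unfold partialD
  rw [fderiv_fun_sub hu hv]; rfl

theorem partialD_congr {u v : Eucl 2 → F} {x : Eucl 2} (huv : u =ᶠ[𝓝 x] v) (i : Fin 2) :
    partialD i u x = partialD i v x := by
  unfold partialD
  rw [huv.fderiv_eq]

end PartialDerivatives

/-! ### The Gauss equation -/

section GaussEquation

variable {φ : Eucl 2 → Eucl 4} {U : Set (Eucl 2)}

theorem fderiv_eq_partialD_comb (x v : Eucl 2) :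
    fderiv ℝ φ x v = v 0 • partialD 0 φ x + v 1 • partialD 1 φ x := by
  have : v = v 0 • EuclideanSpace.single 0 (1 : ℝ) + v 1 • EuclideanSpace.single 1 (1 : ℝ) := by
    ext i; fin_cases i <;> simp
  conv_lhs => rw [this]
  simp [partialD]

theorem metricMatrix_det_ne_zero {x : Eucl 2} (hinj : Function.Injective (fderiv ℝ φ x)) :
    (metricMatrix φ x).det ≠ 0 := by
  intro h0
  rw [Matrix.det_fin_two] at h0
  simp only [metricMatrix, Matrix.of_apply] at h0
  set a := partialD 0 φ x
  set b := partialD 1 φ x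
  have hb : b ≠ 0 := by
    intro hb
    have : fderiv ℝ φ x (EuclideanSpace.single 1 1) = fderiv ℝ φ x 0 :=
      hb.trans (map_zero _).symm
    have := congrArg (fun v : Eucl 2 => v 1) (hinj this)
    simp at this
  -- The image of this vector has squared norm g₁₁ · det g, so a degenerate Gram matrix would give a
  -- kernel vector of the differential.
  have key : fderiv ℝ φ x (!₂[⟪b, b⟫, -⟪a, b⟫]) = 0 := by
    rw [fderiv_eq_partialD_comb]
    change (⟪b, b⟫ : ℝ) • a + (-⟪a, b⟫) • b = 0
    rw [← inner_self_eq_zero (𝕜 := ℝ)]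
    simp only [inner_add_left, inner_add_right, real_inner_smul_left, real_inner_smul_right]
    rw [real_inner_comm a b]
    rw [real_inner_comm a b] at h0
    linear_combination ⟪b, b⟫ * h0
  have := congrArg (fun v : Eucl 2 => v 0) (hinj (key.trans (map_zero _).symm))
  simp at this
  exact hb this

theorem metricMatrix_comm (x : Eucl 2) (i j : Fin 2) :
    metricMatrix φ x i j = metricMatrix φ x j i := by
  simp only [metricMatrix, Matrix.of_apply]; exact real_inner_comm _ _

theorem ContDiffOn.metricMatrix (hφ : ContDiffOn ℝ ∞ φ U) (hU : IsOpen U) (i j : Fin 2) :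
    ContDiffOn ℝ ∞ (fun y => metricMatrix φ y i j) U :=
  (hφ.partialD hU i).inner ℝ (hφ.partialD hU j)

theorem partialD_metricMatrix (hφ : ContDiffOn ℝ ∞ φ U) (hU : IsOpen U) {x : Eucl 2} (hx : x ∈ U)
    (i j l : Fin 2) : partialD i (fun y => metricMatrix φ y j l) x =
      ⟪partialD i (partialD j φ) x, partialD l φ x⟫ +
        ⟪partialD i (partialD l φ) x, partialD j φ x⟫ := by
  rw [real_inner_comm (partialD j φ x)]
  exact partialD_inner ((hφ.partialD hU j).differentiableAt_of_isOpen hU hx)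
    ((hφ.partialD hU l).differentiableAt_of_isOpen hU hx) i

theorem ContDiffOn.metricMatrix_inv (hφ : ContDiffOn ℝ ∞ φ U) (hU : IsOpen U)
    (hinj : ∀ x ∈ U, Function.Injective (fderiv ℝ φ x)) (k l : Fin 2) :
    ContDiffOn ℝ ∞ (fun x => (_root_.metricMatrix φ x)⁻¹ k l) U := by
  have hg := hφ.metricMatrix hU
  have hdet : ContDiffOn ℝ ∞ (fun x => (_root_.metricMatrix φ x).det) U := by
    simp only [Matrix.det_fin_two]
    exact ((hg 0 0).mul (hg 1 1)).sub ((hg 0 1).mul (hg 1 0))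
  have hadj : ContDiffOn ℝ ∞ (fun x => (_root_.metricMatrix φ x).adjugate k l) U := by
    simp only [Matrix.adjugate_fin_two]
    fin_cases k <;> fin_cases l
    · exact hg 1 1
    · exact (hg 0 1).neg
    · exact (hg 1 0).neg
    · exact hg 0 0
  simp only [Matrix.inv_def, Ring.inverse_eq_inv', Matrix.smul_apply, smul_eq_mul]
  exact (hdet.inv fun x hx => metricMatrix_det_ne_zero (hinj x hx)).mul hadj

theorem ContDiffOn.christoffelSymbol (hφ : ContDiffOn ℝ ∞ φ U) (hU : IsOpen U)
    (hinj : ∀ x ∈ U, Function.Injective (fderiv ℝ φ x)) (k i j : Fin 2) :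
    ContDiffOn ℝ ∞ (christoffelSymbol φ k i j) U := by
  have hg := hφ.metricMatrix hU
  have hinv := hφ.metricMatrix_inv hU hinj
  unfold _root_.christoffelSymbol
  simp only [Fin.sum_univ_two]
  exact contDiffOn_const.mul
    (((hinv k 0).mul ((((hg j 0).partialD hU i).add ((hg i 0).partialD hU j)).sub
      ((hg i j).partialD hU 0))).add
    ((hinv k 1).mul ((((hg j 1).partialD hU i).add ((hg i 1).partialD hU j)).sub
      ((hg i j).partialD hU 1))))

/-- Symmetry of second derivatives collapses the bracket in the Christoffel formula to 2⟨∂ᵢ∂ⱼφ,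
∂ₗφ⟩. So the symbols are the tangential coefficients of ∂ᵢ∂ⱼφ, the form in which the Gauss equation
uses them. -/
theorem christoffelSymbol_spec (hφ : ContDiffOn ℝ ∞ φ U) (hU : IsOpen U)
    (hinj : ∀ x ∈ U, Function.Injective (fderiv ℝ φ x)) {x : Eucl 2} (hx : x ∈ U)
    (i j l : Fin 2) :
    metricMatrix φ x l 0 * christoffelSymbol φ 0 i j x +
      metricMatrix φ x l 1 * christoffelSymbol φ 1 i j x =
      ⟪partialD i (partialD j φ) x, partialD l φ x⟫ := by
  set g := metricMatrix φ x with hg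
  have hunit : IsUnit g.det := (metricMatrix_det_ne_zero (hinj x hx)).isUnit
  have hmul := Matrix.mul_nonsing_inv g hunit
  have hl0 := congrFun (congrFun hmul l) 0
  have hl1 := congrFun (congrFun hmul l) 1
  simp only [Matrix.mul_apply, Fin.sum_univ_two] at hl0 hl1
  have hb : ∀ l : Fin 2, partialD i (fun y => metricMatrix φ y j l) x +
      partialD j (fun y => metricMatrix φ y i l) x - partialD l (fun y => metricMatrix φ y i j) x
      = 2 * ⟪partialD i (partialD j φ) x, partialD l φ x⟫ := by
    intro l
    rw [partialD_metricMatrix hφ hU hx, partialD_metricMatrix hφ hU hx,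
      partialD_metricMatrix hφ hU hx, hφ.partialD_comm hU hx i l, hφ.partialD_comm hU hx j l,
      hφ.partialD_comm hU hx j i]
    ring
  simp only [christoffelSymbol, Fin.sum_univ_two, hb, ← hg]
  fin_cases l
  · simp only [Fin.zero_eta, Fin.isValue, Matrix.one_apply_eq, ne_eq, Matrix.one_apply,
      zero_ne_one, if_false, if_true] at hl0 hl1 ⊢
    linear_combination ⟪partialD i (partialD j φ) x, partialD 0 φ x⟫ * hl0 +
      ⟪partialD i (partialD j φ) x, partialD 1 φ x⟫ * hl1
  · simp only [Fin.mk_one, Fin.isValue, Matrix.one_apply_eq, ne_eq, Matrix.one_apply,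
      one_ne_zero, if_false, if_true] at hl0 hl1 ⊢
    linear_combination ⟪partialD i (partialD j φ) x, partialD 0 φ x⟫ * hl0 +
      ⟪partialD i (partialD j φ) x, partialD 1 φ x⟫ * hl1

/-- The Gauss equation, in terms of any vectors `ν₁₁, ν₀₁` normal to the surface that differ from
the second derivatives by tangent vectors. -/
theorem gauss_equation (hφ : ContDiffOn ℝ ∞ φ U) (hU : IsOpen U)
    (hinj : ∀ x ∈ U, Function.Injective (fderiv ℝ φ x)) {x : Eucl 2} (hx : x ∈ U) :
    ∃ ν₁₁ ν₀₁ : Eucl 4, (∀ l, ⟪ν₁₁, partialD l φ x⟫ = 0) ∧ (∀ l, ⟪ν₀₁, partialD l φ x⟫ = 0) ∧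
      (∃ v, partialD 1 (partialD 1 φ) x - ν₁₁ = fderiv ℝ φ x v) ∧
      (∃ v, partialD 0 (partialD 1 φ) x - ν₀₁ = fderiv ℝ φ x v) ∧
      ∑ l : Fin 2, metricMatrix φ x 0 l * riemannCoeff φ l 0 1 1 x =
        ⟪partialD 0 (partialD 0 φ) x, ν₁₁⟫ - ⟪partialD 0 (partialD 1 φ) x, ν₀₁⟫ := by
  have hspec := fun y hy => christoffelSymbol_spec hφ hU hinj (x := y) hy
  have hΓ := fun k i j => (hφ.christoffelSymbol hU hinj k i j).differentiableAt_of_isOpen hU hx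
  have hgd := fun i j => (hφ.metricMatrix hU i j).differentiableAt_of_isOpen hU hx
  have hd1 := fun i => (hφ.partialD hU i).differentiableAt_of_isOpen hU hx
  have hd2 := fun i j => ((hφ.partialD hU i).partialD hU j).differentiableAt_of_isOpen hU hx
  have hdspec : ∀ m i j : Fin 2,
      partialD m (fun y => metricMatrix φ y 0 0) x * christoffelSymbol φ 0 i j x +
      metricMatrix φ x 0 0 * partialD m (christoffelSymbol φ 0 i j) x +
      (partialD m (fun y => metricMatrix φ y 0 1) x * christoffelSymbol φ 1 i j x +
      metricMatrix φ x 0 1 * partialD m (christoffelSymbol φ 1 i j) x) =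
      ⟪partialD m (partialD i (partialD j φ)) x, partialD 0 φ x⟫ +
        ⟪partialD m (partialD 0 φ) x, partialD i (partialD j φ) x⟫ := by
    intro m i j
    rw [real_inner_comm (partialD i (partialD j φ) x), ← partialD_mul (hgd 0 0) (hΓ 0 i j), ← partialD_mul (hgd 0 1) (hΓ 1 i j),
      ← partialD_add (u := fun y => metricMatrix φ y 0 0 * christoffelSymbol φ 0 i j y)
        (v := fun y => metricMatrix φ y 0 1 * christoffelSymbol φ 1 i j y)
        ((hgd 0 0).mul (hΓ 0 i j)) ((hgd 0 1).mul (hΓ 1 i j)),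
      ← partialD_inner (hd2 j i) (hd1 0)]
    apply partialD_congr
    filter_upwards [hU.mem_nhds hx] with y hy using hspec y hy i j 0
  -- `A` and `B` differentiate the defining relations of Γ₁₁ along ∂₀ and of Γ₀₁ along ∂₁. In the
  -- difference the third derivatives cancel, and what remains is the lowered curvature component
  -- against products of second derivatives.
  have A := hdspec 0 1 1
  have B := hdspec 1 0 1
  have hc3 : partialD 0 (partialD 1 (partialD 1 φ)) x = partialD 1 (partialD 0 (partialD 1 φ)) x :=
    (hφ.partialD hU 1).partialD_comm hU hx 0 1
  have hc : partialD 1 (partialD 0 φ) x = partialD 0 (partialD 1 φ) x :=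
    hφ.partialD_comm hU hx 1 0
  rw [hc3] at A
  rw [hc] at B
  rw [partialD_metricMatrix hφ hU hx, partialD_metricMatrix hφ hU hx] at A B
  rw [hc] at B
  set Γ := fun k i j => christoffelSymbol φ k i j x with hΓdef
  refine ⟨partialD 1 (partialD 1 φ) x - (Γ 0 1 1 • partialD 0 φ x + Γ 1 1 1 • partialD 1 φ x),
    partialD 0 (partialD 1 φ) x - (Γ 0 0 1 • partialD 0 φ x + Γ 1 0 1 • partialD 1 φ x),
    fun l => ?_, fun l => ?_, ⟨!₂[Γ 0 1 1, Γ 1 1 1], ?_⟩, ⟨!₂[Γ 0 0 1, Γ 1 0 1], ?_⟩, ?_⟩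
  · have := hspec x hx 1 1 l
    rw [inner_sub_left, inner_add_left, real_inner_smul_left, real_inner_smul_left, ← this]
    rw [metricMatrix_comm x l 0, metricMatrix_comm x l 1]
    simp only [metricMatrix, Matrix.of_apply, hΓdef]
    ring
  · have := hspec x hx 0 1 l
    rw [inner_sub_left, inner_add_left, real_inner_smul_left, real_inner_smul_left, ← this]
    rw [metricMatrix_comm x l 0, metricMatrix_comm x l 1]
    simp only [metricMatrix, Matrix.of_apply, hΓdef]
    ring
  · rw [fderiv_eq_partialD_comb]; simp
  · rw [fderiv_eq_partialD_comb]; simp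
  · have s00 := hspec x hx 0 0 0
    have s01 := hspec x hx 0 1 0
    have s10 := hspec x hx 1 0 0
    have s11 := hspec x hx 1 1 0
    rw [hc] at s10
    simp only [riemannCoeff, Fin.sum_univ_two, inner_sub_right, inner_add_right,
      real_inner_smul_right]
    simp only [hΓdef]
    linear_combination A - B + christoffelSymbol φ 0 1 1 x * s00 +
      christoffelSymbol φ 1 1 1 x * s01 - christoffelSymbol φ 0 0 1 x * s10 -
      christoffelSymbol φ 1 0 1 x * s11

end GaussEquation

/-! ### Smooth principal frames of parametrized surfaces -/

section PrincipalFrames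

/-- A smooth frame `X₁, X₂` of the tangent planes of `φ` over `U` consisting of principal pairs. -/
structure PrincipalFrame (W : Submodule ℝ (Eucl 4)) (c₁ c₂ : ℝ) (φ X₁ X₂ : Eucl 2 → Eucl 4)
    (U : Set (Eucl 2)) : Prop where
  isOpen : IsOpen U
  smooth : ContDiffOn ℝ ∞ φ U
  inj : ∀ x ∈ U, Function.Injective (fderiv ℝ φ x)
  smooth_left : ContDiffOn ℝ ∞ X₁ U
  smooth_right : ContDiffOn ℝ ∞ X₂ U
  mem_left : ∀ x ∈ U, X₁ x ∈ (fderiv ℝ φ x).range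
  mem_right : ∀ x ∈ U, X₂ x ∈ (fderiv ℝ φ x).range
  pair : ∀ x ∈ U, IsPrincipalPair W c₁ c₂ (X₁ x) (X₂ x)

theorem PrincipalFrame.swap {W : Submodule ℝ (Eucl 4)} {c₁ c₂ : ℝ} {φ X₁ X₂ : Eucl 2 → Eucl 4}
    {U : Set (Eucl 2)} (h : PrincipalFrame W c₁ c₂ φ X₁ X₂ U) :
    PrincipalFrame W c₂ c₁ φ X₂ X₁ U :=
  ⟨h.isOpen, h.smooth, h.inj, h.smooth_right, h.smooth_left, h.mem_right, h.mem_left,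
    fun x hx => (h.pair x hx).swap⟩

variable {W : Submodule ℝ (Eucl 4)} {c₁ s₁ c₂ s₂ : ℝ} {φ X₁ X₂ : Eucl 2 → Eucl 4}
  {U : Set (Eucl 2)}

theorem finrank_range_fderiv {x : Eucl 2} (h : Function.Injective (fderiv ℝ φ x)) :
    Module.finrank ℝ (fderiv ℝ φ x).range = 2 := by
  have := LinearMap.finrank_range_of_inj (f := (fderiv ℝ φ x).toLinearMap) h
  simpa using this

theorem eq_comb_of_mem_plane {T : Submodule ℝ (Eucl 4)} (hT : Module.finrank ℝ T = 2)
    {w₁ w₂ : Eucl 4} (h₁ : w₁ ∈ T) (h₂ : w₂ ∈ T)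
    (n₁ : ‖w₁‖ = 1) (n₂ : ‖w₂‖ = 1) (h₁₂ : ⟪w₁, w₂⟫ = 0) {u : Eucl 4} (hu : u ∈ T) :
    u = ⟪w₁, u⟫ • w₁ + ⟪w₂, u⟫ • w₂ := by
  rw [← starProjection_eq_of_orthonormal_pair hT h₁ h₂ n₁ n₂ h₁₂ u]
  exact (T.starProjection_eq_self_iff.2 hu).symm

theorem ContDiffOn.normalize {u : Eucl 2 → Eucl 4} (hu : ContDiffOn ℝ ∞ u U)
    (h0 : ∀ x ∈ U, u x ≠ 0) : ContDiffOn ℝ ∞ (fun x => ‖u x‖⁻¹ • u x) U :=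
  ((hu.norm ℝ h0).inv fun x hx => norm_ne_zero_iff.2 (h0 x hx)).smul hu

theorem norm_normalize {u : Eucl 4} (h0 : u ≠ 0) : ‖‖u‖⁻¹ • u‖ = 1 := by
  rw [norm_smul, norm_inv, norm_norm, inv_mul_cancel₀ (norm_ne_zero_iff.2 h0)]

/-- The Gram-Schmidt frame of a parametrized surface. -/
theorem exists_orthonormal_frame (hU : IsOpen U) (hφ : ContDiffOn ℝ ∞ φ U)
    (hinj : ∀ x ∈ U, Function.Injective (fderiv ℝ φ x)) :
    ∃ Z₁ Z₂ : Eucl 2 → Eucl 4, ContDiffOn ℝ ∞ Z₁ U ∧ ContDiffOn ℝ ∞ Z₂ U ∧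
      ∀ x ∈ U, Z₁ x ∈ (fderiv ℝ φ x).range ∧ Z₂ x ∈ (fderiv ℝ φ x).range ∧
        ‖Z₁ x‖ = 1 ∧ ‖Z₂ x‖ = 1 ∧ ⟪Z₁ x, Z₂ x⟫ = 0 := by
  have hmem : ∀ (i : Fin 2) (x : Eucl 2), partialD i φ x ∈ (fderiv ℝ φ x).range :=
    fun i x => ⟨_, rfl⟩
  have h0 : ∀ x ∈ U, partialD 0 φ x ≠ 0 := by
    intro x hx h
    have := congrArg (fun v : Eucl 2 => v 0) (hinj x hx (h.trans (map_zero _).symm))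
    simp at this
  set Z₁ : Eucl 2 → Eucl 4 := fun x => ‖partialD 0 φ x‖⁻¹ • partialD 0 φ x with hZ₁
  have s₁ : ContDiffOn ℝ ∞ Z₁ U := (hφ.partialD hU 0).normalize h0
  have n₁ : ∀ x ∈ U, ‖Z₁ x‖ = 1 := fun x hx => norm_normalize (h0 x hx)
  set Y : Eucl 2 → Eucl 4 := fun x => partialD 1 φ x - ⟪Z₁ x, partialD 1 φ x⟫ • Z₁ x with hY
  have sY : ContDiffOn ℝ ∞ Y U :=
    (hφ.partialD hU 1).sub ((s₁.inner ℝ (hφ.partialD hU 1)).smul s₁)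
  have hY0 : ∀ x ∈ U, Y x ≠ 0 := by
    intro x hx h
    have e : fderiv ℝ φ x
        (!₂[-(⟪Z₁ x, partialD 1 φ x⟫ * ‖partialD 0 φ x‖⁻¹), 1]) = 0 := by
      rw [fderiv_eq_partialD_comb, ← h]
      simp [hY, hZ₁, smul_smul, sub_eq_add_neg, add_comm]
    have := congrArg (fun v : Eucl 2 => v 1) (hinj x hx (e.trans (map_zero _).symm))
    simp at this
  have m₁ : ∀ x, Z₁ x ∈ (fderiv ℝ φ x).range := fun x => Submodule.smul_mem _ _ (hmem 0 x)
  refine ⟨Z₁, fun x => ‖Y x‖⁻¹ • Y x, s₁, sY.normalize hY0, fun x hx => ⟨m₁ x,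
    Submodule.smul_mem _ _ (Submodule.sub_mem _ (hmem 1 x) (Submodule.smul_mem _ _ (m₁ x))),
    n₁ x hx, norm_normalize (hY0 x hx), ?_⟩⟩
  rw [real_inner_smul_right, hY, inner_sub_right, real_inner_smul_right,
    real_inner_self_eq_norm_sq, n₁ x hx]
  ring

/-- The bilinear conditions on a principal pair amount to the spectral decomposition of the
compression of the projector to `T`; this is what makes smooth spectral projections available below.
-/
theorem compression_eq_comb {T : Submodule ℝ (Eucl 4)} (hT : Module.finrank ℝ T = 2)
    {A₁ A₂ : Eucl 4} (h₁ : A₁ ∈ T) (h₂ : A₂ ∈ T) (h : IsPrincipalPair W c₁ c₂ A₁ A₂)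
    {u : Eucl 4} (hu : u ∈ T) :
    T.starProjection (W.starProjection u) =
      (c₁ ^ 2 * ⟪A₁, u⟫) • A₁ + (c₂ ^ 2 * ⟪A₂, u⟫) • A₂ := by
  have e := eq_comb_of_mem_plane hT h₁ h₂ h.norm_left h.norm_right h.ortho hu
  have hs : ∀ v w, ⟪v, W.starProjection w⟫ = ⟪W.starProjection v, w⟫ := fun v w =>
    (W.inner_starProjection_left_eq_right v w).symm
  rw [starProjection_eq_of_orthonormal_pair hT h₁ h₂ h.norm_left h.norm_right h.ortho]
  have e1 : ⟪A₁, W.starProjection u⟫ = c₁ ^ 2 * ⟪A₁, u⟫ := by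
    conv_lhs => rw [e]
    rw [hs, inner_add_right, real_inner_smul_right, real_inner_smul_right, h.left_left,
      h.left_right]
    ring
  have e2 : ⟪A₂, W.starProjection u⟫ = c₂ ^ 2 * ⟪A₂, u⟫ := by
    conv_lhs => rw [e]
    rw [hs, inner_add_right, real_inner_smul_right, real_inner_smul_right, h.right_right,
      h.swap.left_right]
    ring
  rw [e1, e2]

theorem IsPrincipalPair.of_unit_multiples {A₁ A₂ B₁ B₂ : Eucl 4} {a b : ℝ}
    (h : IsPrincipalPair W c₁ c₂ A₁ A₂) (e₁ : B₁ = a • A₁) (e₂ : B₂ = b • A₂)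
    (n₁ : ‖B₁‖ = 1) (n₂ : ‖B₂‖ = 1) : IsPrincipalPair W c₁ c₂ B₁ B₂ := by
  have ha : a * a = 1 := by
    rw [e₁, norm_smul, h.norm_left, mul_one, Real.norm_eq_abs] at n₁
    rw [← abs_mul_abs_self, n₁, one_mul]
  have hb : b * b = 1 := by
    rw [e₂, norm_smul, h.norm_right, mul_one, Real.norm_eq_abs] at n₂
    rw [← abs_mul_abs_self, n₂, one_mul]
  refine ⟨n₁, n₂, ?_, ?_, ?_, ?_⟩ <;> simp only [e₁, e₂, map_smul, real_inner_smul_left,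
    real_inner_smul_right, h.ortho, h.left_left, h.right_right, h.left_right]
  · ring
  · linear_combination c₁ ^ 2 * ha
  · linear_combination c₂ ^ 2 * hb
  · ring

/-- Over every point there is a local smooth frame of principal pairs. -/
theorem exists_principalFrame {θ₁ θ₂ : ℝ} (hW : Module.finrank ℝ W = 2) (hU : IsOpen U)
    (hφ : ContDiffOn ℝ ∞ φ U) (hinj : ∀ x ∈ U, Function.Injective (fderiv ℝ φ x))
    (hang : ∀ x ∈ U, ArePrincipalAngles (fderiv ℝ φ x).range W θ₁ θ₂)
    {x₀ : Eucl 2} (hx₀ : x₀ ∈ U) :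
    ∃ V ⊆ U, x₀ ∈ V ∧ ∃ X₁ X₂, PrincipalFrame W (Real.cos θ₁) (Real.cos θ₂) φ X₁ X₂ V := by
  set c₁ := Real.cos θ₁
  set c₂ := Real.cos θ₂
  obtain ⟨Z₁, Z₂, sZ₁, sZ₂, hZ⟩ := exists_orthonormal_frame hU hφ hinj
  have hpair : ∀ x ∈ U, ∃ A₁ ∈ (fderiv ℝ φ x).range, ∃ A₂ ∈ (fderiv ℝ φ x).range,
      IsPrincipalPair W c₁ c₂ A₁ A₂ := by
    intro x hx
    obtain ⟨A₁, h₁, A₂, h₂, a, b, c, d, e, g⟩ := (hang x hx).exists_orthonormal_pair hW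
    exact ⟨A₁, h₁, A₂, h₂, a, b, c, d, e, g⟩
  have hT : ∀ x ∈ U, Module.finrank ℝ (fderiv ℝ φ x).range = 2 :=
    fun x hx => finrank_range_fderiv (hinj x hx)
  by_cases hK : c₁ ^ 2 = c₂ ^ 2
  -- With equal eigenvalues the compression is a multiple of the identity, so every orthonormal
  -- frame is principal, in particular the Gram-Schmidt one.
  · refine ⟨U, subset_rfl, hx₀, Z₁, Z₂, hU, hφ, hinj, sZ₁, sZ₂, fun x hx => (hZ x hx).1,
      fun x hx => (hZ x hx).2.1, fun x hx => ?_⟩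
    obtain ⟨m₁, m₂, n₁, n₂, o⟩ := hZ x hx
    obtain ⟨A₁, h₁, A₂, h₂, hA⟩ := hpair x hx
    have key : ∀ u ∈ (fderiv ℝ φ x).range, ∀ v ∈ (fderiv ℝ φ x).range,
        ⟪W.starProjection u, v⟫ = c₁ ^ 2 * ⟪u, v⟫ := by
      intro u hu v hv
      have e := eq_comb_of_mem_plane (hT x hx) h₁ h₂ hA.norm_left hA.norm_right hA.ortho hu
      have e2 := compression_eq_comb (hT x hx) h₁ h₂ hA hu
      rw [← hK, mul_smul, mul_smul, ← smul_add, ← e] at e2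
      rw [← real_inner_smul_left, ← e2,
        (fderiv ℝ φ x).range.inner_starProjection_left_eq_right, Submodule.starProjection_eq_self_iff.2 hv]
    refine ⟨n₁, n₂, o, ?_, ?_, ?_⟩
    · rw [key _ m₁ _ m₁, real_inner_self_eq_norm_sq, n₁]; ring
    · rw [key _ m₂ _ m₂, real_inner_self_eq_norm_sq, n₂, hK]; ring
    · rw [key _ m₁ _ m₂, o]; ring
  · obtain ⟨B₁, hB₁, B₂, hB₂, hB⟩ := hpair x₀ hx₀
    let P : Eucl 2 → Eucl 4 → Eucl 4 := fun x u => ⟪Z₁ x, u⟫ • Z₁ x + ⟪Z₂ x, u⟫ • Z₂ x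
    have hP : ∀ x ∈ U, ∀ u, P x u = (fderiv ℝ φ x).range.starProjection u := by
      intro x hx u
      obtain ⟨m₁, m₂, n₁, n₂, o⟩ := hZ x hx
      exact (starProjection_eq_of_orthonormal_pair (hT x hx) m₁ m₂ n₁ n₂ o u).symm
    have sP : ∀ u : Eucl 2 → Eucl 4, ContDiffOn ℝ ∞ u U → ContDiffOn ℝ ∞ (fun x => P x (u x)) U :=
      fun u hu => ((sZ₁.inner ℝ hu).smul sZ₁).add ((sZ₂.inner ℝ hu).smul sZ₂)
    -- With P the tangent projector, this is (PQP − c²P)B. Taking c² to be one eigenvalue kills its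
    -- eigenline, so `V c₂ B₁` and `V c₁ B₂` span the two principal lines wherever they are nonzero.
    -- They are smooth, although the eigenvectors at each point were only chosen.
    let V : ℝ → Eucl 4 → Eucl 2 → Eucl 4 := fun c B x =>
      P x (W.starProjection (P x B)) - c ^ 2 • P x B
    have sV : ∀ c B, ContDiffOn ℝ ∞ (V c B) U := fun c B =>
      (sP _ (W.starProjection.contDiff.comp_contDiffOn (sP _ contDiffOn_const))).sub
        ((sP (fun _ => B) contDiffOn_const).const_smul (c ^ 2))
    have hV : ∀ x ∈ U, ∀ A₁ ∈ (fderiv ℝ φ x).range, ∀ A₂ ∈ (fderiv ℝ φ x).range,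
        IsPrincipalPair W c₁ c₂ A₁ A₂ → ∀ c B, V c B x =
          ((c₁ ^ 2 - c ^ 2) * ⟪A₁, B⟫) • A₁ + ((c₂ ^ 2 - c ^ 2) * ⟪A₂, B⟫) • A₂ := by
      intro x hx A₁ h₁ A₂ h₂ hA c B
      have m := (fderiv ℝ φ x).range.starProjection_apply_mem B
      have e := starProjection_eq_of_orthonormal_pair (hT x hx) h₁ h₂ hA.norm_left hA.norm_right
        hA.ortho B
      simp only [V, hP x hx]
      rw [compression_eq_comb (hT x hx) h₁ h₂ hA m]
      rw [← Submodule.inner_starProjection_left_eq_right,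
        ← Submodule.inner_starProjection_left_eq_right, Submodule.starProjection_eq_self_iff.2 h₁,
        Submodule.starProjection_eq_self_iff.2 h₂, e]
      module
    have hV₁ : V c₂ B₁ x₀ ≠ 0 := by
      rw [hV x₀ hx₀ B₁ hB₁ B₂ hB₂ hB, real_inner_self_eq_norm_sq, hB.norm_left]
      simp only [sub_self, zero_mul, zero_smul, add_zero, one_pow, mul_one]
      exact smul_ne_zero (sub_ne_zero.2 hK) (norm_ne_zero_iff.1 (by rw [hB.norm_left]; norm_num))
    have hV₂ : V c₁ B₂ x₀ ≠ 0 := by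
      rw [hV x₀ hx₀ B₁ hB₁ B₂ hB₂ hB, real_inner_self_eq_norm_sq, hB.norm_right]
      simp only [sub_self, zero_mul, zero_smul, zero_add, one_pow, mul_one]
      exact smul_ne_zero (sub_ne_zero.2 (Ne.symm hK))
        (norm_ne_zero_iff.1 (by rw [hB.norm_right]; norm_num))
    let V₁ := U ∩ V c₂ B₁ ⁻¹' {0}ᶜ
    let V₂ := U ∩ V c₁ B₂ ⁻¹' {0}ᶜ
    have o₁ : IsOpen V₁ := (sV _ _).continuousOn.isOpen_inter_preimage hU isOpen_compl_singleton
    have o₂ : IsOpen V₂ := (sV _ _).continuousOn.isOpen_inter_preimage hU isOpen_compl_singleton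
    have hsub : V₁ ∩ V₂ ⊆ U := fun x hx => hx.1.1
    refine ⟨V₁ ∩ V₂, hsub, ⟨⟨hx₀, hV₁⟩, hx₀, hV₂⟩, fun x => ‖V c₂ B₁ x‖⁻¹ • V c₂ B₁ x,
      fun x => ‖V c₁ B₂ x‖⁻¹ • V c₁ B₂ x, o₁.inter o₂, hφ.mono hsub, fun x hx => hinj x (hsub hx),
      ((sV _ _).mono hsub).normalize fun x hx => hx.1.2,
      ((sV _ _).mono hsub).normalize fun x hx => hx.2.2, fun x hx => ?_, fun x hx => ?_,
      fun x hx => ?_⟩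
    · obtain ⟨A₁, h₁, A₂, h₂, hA⟩ := hpair x (hsub hx)
      rw [hV x (hsub hx) A₁ h₁ A₂ h₂ hA]
      exact Submodule.smul_mem _ _ (Submodule.add_mem _ (Submodule.smul_mem _ _ h₁)
        (Submodule.smul_mem _ _ h₂))
    · obtain ⟨A₁, h₁, A₂, h₂, hA⟩ := hpair x (hsub hx)
      rw [hV x (hsub hx) A₁ h₁ A₂ h₂ hA]
      exact Submodule.smul_mem _ _ (Submodule.add_mem _ (Submodule.smul_mem _ _ h₁)
        (Submodule.smul_mem _ _ h₂))
    · obtain ⟨A₁, h₁, A₂, h₂, hA⟩ := hpair x (hsub hx)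
      refine hA.of_unit_multiples (a := ‖V c₂ B₁ x‖⁻¹ * ((c₁ ^ 2 - c₂ ^ 2) * ⟪A₁, B₁⟫))
        (b := ‖V c₁ B₂ x‖⁻¹ * ((c₂ ^ 2 - c₁ ^ 2) * ⟪A₂, B₂⟫)) ?_ ?_
        (norm_normalize hx.1.2) (norm_normalize hx.2.2)
      · conv_lhs => rw [hV x (hsub hx) A₁ h₁ A₂ h₂ hA c₂]
        rw [hV x (hsub hx) A₁ h₁ A₂ h₂ hA c₂]
        module
      · conv_lhs => rw [hV x (hsub hx) A₁ h₁ A₂ h₂ hA c₁]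
        rw [hV x (hsub hx) A₁ h₁ A₂ h₂ hA c₁]
        module

namespace PrincipalFrame

theorem finrank_range (hF : PrincipalFrame W c₁ c₂ φ X₁ X₂ U) {x : Eucl 2} (hx : x ∈ U) :
    Module.finrank ℝ (fderiv ℝ φ x).range = 2 :=
  finrank_range_fderiv (hF.inj x hx)

theorem eq_comb (hF : PrincipalFrame W c₁ c₂ φ X₁ X₂ U) {x : Eucl 2} (hx : x ∈ U) {u : Eucl 4} (hu : u ∈ (fderiv ℝ φ x).range) :
    u = ⟪X₁ x, u⟫ • X₁ x + ⟪X₂ x, u⟫ • X₂ x :=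
  eq_comb_of_mem_plane (hF.finrank_range hx) (hF.mem_left x hx) (hF.mem_right x hx)
    (hF.pair x hx).norm_left (hF.pair x hx).norm_right (hF.pair x hx).ortho hu

theorem exists_normals (hF : PrincipalFrame W c₁ c₂ φ X₁ X₂ U) {x : Eucl 2} (hx : x ∈ U) (hW : Module.finrank ℝ W = 2) (h₁ : c₁ ^ 2 + s₁ ^ 2 = 1)
    (h₂ : c₂ ^ 2 + s₂ ^ 2 = 1) :
    ∃ N₁ N₂, AdaptedNormals W.starProjection c₁ s₁ c₂ s₂ (X₁ x) (X₂ x) N₁ N₂ := by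
  have h := hF.pair x hx
  exact exists_adaptedNormals hW h₁ h₂ h.norm_left h.norm_right h.ortho h.left_left
    h.right_right h.left_right

theorem eventually_pair (hF : PrincipalFrame W c₁ c₂ φ X₁ X₂ U) {x : Eucl 2} (hx : x ∈ U) :
    ∀ᶠ y in 𝓝 x, IsPrincipalPair W c₁ c₂ (X₁ y) (X₂ y) := by
  filter_upwards [hF.isOpen.mem_nhds hx] with y hy using hF.pair y hy

end PrincipalFrame

end PrincipalFrames

/-! ### Vanishing of the Gauss curvature and of the normal curvature -/

section Curvature

namespace PrincipalFrame

variable {W : Submodule ℝ (Eucl 4)} {c₁ s₁ c₂ s₂ : ℝ} {φ X₁ X₂ : Eucl 2 → Eucl 4}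
  {U : Set (Eucl 2)} {x : Eucl 2}

theorem inner_normal_eq_zero (hF : PrincipalFrame W c₁ c₂ φ X₁ X₂ U) (hx : x ∈ U)
    {Q : Eucl 4 →L[ℝ] Eucl 4} {N₁ N₂ : Eucl 4}
    (hN : AdaptedNormals Q c₁ s₁ c₂ s₂ (X₁ x) (X₂ x) N₁ N₂) {u : Eucl 4}
    (hu : u ∈ (fderiv ℝ φ x).range) : ⟪N₁, u⟫ = 0 ∧ ⟪N₂, u⟫ = 0 := by
  obtain ⟨-, -, h1, -, h2, -, -, h3⟩ := hN.on.inner_four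
  obtain ⟨-, ⟨-, -, -, h4, -, -⟩, -⟩ := hN.on.inner_four
  rw [hF.eq_comb hx hu]
  simp only [inner_add_right, real_inner_smul_right, h1, h2, h3, h4]
  simp

theorem differentiableAt_left (hF : PrincipalFrame W c₁ c₂ φ X₁ X₂ U) (hx : x ∈ U) :
    DifferentiableAt ℝ X₁ x := hF.smooth_left.differentiableAt_of_isOpen hF.isOpen hx

/-- The normal components of the second derivatives. -/
theorem inner_normal_partialD (hF : PrincipalFrame W c₁ c₂ φ X₁ X₂ U) (hx : x ∈ U)
    (hW : Module.finrank ℝ W = 2) (h₁ : c₁ ^ 2 + s₁ ^ 2 = 1) (h₂ : c₂ ^ 2 + s₂ ^ 2 = 1)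
    {N₁ N₂ : Eucl 4} (hN : AdaptedNormals W.starProjection c₁ s₁ c₂ s₂ (X₁ x) (X₂ x) N₁ N₂)
    (i j : Fin 2) :
    ⟪N₁, partialD i (partialD j φ) x⟫ = ⟪X₂ x, partialD j φ x⟫ * ⟪N₁, partialD i X₂ x⟫ ∧
    ⟪N₂, partialD i (partialD j φ) x⟫ = ⟪X₁ x, partialD j φ x⟫ * ⟪N₂, partialD i X₁ x⟫ := by
  have d₁ := hF.differentiableAt_left hx
  have d₂ := hF.swap.differentiableAt_left hx
  have dφ := (hF.smooth.partialD hF.isOpen j).differentiableAt_of_isOpen hF.isOpen hx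
  have i₁ := d₁.inner ℝ dφ
  have i₂ := d₂.inner ℝ dφ
  have e : partialD j φ =ᶠ[𝓝 x] fun y =>
      ⟪X₁ y, partialD j φ y⟫ • X₁ y + ⟪X₂ y, partialD j φ y⟫ • X₂ y := by
    filter_upwards [hF.isOpen.mem_nhds hx] with y hy
    exact hF.eq_comb hy ⟨_, rfl⟩
  have hD := IsPrincipalPair.deriv hW h₁ h₂ (hF.eventually_pair hx) d₁ d₂ hN
    (EuclideanSpace.single i 1)
  obtain ⟨-, -, -, r₁, r₂, -⟩ := hD
  obtain ⟨a₁, b₁⟩ := hF.inner_normal_eq_zero hx hN (hF.mem_left x hx)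
  obtain ⟨a₂, b₂⟩ := hF.inner_normal_eq_zero hx hN (hF.mem_right x hx)
  rw [partialD_congr e, partialD_add (u := fun y => ⟪X₁ y, partialD j φ y⟫ • X₁ y)
    (v := fun y => ⟪X₂ y, partialD j φ y⟫ • X₂ y) (i₁.smul d₁) (i₂.smul d₂),
    partialD_smul i₁ d₁, partialD_smul i₂ d₂]
  change ⟪N₁, partialD i X₁ x⟫ = 0 at r₁
  change ⟪N₂, partialD i X₂ x⟫ = 0 at r₂
  simp only [inner_add_right, real_inner_smul_right, a₁, a₂, b₁, b₂, r₁, r₂]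
  constructor <;> ring

/-- By `inner_normal_partialD` each of the two normal components of the second fundamental form is a
product of two linear forms. As a symmetric 2 × 2 matrix it has rank at most one, and the Gauss
equation expresses the curvature as the sum of the two determinants. -/
theorem gaussCurvature_eq_zero (hF : PrincipalFrame W c₁ c₂ φ X₁ X₂ U) (hx : x ∈ U)
    (hW : Module.finrank ℝ W = 2) (h₁ : c₁ ^ 2 + s₁ ^ 2 = 1) (h₂ : c₂ ^ 2 + s₂ ^ 2 = 1) :
    gaussCurvature φ x = 0 := by
  obtain ⟨N₁, N₂, hN⟩ := hF.exists_normals hx hW h₁ h₂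
  obtain ⟨ν₁, ν₀, hν₁, hν₀, ⟨v₁, e₁⟩, ⟨v₀, e₀⟩, key⟩ := gauss_equation hF.smooth hF.isOpen hF.inj hx
  have hperp : ∀ ν : Eucl 4, (∀ l, ⟪ν, partialD l φ x⟫ = 0) →
      ν = ⟪N₁, ν⟫ • N₁ + ⟪N₂, ν⟫ • N₂ := by
    intro ν hν
    have ht : ∀ u ∈ (fderiv ℝ φ x).range, ⟪u, ν⟫ = 0 := by
      rintro _ ⟨v, rfl⟩
      rw [real_inner_comm]
      change ⟪ν, fderiv ℝ φ x v⟫ = 0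
      rw [fderiv_eq_partialD_comb, inner_add_right, real_inner_smul_right, real_inner_smul_right,
        hν, hν]
      simp
    have := hN.on.expand_four ν
    rw [ht _ (hF.mem_left x hx), ht _ (hF.mem_right x hx)] at this
    simpa using this
  have hs := fun i j => hF.inner_normal_partialD hx hW h₁ h₂ hN i j
  have t₁ := hF.inner_normal_eq_zero hx hN (u := fderiv ℝ φ x v₁) ⟨_, rfl⟩
  have t₀ := hF.inner_normal_eq_zero hx hN (u := fderiv ℝ φ x v₀) ⟨_, rfl⟩
  rw [← e₁, inner_sub_right, inner_sub_right] at t₁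
  rw [← e₀, inner_sub_right, inner_sub_right] at t₀
  have f₁ : ⟪N₁, ν₁⟫ = _ := (by linarith [t₁.1] : _ = _).trans (hs 1 1).1
  have f₂ : ⟪N₂, ν₁⟫ = _ := (by linarith [t₁.2] : _ = _).trans (hs 1 1).2
  have f₃ : ⟪N₁, ν₀⟫ = _ := (by linarith [t₀.1] : _ = _).trans (hs 0 1).1
  have f₄ : ⟪N₂, ν₀⟫ = _ := (by linarith [t₀.2] : _ = _).trans (hs 0 1).2
  have hcomm := hF.smooth.partialD_comm hF.isOpen hx 0 1
  have g₁ := (hs 1 0).1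
  have g₂ := (hs 1 0).2
  rw [← hcomm] at g₁ g₂
  rw [gaussCurvature, key, hperp ν₁ hν₁, hperp ν₀ hν₀]
  simp only [inner_add_right, real_inner_smul_right, real_inner_comm N₁, real_inner_comm N₂,
    f₁, f₂, f₃, f₄]
  rw [g₁, g₂, (hs 0 0).1, (hs 0 0).2]
  ring

theorem normalDeriv_eq (hF : PrincipalFrame W c₁ c₂ φ X₁ X₂ U) (hx : x ∈ U) (i : Fin 2)
    (ξ : Eucl 2 → Eucl 4) : normalDeriv φ i ξ x =
      partialD i ξ x - (⟪X₁ x, partialD i ξ x⟫ • X₁ x + ⟪X₂ x, partialD i ξ x⟫ • X₂ x) := by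
  have h := hF.pair x hx
  rw [← starProjection_eq_of_orthonormal_pair (hF.finrank_range hx) (hF.mem_left x hx)
    (hF.mem_right x hx) h.norm_left h.norm_right h.ortho]
  simp only [normalDeriv, normalPlane, Submodule.starProjection_orthogonal]
  rfl

/-- Differentiating ⟨Xₖ, ξ⟩ = 0 shows that the tangential part of ∂ⱼξ along X₁ involves only the
N₂-component of ξ, and along X₂ only the N₁-component. Hence ∇ᵢ∇ⱼξ is the normal part of ∂ᵢ∂ⱼξ plus
a term symmetric in i and j, and the commutator vanishes. -/
theorem normalCurvature_eq_zero (hF : PrincipalFrame W c₁ c₂ φ X₁ X₂ U) (hx : x ∈ U)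
    (hW : Module.finrank ℝ W = 2) (h₁ : c₁ ^ 2 + s₁ ^ 2 = 1) (h₂ : c₂ ^ 2 + s₂ ^ 2 = 1)
    {ξ : Eucl 2 → Eucl 4} (hξ : ContDiffOn ℝ ∞ ξ U) (hn : ∀ y ∈ U, ξ y ∈ normalPlane φ y) :
    normalCurvature φ ξ x = 0 := by
  obtain ⟨N₁, N₂, hN⟩ := hF.exists_normals hx hW h₁ h₂
  have hU := hF.isOpen
  have d₁ := hF.differentiableAt_left hx
  have d₂ := hF.swap.differentiableAt_left hx
  have dξ := hξ.differentiableAt_of_isOpen hU hx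
  have dξ' := fun i => (hξ.partialD hU i).differentiableAt_of_isOpen hU hx
  have horth : ∀ y ∈ U, ∀ u ∈ (fderiv ℝ φ y).range, ⟪u, ξ y⟫ = 0 := fun y hy u hu =>
    Submodule.inner_right_of_mem_orthogonal hu (hn y hy)
  have hξN : ξ x = ⟪N₁, ξ x⟫ • N₁ + ⟪N₂, ξ x⟫ • N₂ := by
    have := hN.on.expand_four (ξ x)
    rw [horth x hx _ (hF.mem_left x hx), horth x hx _ (hF.mem_right x hx)] at this
    simpa using this
  have hPN : ∀ u : Eucl 4, (normalPlane φ x).starProjection u = ⟪N₁, u⟫ • N₁ + ⟪N₂, u⟫ • N₂ := by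
    intro u
    have h := hF.pair x hx
    have e : (normalPlane φ x).starProjection u = u - (⟪X₁ x, u⟫ • X₁ x + ⟪X₂ x, u⟫ • X₂ x) := by
      rw [← starProjection_eq_of_orthonormal_pair (hF.finrank_range hx) (hF.mem_left x hx)
        (hF.mem_right x hx) h.norm_left h.norm_right h.ortho]
      simp only [normalPlane, Submodule.starProjection_orthogonal]
      rfl
    rw [e, sub_eq_iff_eq_add]
    conv_lhs => rw [hN.on.expand_four u]
    abel
  have hD := fun i => IsPrincipalPair.deriv hW h₁ h₂ (hF.eventually_pair hx) d₁ d₂ hN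
    (EuclideanSpace.single i 1)
  have r₁ : ∀ i, ⟪N₁, partialD i X₁ x⟫ = 0 := fun i => (hD i).2.2.2.1
  have r₂ : ∀ i, ⟪N₂, partialD i X₂ x⟫ = 0 := fun i => (hD i).2.2.2.2.1
  have q₁ : ∀ i, ⟪X₁ x, partialD i ξ x⟫ = -(⟪N₂, partialD i X₁ x⟫ * ⟪N₂, ξ x⟫) := by
    intro i
    have e : partialD i (fun y => ⟪X₁ y, ξ y⟫) x = partialD i (fun _ => (0 : ℝ)) x := by
      apply partialD_congr
      filter_upwards [hU.mem_nhds hx] with y hy using horth y hy _ (hF.mem_left y hy)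
    rw [partialD_inner d₁ dξ] at e
    have z : partialD i (fun _ : Eucl 2 => (0 : ℝ)) x = 0 := by simp [partialD]
    rw [z] at e
    have : ⟪partialD i X₁ x, ξ x⟫ = ⟪N₂, partialD i X₁ x⟫ * ⟪N₂, ξ x⟫ := by
      conv_lhs => rw [hξN]
      rw [inner_add_right, real_inner_smul_right, real_inner_smul_right,
        real_inner_comm N₁ (partialD i X₁ x), r₁, real_inner_comm N₂ (partialD i X₁ x)]
      ring
    linarith
  have q₂ : ∀ i, ⟪X₂ x, partialD i ξ x⟫ = -(⟪N₁, partialD i X₂ x⟫ * ⟪N₁, ξ x⟫) := by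
    intro i
    have e : partialD i (fun y => ⟪X₂ y, ξ y⟫) x = partialD i (fun _ => (0 : ℝ)) x := by
      apply partialD_congr
      filter_upwards [hU.mem_nhds hx] with y hy using horth y hy _ (hF.mem_right y hy)
    rw [partialD_inner d₂ dξ] at e
    have z : partialD i (fun _ : Eucl 2 => (0 : ℝ)) x = 0 := by simp [partialD]
    rw [z] at e
    have : ⟪partialD i X₂ x, ξ x⟫ = ⟪N₁, partialD i X₂ x⟫ * ⟪N₁, ξ x⟫ := by
      conv_lhs => rw [hξN]
      rw [inner_add_right, real_inner_smul_right, real_inner_smul_right,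
        real_inner_comm N₂ (partialD i X₂ x), r₂, real_inner_comm N₁ (partialD i X₂ x)]
      ring
    linarith
  obtain ⟨a₁, b₁⟩ := hF.inner_normal_eq_zero hx hN (hF.mem_left x hx)
  obtain ⟨a₂, b₂⟩ := hF.inner_normal_eq_zero hx hN (hF.mem_right x hx)
  have key : ∀ i j, normalDeriv φ i (normalDeriv φ j ξ) x =
      (normalPlane φ x).starProjection (partialD i (partialD j ξ) x) +
        ((⟪N₁, partialD j X₂ x⟫ * ⟪N₁, ξ x⟫ * ⟪N₁, partialD i X₂ x⟫) • N₁ +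
        (⟪N₂, partialD j X₁ x⟫ * ⟪N₂, ξ x⟫ * ⟪N₂, partialD i X₁ x⟫) • N₂) := by
    intro i j
    have e : normalDeriv φ j ξ =ᶠ[𝓝 x] fun y =>
        partialD j ξ y - (⟪X₁ y, partialD j ξ y⟫ • X₁ y + ⟪X₂ y, partialD j ξ y⟫ • X₂ y) := by
      filter_upwards [hU.mem_nhds hx] with y hy using hF.normalDeriv_eq hy j ξ
    have i₁ := d₁.inner ℝ (dξ' j)
    have i₂ := d₂.inner ℝ (dξ' j)
    rw [normalDeriv, partialD_congr e,
      partialD_sub (u := partialD j ξ)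
        (v := fun y => ⟪X₁ y, partialD j ξ y⟫ • X₁ y + ⟪X₂ y, partialD j ξ y⟫ • X₂ y) (dξ' j)
        ((i₁.smul d₁).add (i₂.smul d₂)),
      partialD_add (u := fun y => ⟪X₁ y, partialD j ξ y⟫ • X₁ y)
        (v := fun y => ⟪X₂ y, partialD j ξ y⟫ • X₂ y) (i₁.smul d₁) (i₂.smul d₂),
      partialD_smul i₁ d₁, partialD_smul i₂ d₂, hPN, hPN, q₁, q₂]
    simp only [inner_sub_right, inner_add_right, real_inner_smul_right, a₁, a₂, b₁, b₂, r₁, r₂]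
    module
  rw [normalCurvature, key, key, hξ.partialD_comm hU hx 0 1]
  module

end PrincipalFrame

end Curvature

/-! ### Immersed surfaces in charts -/

section Charts

variable {M : Type*} [TopologicalSpace M] [ChartedSpace (Eucl 2) M] [IsManifold (𝓡 2) ∞ M]
  {f : M → Eucl 4}

theorem IsSmoothImmersion.contDiffOn_chart (hf : IsSmoothImmersion 2 f)
    {e : OpenPartialHomeomorph M (Eucl 2)} (he : e ∈ IsManifold.maximalAtlas (𝓡 2) ∞ M) :
    ContDiffOn ℝ ∞ (f ∘ e.symm) e.target :=
  (hf.1.comp_contMDiffOn (contMDiffOn_symm_of_mem_maximalAtlas he)).contDiffOn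

theorem mdifferentiable_of_mem_maximalAtlas {e : OpenPartialHomeomorph M (Eucl 2)}
    (he : e ∈ IsManifold.maximalAtlas (𝓡 2) ∞ M) : e.MDifferentiable (𝓡 2) (𝓡 2) :=
  ⟨(contMDiffOn_of_mem_maximalAtlas he).mdifferentiableOn (by simp),
    (contMDiffOn_symm_of_mem_maximalAtlas he).mdifferentiableOn (by simp)⟩

theorem IsSmoothImmersion.fderiv_chart (hf : IsSmoothImmersion 2 f)
    {e : OpenPartialHomeomorph M (Eucl 2)} (he : e ∈ IsManifold.maximalAtlas (𝓡 2) ∞ M)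
    {x : Eucl 2} (hx : x ∈ e.target) (v : Eucl 2) :
    fderiv ℝ (f ∘ e.symm) x v = mfderiv (𝓡 2) 𝓘(ℝ, Eucl 4) f (e.symm x)
      (mfderiv (𝓡 2) (𝓡 2) e.symm x v) := by
  rw [← mfderiv_eq_fderiv]
  rw [mfderiv_comp x ((hf.1 (e.symm x)).mdifferentiableAt (by simp))
    ((mdifferentiable_of_mem_maximalAtlas he).mdifferentiableAt_symm hx)]
  rfl

theorem IsSmoothImmersion.injective_fderiv_chart (hf : IsSmoothImmersion 2 f)
    {e : OpenPartialHomeomorph M (Eucl 2)} (he : e ∈ IsManifold.maximalAtlas (𝓡 2) ∞ M)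
    {x : Eucl 2} (hx : x ∈ e.target) : Function.Injective (fderiv ℝ (f ∘ e.symm) x) := by
  intro v w hvw
  rw [hf.fderiv_chart he hx, hf.fderiv_chart he hx] at hvw
  exact (mdifferentiable_of_mem_maximalAtlas he).symm.mfderiv_injective hx (hf.2 _ hvw)

theorem IsSmoothImmersion.range_fderiv_chart (hf : IsSmoothImmersion 2 f)
    {e : OpenPartialHomeomorph M (Eucl 2)} (he : e ∈ IsManifold.maximalAtlas (𝓡 2) ∞ M)
    {x : Eucl 2} (hx : x ∈ e.target) :
    (fderiv ℝ (f ∘ e.symm) x).range = tangentPlane f (e.symm x) := by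
  apply le_antisymm
  · rintro _ ⟨v, rfl⟩
    exact ⟨mfderiv (𝓡 2) (𝓡 2) e.symm x v, (hf.fderiv_chart he hx v).symm⟩
  · rintro _ ⟨w, rfl⟩
    obtain ⟨v, hv⟩ := (mdifferentiable_of_mem_maximalAtlas he).symm.mfderiv_surjective hx w
    exact ⟨v, (hf.fderiv_chart he hx v).trans (congrArg _ hv)⟩

/-- Part one: constant principal angles force both curvatures to vanish. -/
theorem curvatures_eq_zero (hf : IsSmoothImmersion 2 f) {W : Submodule ℝ (Eucl 4)}
    (hW : Module.finrank ℝ W = 2) (hangles : HasConstantPrincipalAngles f W) :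
    HasZeroGaussCurvature f ∧ HasFlatNormalBundle f := by
  obtain ⟨θ₁, θ₂, hθ⟩ := hangles
  have frame : ∀ e ∈ IsManifold.maximalAtlas (𝓡 2) ∞ M, ∀ x ∈ e.target, ∃ V ⊆ e.target, x ∈ V ∧
      ∃ X₁ X₂, PrincipalFrame W (Real.cos θ₁) (Real.cos θ₂) (f ∘ e.symm) X₁ X₂ V :=
    fun e he x hx => exists_principalFrame hW e.open_target (hf.contDiffOn_chart he)
      (fun y hy => hf.injective_fderiv_chart he hy)
      (fun y hy => by rw [hf.range_fderiv_chart he hy]; exact hθ _) hx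
  constructor
  · intro e he x hx
    obtain ⟨V, hV, hxV, X₁, X₂, hF⟩ := frame e he x hx
    exact hF.gaussCurvature_eq_zero hxV hW (Real.cos_sq_add_sin_sq θ₁) (Real.cos_sq_add_sin_sq θ₂)
  · intro e he ξ hξ hn x hx
    obtain ⟨V, hV, hxV, X₁, X₂, hF⟩ := frame e he x hx
    exact hF.normalCurvature_eq_zero hxV hW (Real.cos_sq_add_sin_sq θ₁)
      (Real.cos_sq_add_sin_sq θ₂) (hξ.mono hV) (fun y hy => hn y (hV hy))

end Charts

/-! ### Moving frames with a Riccati equation -/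

section MovingFrames

/-- An orthonormal frame `X₁, X₂` tangent to `φ`, together with the vector fields `x₁, x₂` that it
lifts, such that `X₁` rotates only towards `X₂` along `x₂` (and vice versa) and the geodesic
curvatures satisfy Riccati equations in the transverse directions. -/
structure MovingFrame (φ X₁ X₂ : Eucl 2 → Eucl 4) (x₁ x₂ : Eucl 2 → Eucl 2)
    (U : Set (Eucl 2)) : Prop where
  isOpen : IsOpen U
  smooth : ContDiffOn ℝ ∞ φ U
  inj : ∀ x ∈ U, Function.Injective (fderiv ℝ φ x)
  smooth_left : ContDiffOn ℝ ∞ X₁ U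
  smooth_right : ContDiffOn ℝ ∞ X₂ U
  smooth_vec_left : ContDiffOn ℝ ∞ x₁ U
  smooth_vec_right : ContDiffOn ℝ ∞ x₂ U
  lift_left : ∀ x ∈ U, fderiv ℝ φ x (x₁ x) = X₁ x
  lift_right : ∀ x ∈ U, fderiv ℝ φ x (x₂ x) = X₂ x
  norm_left : ∀ x ∈ U, ‖X₁ x‖ = 1
  norm_right : ∀ x ∈ U, ‖X₂ x‖ = 1
  ortho : ∀ x ∈ U, ⟪X₁ x, X₂ x⟫ = 0
  deriv_left : ∀ x ∈ U, ∃ b : ℝ, fderiv ℝ X₁ x (x₂ x) = b • X₂ x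
  deriv_right : ∀ x ∈ U, ∃ a : ℝ, fderiv ℝ X₂ x (x₁ x) = a • X₁ x
  riccati_left : ∀ x ∈ U, fderiv ℝ (fun y => ⟪fderiv ℝ X₁ y (x₁ y), X₂ y⟫) x (x₂ x) =
    ⟪fderiv ℝ X₁ x (x₁ x), X₂ x⟫ ^ 2
  riccati_right : ∀ x ∈ U, fderiv ℝ (fun y => ⟪fderiv ℝ X₂ y (x₂ y), X₁ y⟫) x (x₁ x) =
    ⟪fderiv ℝ X₂ x (x₂ x), X₁ x⟫ ^ 2

theorem MovingFrame.swap {φ X₁ X₂ : Eucl 2 → Eucl 4} {x₁ x₂ : Eucl 2 → Eucl 2}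
    {U : Set (Eucl 2)} (h : MovingFrame φ X₁ X₂ x₁ x₂ U) : MovingFrame φ X₂ X₁ x₂ x₁ U :=
  ⟨h.isOpen, h.smooth, h.inj, h.smooth_right, h.smooth_left, h.smooth_vec_right,
    h.smooth_vec_left, h.lift_right, h.lift_left, h.norm_right, h.norm_left,
    fun x hx => by rw [real_inner_comm]; exact h.ortho x hx, h.deriv_right, h.deriv_left,
    h.riccati_right, h.riccati_left⟩

variable {φ X₁ X₂ : Eucl 2 → Eucl 4} {x₁ x₂ : Eucl 2 → Eucl 2} {U : Set (Eucl 2)} {x : Eucl 2}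

/-- The coefficients of the lift are recovered from the inner products with ∂ₗφ through the inverse
metric, and are therefore smooth. -/
theorem exists_smooth_lift (hφ : ContDiffOn ℝ ∞ φ U) (hU : IsOpen U)
    (hinj : ∀ x ∈ U, Function.Injective (fderiv ℝ φ x)) {X : Eucl 2 → Eucl 4}
    (hX : ContDiffOn ℝ ∞ X U) (hm : ∀ x ∈ U, X x ∈ (fderiv ℝ φ x).range) :
    ∃ ξ : Eucl 2 → Eucl 2, ContDiffOn ℝ ∞ ξ U ∧ ∀ x ∈ U, fderiv ℝ φ x (ξ x) = X x := by
  let c : Fin 2 → Eucl 2 → ℝ := fun k x =>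
    (metricMatrix φ x)⁻¹ k 0 * ⟪partialD 0 φ x, X x⟫ +
      (metricMatrix φ x)⁻¹ k 1 * ⟪partialD 1 φ x, X x⟫
  have hc : ∀ k, ContDiffOn ℝ ∞ (c k) U := fun k =>
    ((hφ.metricMatrix_inv hU hinj k 0).mul ((hφ.partialD hU 0).inner ℝ hX)).add
      ((hφ.metricMatrix_inv hU hinj k 1).mul ((hφ.partialD hU 1).inner ℝ hX))
  refine ⟨fun x => !₂[c 0 x, c 1 x], ?_, fun x hx => ?_⟩
  · rw [contDiffOn_euclidean]
    intro i; fin_cases i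
    · exact hc 0
    · exact hc 1
  · obtain ⟨v, hv⟩ := hm x hx
    have hv' : X x = v 0 • partialD 0 φ x + v 1 • partialD 1 φ x :=
      hv.symm.trans (fderiv_eq_partialD_comb x v)
    have hmul := Matrix.nonsing_inv_mul (metricMatrix φ x)
      (metricMatrix_det_ne_zero (hinj x hx)).isUnit
    have h00 := congrFun (congrFun hmul 0) 0
    have h01 := congrFun (congrFun hmul 0) 1
    have h10 := congrFun (congrFun hmul 1) 0
    have h11 := congrFun (congrFun hmul 1) 1
    simp only [Matrix.mul_apply, Fin.sum_univ_two, Matrix.one_apply_eq, ne_eq, zero_ne_one,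
      one_ne_zero, not_false_eq_true, Matrix.one_apply_ne] at h00 h01 h10 h11
    have hinner : ∀ l, ⟪partialD l φ x, X x⟫ =
        metricMatrix φ x l 0 * v 0 + metricMatrix φ x l 1 * v 1 := by
      intro l
      rw [hv', inner_add_right, real_inner_smul_right, real_inner_smul_right]
      simp only [metricMatrix, Matrix.of_apply]
      ring
    have e0 : c 0 x = v 0 := by
      simp only [c, hinner]; linear_combination v 0 * h00 + v 1 * h01
    have e1 : c 1 x = v 1 := by
      simp only [c, hinner]; linear_combination v 0 * h10 + v 1 * h11
    rw [fderiv_eq_partialD_comb, hv']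
    simp [e0, e1]

theorem fderiv_along_field {F : Type*} [NormedAddCommGroup F] [NormedSpace ℝ F]
    {h : Eucl 2 → F} {ξ : Eucl 2 → Eucl 2} (hU : IsOpen U) (hh : ContDiffOn ℝ ∞ h U)
    (hξ : ContDiffOn ℝ ∞ ξ U) (hx : x ∈ U) (v : Eucl 2) :
    fderiv ℝ (fun y => fderiv ℝ h y (ξ y)) x v =
      fderiv ℝ (fderiv ℝ h) x v (ξ x) + fderiv ℝ h x (fderiv ℝ ξ x v) := by
  have hd : DifferentiableAt ℝ (fderiv ℝ h) x :=
    (hh.fderiv_of_isOpen hU (m := ∞) (by simp)).differentiableAt_of_isOpen hU hx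
  rw [fderiv_clm_apply hd (hξ.differentiableAt_of_isOpen hU hx)]
  simp [add_comm]

/-- The second derivatives of h cancel by symmetry, leaving its derivative along the Lie bracket
[x₁, x₂]. -/
theorem fderiv_along_field_sub {F : Type*} [NormedAddCommGroup F] [NormedSpace ℝ F]
    {h : Eucl 2 → F} (hU : IsOpen U) (hh : ContDiffOn ℝ ∞ h U)
    (h₁ : ContDiffOn ℝ ∞ x₁ U) (h₂ : ContDiffOn ℝ ∞ x₂ U) (hx : x ∈ U) :
    fderiv ℝ (fun y => fderiv ℝ h y (x₂ y)) x (x₁ x) -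
      fderiv ℝ (fun y => fderiv ℝ h y (x₁ y)) x (x₂ x) =
      fderiv ℝ h x (fderiv ℝ x₂ x (x₁ x) - fderiv ℝ x₁ x (x₂ x)) := by
  rw [fderiv_along_field hU hh h₂ hx, fderiv_along_field hU hh h₁ hx,
    hh.fderiv_fderiv_comm hU hx, map_sub]
  abel

variable {W : Submodule ℝ (Eucl 4)} {c₁ s₁ c₂ s₂ : ℝ}

/-- Torsion-freeness: `D₁X₂ - D₂X₁` is tangent. -/
theorem deriv_frame_sub (hU : IsOpen U) (hφ : ContDiffOn ℝ ∞ φ U)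
    (h₁ : ContDiffOn ℝ ∞ x₁ U) (h₂ : ContDiffOn ℝ ∞ x₂ U)
    (l₁ : ∀ x ∈ U, fderiv ℝ φ x (x₁ x) = X₁ x) (l₂ : ∀ x ∈ U, fderiv ℝ φ x (x₂ x) = X₂ x)
    (hx : x ∈ U) : fderiv ℝ X₂ x (x₁ x) - fderiv ℝ X₁ x (x₂ x) =
      fderiv ℝ φ x (fderiv ℝ x₂ x (x₁ x) - fderiv ℝ x₁ x (x₂ x)) := by
  rw [← fderiv_along_field_sub hU hφ h₁ h₂ hx]
  have e₁ : X₁ =ᶠ[𝓝 x] fun y => fderiv ℝ φ y (x₁ y) := by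
    filter_upwards [hU.mem_nhds hx] with y hy using (l₁ y hy).symm
  have e₂ : X₂ =ᶠ[𝓝 x] fun y => fderiv ℝ φ y (x₂ y) := by
    filter_upwards [hU.mem_nhds hx] with y hy using (l₂ y hy).symm
  rw [e₁.fderiv_eq, e₂.fderiv_eq]

namespace PrincipalFrame

/-- D₁X₂ − D₂X₁ is tangent and D₁X₂ has no N₂-component, so D₂X₁ has none either. Its components
along X₁ and N₁ vanish for every direction of differentiation, and only X₂ remains. -/
theorem deriv_left (hF : PrincipalFrame W c₁ c₂ φ X₁ X₂ U) (hW : Module.finrank ℝ W = 2)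
    (h₁ : c₁ ^ 2 + s₁ ^ 2 = 1) (h₂ : c₂ ^ 2 + s₂ ^ 2 = 1)
    (v₁ : ContDiffOn ℝ ∞ x₁ U) (v₂ : ContDiffOn ℝ ∞ x₂ U)
    (l₁ : ∀ x ∈ U, fderiv ℝ φ x (x₁ x) = X₁ x) (l₂ : ∀ x ∈ U, fderiv ℝ φ x (x₂ x) = X₂ x)
    (hx : x ∈ U) : fderiv ℝ X₁ x (x₂ x) = ⟪X₂ x, fderiv ℝ X₁ x (x₂ x)⟫ • X₂ x := by
  obtain ⟨N₁, N₂, hN⟩ := hF.exists_normals hx hW h₁ h₂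
  have hD := fun v => IsPrincipalPair.deriv hW h₁ h₂ (hF.eventually_pair hx)
    (hF.differentiableAt_left hx) (hF.swap.differentiableAt_left hx) hN v
  have ht := deriv_frame_sub hF.isOpen hF.smooth v₁ v₂ l₁ l₂ hx
  have hn := (hF.inner_normal_eq_zero hx hN 
    (u := fderiv ℝ φ x (fderiv ℝ x₂ x (x₁ x) - fderiv ℝ x₁ x (x₂ x))) ⟨_, rfl⟩).2
  rw [← ht, inner_sub_right, (hD _).2.2.2.2.1] at hn
  have := hN.on.expand_four (fderiv ℝ X₁ x (x₂ x))
  rw [(hD _).1, (hD _).2.2.2.1, (by linarith : ⟪N₂, fderiv ℝ X₁ x (x₂ x)⟫ = 0)] at this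
  simpa using this

/-- The Riccati equation for the geodesic curvature of the first family of curves. -/
theorem riccati (hF : PrincipalFrame W c₁ c₂ φ X₁ X₂ U) (hW : Module.finrank ℝ W = 2)
    (h₁ : c₁ ^ 2 + s₁ ^ 2 = 1) (h₂ : c₂ ^ 2 + s₂ ^ 2 = 1) (hK : c₁ ^ 2 ≠ c₂ ^ 2)
    (v₁ : ContDiffOn ℝ ∞ x₁ U) (v₂ : ContDiffOn ℝ ∞ x₂ U)
    (l₁ : ∀ x ∈ U, fderiv ℝ φ x (x₁ x) = X₁ x) (l₂ : ∀ x ∈ U, fderiv ℝ φ x (x₂ x) = X₂ x)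
    (hx : x ∈ U) : fderiv ℝ (fun y => ⟪fderiv ℝ X₁ y (x₁ y), X₂ y⟫) x (x₂ x) =
    ⟪fderiv ℝ X₁ x (x₁ x), X₂ x⟫ ^ 2 := by
  have hU := hF.isOpen
  have d₁ := hF.differentiableAt_left hx
  have d₂ := hF.swap.differentiableAt_left hx
  have hDU : ∀ y ∈ U, ∃ N₁ N₂, AdaptedNormals W.starProjection c₁ s₁ c₂ s₂ (X₁ y) (X₂ y) N₁ N₂ :=
    fun y hy => hF.exists_normals hy hW h₁ h₂
  have hD := fun {y : Eucl 2} (hy : y ∈ U) {N₁ N₂ : Eucl 4}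
    (hN : AdaptedNormals W.starProjection c₁ s₁ c₂ s₂ (X₁ y) (X₂ y) N₁ N₂) (v : Eucl 2) =>
    IsPrincipalPair.deriv hW h₁ h₂ (hF.eventually_pair hy)
      (hF.differentiableAt_left hy) (hF.swap.differentiableAt_left hy) hN v
  have hDr := fun {y : Eucl 2} (hy : y ∈ U) =>
    hF.swap.deriv_left hW h₂ h₁ v₂ v₁ l₂ l₁ hy
  have hDl := fun {y : Eucl 2} (hy : y ∈ U) => hF.deriv_left hW h₁ h₂ v₁ v₂ l₁ l₂ hy
  let A : Eucl 2 → ℝ := fun y => ⟪fderiv ℝ X₁ y (x₁ y), X₂ y⟫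
  -- A smooth substitute for c₂s₂N₂: the adapted normals are chosen point by point and cannot be
  -- differentiated.
  let Y : Eucl 2 → Eucl 4 := fun y => W.starProjection (X₂ y) - c₂ ^ 2 • X₂ y
  have sD : ContDiffOn ℝ ∞ (fun y => fderiv ℝ X₁ y (x₁ y)) U :=
    (hF.smooth_left.fderiv_of_isOpen hU (m := ∞) (by simp)).clm_apply v₁
  have sD₂ : ContDiffOn ℝ ∞ (fun y => fderiv ℝ X₁ y (x₂ y)) U :=
    (hF.smooth_left.fderiv_of_isOpen hU (m := ∞) (by simp)).clm_apply v₂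
  have sY : ContDiffOn ℝ ∞ Y U := (W.starProjection.contDiff.comp_contDiffOn hF.smooth_right).sub
    (hF.smooth_right.const_smul _)
  have dD := sD.differentiableAt_of_isOpen hU hx
  have dY := sY.differentiableAt_of_isOpen hU hx
  have hYN : ∀ {y : Eucl 2} {N₁ N₂ : Eucl 4},
      AdaptedNormals W.starProjection c₁ s₁ c₂ s₂ (X₁ y) (X₂ y) N₁ N₂ → Y y = (c₂ * s₂) • N₂ := by
    intro y N₁ N₂ hN
    simp only [Y, hN.map_X₂]; abel
  have hKA : ∀ y ∈ U, (c₁ ^ 2 - c₂ ^ 2) * A y = ⟪fderiv ℝ X₁ y (x₁ y), Y y⟫ := by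
    intro y hy
    obtain ⟨N₁, N₂, hN⟩ := hDU y hy
    have h := (hD hy hN (x₁ y)).2.2.2.2.2
    have hz : ⟪N₁, fderiv ℝ X₂ y (x₁ y)⟫ = 0 := by
      rw [hDr hy, real_inner_smul_right]
      rw [(hF.inner_normal_eq_zero hy hN (hF.mem_left y hy)).1, mul_zero]
    rw [hz, mul_zero, add_zero] at h
    simp only [A]
    rw [hYN hN, real_inner_smul_right, real_inner_comm (X₂ y), h, real_inner_comm N₂]
  obtain ⟨N₁, N₂, hN⟩ := hDU x hx
  obtain ⟨⟨i₁, i₂, i₃, i₄⟩, ⟨o₁, o₂, o₃, o₄, o₅, o₆⟩, q₁, q₂, q₃, q₄, q₅, q₆⟩ := hN.on.inner_four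
  have eY : fderiv ℝ Y x (x₂ x) = W.starProjection (fderiv ℝ X₂ x (x₂ x)) -
      c₂ ^ 2 • fderiv ℝ X₂ x (x₂ x) := by
    have : HasFDerivAt Y (W.starProjection.comp (fderiv ℝ X₂ x) - c₂ ^ 2 • fderiv ℝ X₂ x) x :=
      (W.starProjection.hasFDerivAt.comp x d₂.hasFDerivAt).sub (d₂.hasFDerivAt.fun_const_smul (c₂ ^ 2))
    rw [this.fderiv]; rfl
  -- D₁X₁ lies in span(X₂, N₂) and D₂X₂ in span(X₁, N₁). The projector preserves both planes and
  -- they are orthogonal.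
  have z₁ : ⟪fderiv ℝ X₁ x (x₁ x), fderiv ℝ Y x (x₂ x)⟫ = 0 := by
    have e₁ := hN.on.expand_four (fderiv ℝ X₁ x (x₁ x))
    have e₂ := hN.on.expand_four (fderiv ℝ X₂ x (x₂ x))
    rw [(hD hx hN _).1, (hD hx hN _).2.2.2.1] at e₁
    rw [(hD hx hN _).2.1, (hD hx hN _).2.2.2.2.1] at e₂
    rw [eY, e₁, e₂]
    simp only [map_add, map_smul, hN.map_X₁, hN.map_N₁, hN.map_X₂, hN.map_N₂, inner_add_left,
      inner_add_right, inner_sub_right, real_inner_smul_left, real_inner_smul_right, o₁, o₂, o₃,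
      o₄, o₅, o₆, q₁, q₂, q₃, q₄, q₅, q₆]
    ring
  have z₂ : ⟪fderiv ℝ (fun y => fderiv ℝ X₁ y (x₂ y)) x (x₁ x), N₂⟫ = 0 := by
    have sB : DifferentiableAt ℝ (fun y => ⟪X₂ y, fderiv ℝ X₁ y (x₂ y)⟫) x :=
      d₂.inner ℝ (sD₂.differentiableAt_of_isOpen hU hx)
    have e : (fun y => fderiv ℝ X₁ y (x₂ y)) =ᶠ[𝓝 x]
        fun y => ⟪X₂ y, fderiv ℝ X₁ y (x₂ y)⟫ • X₂ y := by
      filter_upwards [hU.mem_nhds hx] with y hy using hDl hy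
    rw [e.fderiv_eq, fderiv_fun_smul sB d₂, real_inner_comm]
    simp only [add_apply, smul_apply, ContinuousLinearMap.smulRight_apply, inner_add_right,
      real_inner_smul_right, (hD hx hN _).2.2.2.2.1, q₆]
    ring
  set β := fderiv ℝ x₂ x (x₁ x) - fderiv ℝ x₁ x (x₂ x) with hβ
  -- The Lie bracket in the frame, read off from D₁X₂ − D₂X₁. Its x₁-coefficient −A is what turns
  -- the commutator identity for X₁ into a quadratic equation for A.
  have hβ' : β = -(A x) • x₁ x - ⟪X₂ x, fderiv ℝ X₁ x (x₂ x)⟫ • x₂ x := by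
    apply hF.inj x hx
    rw [← deriv_frame_sub hU hF.smooth v₁ v₂ l₁ l₂ hx, map_sub, map_smul, map_smul, l₁ x hx,
      l₂ x hx, hDr hx, (hD hx hN _).2.2.1, ← hDl hx]
    simp only [A, real_inner_comm (X₂ x) (fderiv ℝ X₁ x (x₁ x))]
  have hbr := fderiv_along_field_sub hU hF.smooth_left v₁ v₂ hx
  rw [← hβ, hβ', map_sub, map_smul, map_smul] at hbr
  have hbr2 := congrArg (fun u => ⟪u, N₂⟫) hbr
  simp only [inner_sub_left, z₂, real_inner_smul_left] at hbr2
  have z₃ : ⟪fderiv ℝ X₁ x (x₂ x), N₂⟫ = 0 := by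
    rw [hDl hx, real_inner_smul_left, o₆, mul_zero]
  have hmain : ⟪fderiv ℝ (fun y => fderiv ℝ X₁ y (x₁ y)) x (x₂ x), N₂⟫ =
      A x * ⟪fderiv ℝ X₁ x (x₁ x), N₂⟫ := by
    rw [z₃] at hbr2; linarith
  have dA : DifferentiableAt ℝ A x := dD.inner ℝ d₂
  have hp : fderiv ℝ (fun y => (c₁ ^ 2 - c₂ ^ 2) * A y) x (x₂ x) =
      fderiv ℝ (fun y => ⟪fderiv ℝ X₁ y (x₁ y), Y y⟫) x (x₂ x) := by
    have e : (fun y => (c₁ ^ 2 - c₂ ^ 2) * A y) =ᶠ[𝓝 x]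
        fun y => ⟪fderiv ℝ X₁ y (x₁ y), Y y⟫ := by
      filter_upwards [hU.mem_nhds hx] with y hy using hKA y hy
    rw [e.fderiv_eq]
  rw [fderiv_inner_apply ℝ dD dY, z₁, fderiv_const_mul dA, hYN hN, real_inner_smul_right,
    hmain, smul_apply, smul_eq_mul] at hp
  have hK' := hKA x hx
  rw [hYN hN, real_inner_smul_right] at hK'
  apply mul_left_cancel₀ (sub_ne_zero.2 hK)
  change (c₁ ^ 2 - c₂ ^ 2) * fderiv ℝ A x (x₂ x) = (c₁ ^ 2 - c₂ ^ 2) * A x ^ 2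
  rw [hp]
  linear_combination -(A x) * hK'

theorem exists_movingFrame (hF : PrincipalFrame W c₁ c₂ φ X₁ X₂ U) (hW : Module.finrank ℝ W = 2)
    (h₁ : c₁ ^ 2 + s₁ ^ 2 = 1) (h₂ : c₂ ^ 2 + s₂ ^ 2 = 1) (hK : c₁ ^ 2 ≠ c₂ ^ 2) :
    ∃ x₁ x₂, MovingFrame φ X₁ X₂ x₁ x₂ U := by
  obtain ⟨x₁, v₁, l₁⟩ := exists_smooth_lift hF.smooth hF.isOpen hF.inj hF.smooth_left hF.mem_left
  obtain ⟨x₂, v₂, l₂⟩ := exists_smooth_lift hF.smooth hF.isOpen hF.inj hF.smooth_right hF.mem_right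
  exact ⟨x₁, x₂, hF.isOpen, hF.smooth, hF.inj, hF.smooth_left, hF.smooth_right, v₁, v₂, l₁, l₂,
    fun x hx => (hF.pair x hx).norm_left, fun x hx => (hF.pair x hx).norm_right,
    fun x hx => (hF.pair x hx).ortho,
    fun x hx => ⟨_, hF.deriv_left hW h₁ h₂ v₁ v₂ l₁ l₂ hx⟩,
    fun x hx => ⟨_, hF.swap.deriv_left hW h₂ h₁ v₂ v₁ l₂ l₁ hx⟩,
    fun x hx => hF.riccati hW h₁ h₂ hK v₁ v₂ l₁ l₂ hx,
    fun x hx => hF.swap.riccati hW h₂ h₁ hK.symm v₂ v₁ l₂ l₁ hx⟩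

theorem smul_signs (hF : PrincipalFrame W c₁ c₂ φ X₁ X₂ U) {a b : ℝ} (ha : |a| = 1)
    (hb : |b| = 1) : PrincipalFrame W c₁ c₂ φ (fun x => a • X₁ x) (fun x => b • X₂ x) U :=
  ⟨hF.isOpen, hF.smooth, hF.inj, hF.smooth_left.const_smul a, hF.smooth_right.const_smul b,
    fun x hx => Submodule.smul_mem _ _ (hF.mem_left x hx),
    fun x hx => Submodule.smul_mem _ _ (hF.mem_right x hx),
    fun x hx => (hF.pair x hx).of_unit_multiples rfl rfl
      (by rw [norm_smul, (hF.pair x hx).norm_left, Real.norm_eq_abs, ha, one_mul])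
      (by rw [norm_smul, (hF.pair x hx).norm_right, Real.norm_eq_abs, hb, one_mul])⟩

end PrincipalFrame

end MovingFrames

/-! ### Line fields with smooth moving frames -/

section FrameSystems

variable {W : Submodule ℝ (Eucl 4)} {c₁ s₁ c₂ s₂ : ℝ}

/-- The unit vectors of `T` on which the compression of the projector onto `W` is `c ^ 2`. -/
def principalLine (T W : Submodule ℝ (Eucl 4)) (c : ℝ) : Set (Eucl 4) :=
  {v | v ∈ T ∧ ‖v‖ = 1 ∧ ∀ u ∈ T, ⟪W.starProjection v, u⟫ = c ^ 2 * ⟪v, u⟫}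

theorem IsPrincipalPair.principalLine_eq {T : Submodule ℝ (Eucl 4)}
    (hT : Module.finrank ℝ T = 2) {X₁ X₂ : Eucl 4} (h : IsPrincipalPair W c₁ c₂ X₁ X₂)
    (h₁ : X₁ ∈ T) (h₂ : X₂ ∈ T) (hK : c₁ ^ 2 ≠ c₂ ^ 2) :
    principalLine T W c₁ = {X₁, -X₁} := by
  have hcomb := fun {u : Eucl 4} (hu : u ∈ T) =>
    eq_comb_of_mem_plane hT h₁ h₂ h.norm_left h.norm_right h.ortho hu
  have hX₁ : X₁ ∈ principalLine T W c₁ := by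
    refine ⟨h₁, h.norm_left, fun u hu => ?_⟩
    rw [hcomb hu]
    simp only [inner_add_right, real_inner_smul_right, h.left_left, h.left_right, h.ortho,
      real_inner_self_eq_norm_sq, h.norm_left]
    ring
  apply Set.Subset.antisymm
  · rintro v ⟨hv, nv, hq⟩
    have hv2 := hcomb hv
    have e₂ : ⟪W.starProjection v, X₂⟫ = c₂ ^ 2 * ⟪X₂, v⟫ := by
      conv_lhs => rw [hv2]
      simp only [map_add, map_smul, inner_add_left, real_inner_smul_left, h.left_right,
        h.right_right]
      ring
    rw [hq _ h₂, real_inner_comm] at e₂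
    have hz : ⟪X₂, v⟫ = 0 := by
      have : (c₁ ^ 2 - c₂ ^ 2) * ⟪X₂, v⟫ = 0 := by linear_combination e₂
      exact (mul_eq_zero.1 this).resolve_left (sub_ne_zero.2 hK)
    rw [hz, zero_smul, add_zero] at hv2
    have : |⟪X₁, v⟫| = 1 := by
      rw [hv2, norm_smul, h.norm_left, mul_one] at nv
      exact nv
    rcases eq_or_eq_neg_of_abs_eq this with h' | h'
    · left; rw [hv2, h', one_smul]
    · right; rw [Set.mem_singleton_iff, hv2, h', neg_smul, one_smul]
  · rintro v (rfl | rfl)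
    · exact hX₁
    · exact ⟨T.neg_mem h₁, by rw [norm_neg, h.norm_left], fun u hu => by
        rw [map_neg, inner_neg_left, inner_neg_left, hX₁.2.2 u hu]; ring⟩

variable {M : Type*} [TopologicalSpace M] [ChartedSpace (Eucl 2) M]

/-- Around `p`, in the chart `e`, the line fields `L₁, L₂` are spanned by a moving frame with value
`(a, b)` at `p`. -/
structure FrameChart (f : M → Eucl 4) (L₁ L₂ : M → Set (Eucl 4)) (p : M) (a b : Eucl 4)
    (e : OpenPartialHomeomorph M (Eucl 2)) (U : Set (Eucl 2)) (X₁ X₂ : Eucl 2 → Eucl 4)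
    (x₁ x₂ : Eucl 2 → Eucl 2) : Prop where
  atlas : e ∈ IsManifold.maximalAtlas (𝓡 2) ∞ M
  mem_source : p ∈ e.source
  mem : e p ∈ U
  subset : U ⊆ e.target
  frame : MovingFrame (f ∘ e.symm) X₁ X₂ x₁ x₂ U
  left : X₁ (e p) = a
  right : X₂ (e p) = b
  lines_left : ∀ x ∈ U, L₁ (e.symm x) = {X₁ x, -X₁ x}
  lines_right : ∀ x ∈ U, L₂ (e.symm x) = {X₂ x, -X₂ x}

theorem FrameChart.swap {f : M → Eucl 4} {L₁ L₂ : M → Set (Eucl 4)} {p : M} {a b : Eucl 4}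
    {e : OpenPartialHomeomorph M (Eucl 2)} {U : Set (Eucl 2)} {X₁ X₂ : Eucl 2 → Eucl 4}
    {x₁ x₂ : Eucl 2 → Eucl 2} (h : FrameChart f L₁ L₂ p a b e U X₁ X₂ x₁ x₂) :
    FrameChart f L₂ L₁ p b a e U X₂ X₁ x₂ x₁ :=
  ⟨h.atlas, h.mem_source, h.mem, h.subset, h.frame.swap, h.right, h.left, h.lines_right,
    h.lines_left⟩

/-- A pair of orthogonal line fields on an immersed surface, given by their unit vectors, that are
spanned by moving frames around every point. -/
structure IsFrameSystem (f : M → Eucl 4) (L₁ L₂ : M → Set (Eucl 4)) : Prop where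
  nonempty_left : ∀ p, (L₁ p).Nonempty
  nonempty_right : ∀ p, (L₂ p).Nonempty
  exists_chart : ∀ p, ∀ a ∈ L₁ p, ∀ b ∈ L₂ p, ∃ e U X₁ X₂ x₁ x₂,
    FrameChart f L₁ L₂ p a b e U X₁ X₂ x₁ x₂

theorem IsFrameSystem.swap {f : M → Eucl 4} {L₁ L₂ : M → Set (Eucl 4)}
    (h : IsFrameSystem f L₁ L₂) : IsFrameSystem f L₂ L₁ :=
  ⟨h.nonempty_right, h.nonempty_left, fun p b hb a ha => by
    obtain ⟨e, U, X₁, X₂, x₁, x₂, hc⟩ := h.exists_chart p a ha b hb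
    exact ⟨e, U, X₂, X₁, x₂, x₁, hc.swap⟩⟩

variable [IsManifold (𝓡 2) ∞ M] {f : M → Eucl 4}

theorem exists_principalFrame_chart (hf : IsSmoothImmersion 2 f) (hW : Module.finrank ℝ W = 2)
    {θ₁ θ₂ : ℝ} (hθ : ∀ p : M, ArePrincipalAngles (tangentPlane f p) W θ₁ θ₂) (p : M) :
    ∃ V ⊆ (chartAt (Eucl 2) p).target, chartAt (Eucl 2) p p ∈ V ∧ ∃ X₁ X₂,
      PrincipalFrame W (Real.cos θ₁) (Real.cos θ₂) (f ∘ (chartAt (Eucl 2) p).symm) X₁ X₂ V :=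
  have he := IsManifold.chart_mem_maximalAtlas (I := 𝓡 2) (n := ∞) p
  exists_principalFrame hW (chartAt (Eucl 2) p).open_target (hf.contDiffOn_chart he)
    (fun y hy => hf.injective_fderiv_chart he hy)
    (fun y hy => by rw [hf.range_fderiv_chart he hy]; exact hθ _)
    ((chartAt (Eucl 2) p).map_source (mem_chart_source _ p))

/-- A local principal frame spans the two lines and is determined up to signs; since signs may be
changed freely, it can be given any admissible values at the centre. -/
theorem isFrameSystem_principalLine (hf : IsSmoothImmersion 2 f) (hW : Module.finrank ℝ W = 2)
    {θ₁ θ₂ : ℝ} (hθ : ∀ p : M, ArePrincipalAngles (tangentPlane f p) W θ₁ θ₂)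
    (hK : Real.cos θ₁ ^ 2 ≠ Real.cos θ₂ ^ 2) :
    IsFrameSystem f (fun p => principalLine (tangentPlane f p) W (Real.cos θ₁))
      (fun p => principalLine (tangentPlane f p) W (Real.cos θ₂)) := by
  have key : ∀ (p : M) (V : Set (Eucl 2)), V ⊆ (chartAt (Eucl 2) p).target → ∀ X₁ X₂,
      PrincipalFrame W (Real.cos θ₁) (Real.cos θ₂) (f ∘ (chartAt (Eucl 2) p).symm) X₁ X₂ V →
      ∀ x ∈ V, principalLine (tangentPlane f ((chartAt (Eucl 2) p).symm x)) W (Real.cos θ₁) =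
        {X₁ x, -X₁ x} ∧
        principalLine (tangentPlane f ((chartAt (Eucl 2) p).symm x)) W (Real.cos θ₂) =
        {X₂ x, -X₂ x} := by
    intro p V hV X₁ X₂ hF x hx
    rw [← hf.range_fderiv_chart (IsManifold.chart_mem_maximalAtlas (I := 𝓡 2) (n := ∞) p) (hV hx)]
    exact ⟨(hF.pair x hx).principalLine_eq (hF.finrank_range hx) (hF.mem_left x hx)
        (hF.mem_right x hx) hK,
      (hF.pair x hx).swap.principalLine_eq (hF.finrank_range hx) (hF.mem_right x hx)
        (hF.mem_left x hx) hK.symm⟩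
  have hpp := fun p : M => (chartAt (Eucl 2) p).left_inv (mem_chart_source _ p)
  refine ⟨fun p => ?_, fun p => ?_, fun p a ha b hb => ?_⟩
  · obtain ⟨V, hV, hpV, X₁, X₂, hF⟩ := exists_principalFrame_chart hf hW hθ p
    have := (key p V hV X₁ X₂ hF _ hpV).1
    rw [hpp] at this
    rw [this]; exact ⟨_, Or.inl rfl⟩
  · obtain ⟨V, hV, hpV, X₁, X₂, hF⟩ := exists_principalFrame_chart hf hW hθ p
    have := (key p V hV X₁ X₂ hF _ hpV).2
    rw [hpp] at this
    rw [this]; exact ⟨_, Or.inl rfl⟩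
  · obtain ⟨V, hV, hpV, X₁, X₂, hF⟩ := exists_principalFrame_chart hf hW hθ p
    have hsign : ∀ {v w : Eucl 4}, v ∈ ({w, -w} : Set (Eucl 4)) → ∃ r : ℝ, |r| = 1 ∧ r • w = v := by
      rintro v w (rfl | rfl)
      · exact ⟨1, by simp, by simp⟩
      · exact ⟨-1, by simp, by simp⟩
    have h1 := (key p V hV X₁ X₂ hF _ hpV)
    rw [hpp] at h1
    rw [h1.1] at ha
    rw [h1.2] at hb
    obtain ⟨r, hr, rfl⟩ := hsign ha
    obtain ⟨r', hr', rfl⟩ := hsign hb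
    have hF' := hF.smul_signs hr hr'
    obtain ⟨x₁, x₂, hM⟩ := hF'.exists_movingFrame hW (Real.cos_sq_add_sin_sq θ₁)
      (Real.cos_sq_add_sin_sq θ₂) hK
    exact ⟨_, V, _, _, x₁, x₂, IsManifold.chart_mem_maximalAtlas (I := 𝓡 2) (n := ∞) p,
      mem_chart_source _ p, hpV, hV, hM, rfl, rfl,
      fun x hx => (key p V hV _ _ hF' x hx).1, fun x hx => (key p V hV _ _ hF' x hx).2⟩

/-! ### Equal principal angles: constancy of the tangent plane -/

namespace PrincipalFrame

variable {φ X₁ X₂ : Eucl 2 → Eucl 4} {U : Set (Eucl 2)} {x : Eucl 2} {c s : ℝ}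

/-- When the two eigenvalues agree and are neither `0` nor `1`, the frame stays in its plane. -/
theorem deriv_left_of_eq (hF : PrincipalFrame W c c φ X₁ X₂ U) (hW : Module.finrank ℝ W = 2)
    (h : c ^ 2 + s ^ 2 = 1) (hcs : c * s ≠ 0) (hx : x ∈ U) (v : Eucl 2) :
    fderiv ℝ X₁ x v = ⟪X₂ x, fderiv ℝ X₁ x v⟫ • X₂ x := by
  obtain ⟨x₁, v₁, l₁⟩ := exists_smooth_lift hF.smooth hF.isOpen hF.inj hF.smooth_left hF.mem_left
  obtain ⟨x₂, v₂, l₂⟩ := exists_smooth_lift hF.smooth hF.isOpen hF.inj hF.smooth_right hF.mem_right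
  obtain ⟨N₁, N₂, hN⟩ := hF.exists_normals hx hW h h
  have hD := fun v => IsPrincipalPair.deriv hW h h (hF.eventually_pair hx)
    (hF.differentiableAt_left hx) (hF.swap.differentiableAt_left hx) hN v
  -- With equal eigenvalues the last relation of `IsPrincipalPair.deriv` loses its left-hand side
  -- and makes ⟨N₂, dX₁⟩ and ⟨N₁, dX₂⟩ opposite. Torsion-freeness kills the first along x₂ and the
  -- second along x₁, so ⟨N₂, dX₁⟩ vanishes in every direction.
  have hsum : ∀ v, ⟪N₂, fderiv ℝ X₁ x v⟫ + ⟪N₁, fderiv ℝ X₂ x v⟫ = 0 := fun v => by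
    have := (hD v).2.2.2.2.2
    have h' : c * s * (⟪N₂, fderiv ℝ X₁ x v⟫ + ⟪N₁, fderiv ℝ X₂ x v⟫) = 0 := by
      linear_combination -this
    exact (mul_eq_zero.1 h').resolve_left hcs
  have hn₁ := hF.inner_normal_eq_zero hx hN (hF.mem_left x hx)
  have hn₂ := hF.inner_normal_eq_zero hx hN (hF.mem_right x hx)
  have z₂ : ⟪N₂, fderiv ℝ X₁ x (x₂ x)⟫ = 0 := by
    rw [hF.deriv_left hW h h v₁ v₂ l₁ l₂ hx, real_inner_smul_right, hn₂.2, mul_zero]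
  have z₁ : ⟪N₂, fderiv ℝ X₁ x (x₁ x)⟫ = 0 := by
    have : ⟪N₁, fderiv ℝ X₂ x (x₁ x)⟫ = 0 := by
      rw [hF.swap.deriv_left hW h h v₂ v₁ l₂ l₁ hx, real_inner_smul_right, hn₁.1, mul_zero]
    have h' := hsum (x₁ x)
    rwa [this, add_zero] at h'
  have hv : v = ⟪X₁ x, fderiv ℝ φ x v⟫ • x₁ x + ⟪X₂ x, fderiv ℝ φ x v⟫ • x₂ x := by
    apply hF.inj x hx
    rw [map_add, map_smul, map_smul, l₁ x hx, l₂ x hx]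
    exact hF.eq_comb hx ⟨v, rfl⟩
  have z : ⟪N₂, fderiv ℝ X₁ x v⟫ = 0 := by
    rw [hv, map_add, map_smul, map_smul, inner_add_right, real_inner_smul_right,
      real_inner_smul_right, z₁, z₂]
    ring
  have := hN.on.expand_four (fderiv ℝ X₁ x v)
  rw [(hD _).1, (hD _).2.2.2.1, z] at this
  simpa using this

/-- The frame only rotates: dX₁ = kX₂ and dX₂ = −kX₁. So the orthogonal projector onto its span,
applied to any fixed vector, has zero derivative. -/
theorem eventually_range_eq (hF : PrincipalFrame W c c φ X₁ X₂ U) (hW : Module.finrank ℝ W = 2)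
    (h : c ^ 2 + s ^ 2 = 1) (hcs : c * s ≠ 0) (hx : x ∈ U) :
    ∀ᶠ y in 𝓝 x, (fderiv ℝ φ y).range = (fderiv ℝ φ x).range := by
  obtain ⟨r, hr, hball⟩ := Metric.isOpen_iff.1 hF.isOpen x hx
  have hconst : ∀ u : Eucl 4, ∀ y ∈ Metric.ball x r, ⟪X₁ y, u⟫ • X₁ y + ⟪X₂ y, u⟫ • X₂ y =
      ⟪X₁ x, u⟫ • X₁ x + ⟪X₂ x, u⟫ • X₂ x := by
    intro u y hy
    have hd : ∀ z ∈ Metric.ball x r,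
        HasFDerivAt (fun y => ⟪X₁ y, u⟫ • X₁ y + ⟪X₂ y, u⟫ • X₂ y)
          (0 : Eucl 2 →L[ℝ] Eucl 4) z := by
      intro z hz
      have hzU := hball hz
      have d₁ := (hF.differentiableAt_left hzU).hasFDerivAt
      have d₂ := (hF.swap.differentiableAt_left hzU).hasFDerivAt
      have := ((d₁.inner ℝ (hasFDerivAt_const u z)).smul d₁).add
        ((d₂.inner ℝ (hasFDerivAt_const u z)).smul d₂)
      refine HasFDerivAt.congr_fderiv this ?_
      ext1 v
      obtain ⟨N₁, N₂, hN⟩ := hF.exists_normals hzU hW h h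
      have hD := IsPrincipalPair.deriv hW h h (hF.eventually_pair hzU)
        (hF.differentiableAt_left hzU) (hF.swap.differentiableAt_left hzU) hN v
      have e₁ := hF.deriv_left_of_eq hW h hcs hzU v
      have e₂ := hF.swap.deriv_left_of_eq hW h hcs hzU v
      rw [hD.2.2.1] at e₂
      set k := ⟪X₂ z, fderiv ℝ X₁ z v⟫
      simp [fderivInnerCLM_apply, e₁, e₂, real_inner_smul_left]
      module
    exact (convex_ball x r).is_const_of_fderivWithin_eq_zero (𝕜 := ℝ)
      (fun z hz => (hd z hz).differentiableAt.differentiableWithinAt)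
      (fun z hz => by
        rw [fderivWithin_of_isOpen Metric.isOpen_ball hz, (hd z hz).fderiv]) hy
      (Metric.mem_ball_self hr)
  have hmem : ∀ y ∈ Metric.ball x r, ∀ u, u ∈ (fderiv ℝ φ y).range ↔
      u = ⟪X₁ x, u⟫ • X₁ x + ⟪X₂ x, u⟫ • X₂ x := by
    intro y hy u
    rw [← hconst u y hy]
    refine ⟨fun hu => hF.eq_comb (hball hy) hu, fun hu => ?_⟩
    rw [hu]
    exact Submodule.add_mem _ (Submodule.smul_mem _ _ (hF.mem_left y (hball hy)))
      (Submodule.smul_mem _ _ (hF.mem_right y (hball hy)))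
  filter_upwards [Metric.ball_mem_nhds x hr] with y hy
  ext u
  rw [hmem y hy, hmem x (Metric.mem_ball_self hr)]

end PrincipalFrame

theorem tangentPlane_eq_of_not_degenerate [ConnectedSpace M] (hf : IsSmoothImmersion 2 f)
    (hW : Module.finrank ℝ W = 2) {θ₁ θ₂ : ℝ}
    (hθ : ∀ p : M, ArePrincipalAngles (tangentPlane f p) W θ₁ θ₂)
    (hc : Real.cos θ₁ = Real.cos θ₂) (hcs : Real.cos θ₁ * Real.sin θ₁ ≠ 0) (p q : M) :
    tangentPlane f p = tangentPlane f q := by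
  suffices h : IsLocallyConstant (tangentPlane f) from h.apply_eq_of_preconnectedSpace p q
  rw [IsLocallyConstant.iff_eventually_eq]
  intro p
  obtain ⟨V, hV, hpV, X₁, X₂, hF⟩ := exists_principalFrame_chart hf hW hθ p
  rw [← hc] at hF
  set e := chartAt (Eucl 2) p
  have he : e ∈ IsManifold.maximalAtlas (𝓡 2) ∞ M :=
    IsManifold.chart_mem_maximalAtlas (I := 𝓡 2) (n := ∞) p
  have hp : p ∈ e.source := mem_chart_source _ p
  have := hF.eventually_range_eq hW (Real.cos_sq_add_sin_sq θ₁) hcs hpV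
  filter_upwards [(e.continuousAt hp).eventually this, e.open_source.mem_nhds hp] with q hq hqs
  rwa [hf.range_fderiv_chart he (e.map_source hqs), hf.range_fderiv_chart he (e.map_source hp),
    e.left_inv hqs, e.left_inv hp] at hq

/-- In the degenerate cases the plane is known outright: it is `Wᗮ` if the cosine vanishes and `W`
if the sine vanishes. Otherwise it is locally constant on a connected surface. Equality of the
squared cosines suffices, because angles in [0, π/2] have nonnegative cosine. -/
theorem tangentPlane_eq [ConnectedSpace M] (hf : IsSmoothImmersion 2 f)
    (hW : Module.finrank ℝ W = 2) {θ₁ θ₂ : ℝ}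
    (hθ : ∀ p : M, ArePrincipalAngles (tangentPlane f p) W θ₁ θ₂)
    (hc : Real.cos θ₁ ^ 2 = Real.cos θ₂ ^ 2) (p q : M) :
    tangentPlane f p = tangentPlane f q := by
  have hpos : ∀ θ, 0 ≤ θ → θ ≤ Real.pi / 2 → 0 ≤ Real.cos θ := fun θ h h' =>
    Real.cos_nonneg_of_mem_Icc ⟨by linarith [Real.pi_pos], h'⟩
  have hp := hθ p
  have hc' : Real.cos θ₁ = Real.cos θ₂ :=
    (sq_eq_sq₀ (hpos _ hp.1 (hp.2.1.trans hp.2.2.1)) (hpos _ (hp.1.trans hp.2.1) hp.2.2.1)).1 hc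
  by_cases hcs : Real.cos θ₁ * Real.sin θ₁ = 0
  swap
  · exact tangentPlane_eq_of_not_degenerate hf hW hθ hc' hcs p q
  have hfin : ∀ p : M, Module.finrank ℝ (tangentPlane f p) = 2 := fun p => by
    have := LinearMap.finrank_range_of_inj (f := (show Eucl 2 →L[ℝ] Eucl 4 from
      mfderiv (𝓡 2) 𝓘(ℝ, Eucl 4) f p).toLinearMap) (hf.2 p)
    exact this.trans (by simp)
  have hcomb : ∀ p : M, ∃ X₁ X₂ : Eucl 4, IsPrincipalPair W (Real.cos θ₁) (Real.cos θ₁) X₁ X₂ ∧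
      ∀ u ∈ tangentPlane f p, u = ⟪X₁, u⟫ • X₁ + ⟪X₂, u⟫ • X₂ := by
    intro p
    obtain ⟨X₁, h₁, X₂, h₂, n₁, n₂, o, q₁, q₂, q₁₂⟩ := (hθ p).exists_orthonormal_pair hW
    rw [← hc] at q₂
    exact ⟨X₁, X₂, ⟨n₁, n₂, o, q₁, q₂, q₁₂⟩, fun u hu =>
      eq_comb_of_mem_plane (hfin p) h₁ h₂ n₁ n₂ o hu⟩
  have hsq : ∀ X : Eucl 4, ⟪W.starProjection X, X⟫ = ‖W.starProjection X‖ ^ 2 := fun X => by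
    rw [← real_inner_self_eq_norm_sq, ← W.inner_starProjection_left_eq_right,
      W.starProjection_eq_self_iff.2 (W.starProjection_apply_mem X)]
  rcases mul_eq_zero.1 hcs with h0 | h0
  · have : ∀ p : M, tangentPlane f p = Wᗮ := by
      intro p
      apply Submodule.eq_of_le_of_finrank_eq
      · intro u hu
        obtain ⟨X₁, X₂, hX, huX⟩ := hcomb p
        rw [h0] at hX
        rw [huX u hu]
        refine Submodule.add_mem _ (Submodule.smul_mem _ _ ?_) (Submodule.smul_mem _ _ ?_)
        · rw [← Submodule.starProjection_apply_eq_zero_iff]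
          have := hX.left_left
          rw [hsq] at this
          simpa using this
        · rw [← Submodule.starProjection_apply_eq_zero_iff]
          have := hX.right_right
          rw [hsq] at this
          simpa using this
      · have := W.finrank_add_finrank_orthogonal
        simp only [finrank_euclideanSpace, Fintype.card_fin, hW] at this
        rw [hfin]; omega
    rw [this, this]
  · have h1 : Real.cos θ₁ ^ 2 = 1 := by
      have := Real.cos_sq_add_sin_sq θ₁
      rw [h0] at this; linarith
    have hW' : ∀ X : Eucl 4, ‖X‖ = 1 → ⟪W.starProjection X, X⟫ = 1 → X ∈ W := by
      intro X nX hX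
      rw [← W.starProjection_eq_self_iff, ← sub_eq_zero, ← norm_eq_zero,
        ← sq_eq_zero_iff, ← real_inner_self_eq_norm_sq]
      rw [inner_sub_left, inner_sub_right, inner_sub_right, real_inner_self_eq_norm_sq,
        real_inner_self_eq_norm_sq, ← hsq, real_inner_comm (W.starProjection X) X, hX, nX]
      norm_num
    have : ∀ p : M, tangentPlane f p = W := by
      intro p
      apply Submodule.eq_of_le_of_finrank_eq
      · intro u hu
        obtain ⟨X₁, X₂, hX, huX⟩ := hcomb p
        rw [huX u hu]
        exact Submodule.add_mem _
          (Submodule.smul_mem _ _ (hW' _ hX.norm_left (hX.left_left.trans h1)))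
          (Submodule.smul_mem _ _ (hW' _ hX.norm_right (hX.right_right.trans h1)))
      · rw [hfin, hW]
    rw [this, this]

/-- When the squared cosines agree there are no distinguished lines, but the tangent plane is
constant, so a fixed orthonormal pair spans two constant line fields. Its derivatives vanish, and
the Riccati equations hold trivially. -/
theorem exists_frameSystem [ConnectedSpace M] (hf : IsSmoothImmersion 2 f)
    (hW : Module.finrank ℝ W = 2) (hangles : HasConstantPrincipalAngles f W) :
    ∃ L₁ L₂, IsFrameSystem f L₁ L₂ := by
  obtain ⟨θ₁, θ₂, hθ⟩ := hangles
  by_cases hK : Real.cos θ₁ ^ 2 = Real.cos θ₂ ^ 2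
  swap
  · exact ⟨_, _, isFrameSystem_principalLine hf hW hθ hK⟩
  obtain ⟨p₀⟩ := (inferInstance : Nonempty M)
  obtain ⟨a, ha, b, hb, na, nb, hab, -, -, -⟩ := (hθ p₀).exists_orthonormal_pair hW
  refine ⟨fun _ => {a, -a}, fun _ => {b, -b}, fun p => ⟨a, Or.inl rfl⟩, fun p => ⟨b, Or.inl rfl⟩,
    fun p a' ha' b' hb' => ?_⟩
  have he := IsManifold.chart_mem_maximalAtlas (I := 𝓡 2) (n := ∞) p
  set e := chartAt (Eucl 2) p
  have hpe : p ∈ e.source := mem_chart_source _ p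
  have hpair : ∀ {v w : Eucl 4}, v ∈ ({w, -w} : Set (Eucl 4)) →
      ({w, -w} : Set (Eucl 4)) = {v, -v} ∧ ‖v‖ = ‖w‖ ∧ (∃ r : ℝ, v = r • w) := by
    rintro v w (rfl | rfl)
    · exact ⟨rfl, rfl, 1, by simp⟩
    · exact ⟨by rw [neg_neg, Set.pair_comm], norm_neg _, -1, by simp⟩
  obtain ⟨la, na', ra, hra⟩ := hpair ha'
  obtain ⟨lb, nb', rb, hrb⟩ := hpair hb'
  have hmem : ∀ {v w : Eucl 4} {r : ℝ}, v = r • w → w ∈ tangentPlane f p₀ →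
      ∀ x ∈ e.target, v ∈ (fderiv ℝ (f ∘ e.symm) x).range := by
    rintro v w r rfl hw x hx
    rw [hf.range_fderiv_chart he hx, tangentPlane_eq hf hW hθ hK _ p₀]
    exact Submodule.smul_mem _ _ hw
  obtain ⟨x₁, v₁, l₁⟩ := exists_smooth_lift (hf.contDiffOn_chart he) e.open_target
    (fun y hy => hf.injective_fderiv_chart he hy) (X := fun _ => a') contDiffOn_const
    (hmem hra ha)
  obtain ⟨x₂, v₂, l₂⟩ := exists_smooth_lift (hf.contDiffOn_chart he) e.open_target
    (fun y hy => hf.injective_fderiv_chart he hy) (X := fun _ => b') contDiffOn_const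
    (hmem hrb hb)
  refine ⟨e, e.target, fun _ => a', fun _ => b', x₁, x₂, he, hpe, e.map_source hpe, subset_rfl,
    ⟨e.open_target, hf.contDiffOn_chart he, fun y hy => hf.injective_fderiv_chart he hy,
      contDiffOn_const, contDiffOn_const, v₁, v₂, l₁, l₂, fun _ _ => na'.trans na,
      fun _ _ => nb'.trans nb, fun _ _ => ?_, fun _ _ => ⟨0, by simp⟩, fun _ _ => ⟨0, by simp⟩,
      fun _ _ => by simp, fun _ _ => by simp⟩, rfl, rfl, fun _ _ => la, fun _ _ => lb⟩
  rw [hra, hrb, real_inner_smul_left, real_inner_smul_right, hab, mul_zero, mul_zero]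

end FrameSystems

/-! ### Curves tangent to a line field -/

section LineCurves

/-- Composing φ with a linear left inverse of its differential gives a local diffeomorphism of the
plane with identity differential at c(t). A continuous curve is thus differentiable as soon as its
image in ℝ⁴ is, provided that the velocity is tangent. -/
theorem hasDerivAt_of_comp_immersion {φ : Eucl 2 → Eucl 4} {U : Set (Eucl 2)} (hU : IsOpen U)
    (hφ : ContDiffOn ℝ ∞ φ U) {c : ℝ → Eucl 2} {t : ℝ} (hc : ContinuousAt c t) (ht : c t ∈ U)
    (hinj : Function.Injective (fderiv ℝ φ (c t))) {w : Eucl 2}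
    (h : HasDerivAt (φ ∘ c) (fderiv ℝ φ (c t) w) t) : HasDerivAt c w t := by
  obtain ⟨P, hP⟩ := (fderiv ℝ φ (c t)).toLinearMap.exists_leftInverse_of_injective
    (LinearMap.ker_eq_bot.2 hinj)
  have hP' : ∀ v, LinearMap.toContinuousLinearMap P (fderiv ℝ φ (c t) v) = v :=
    fun v => LinearMap.congr_fun hP v
  have hs : HasStrictFDerivAt φ (fderiv ℝ φ (c t)) (c t) :=
    ((hφ.contDiffAt (hU.mem_nhds ht)).hasStrictFDerivAt (by simp))
  have hg : HasStrictFDerivAt (fun x => LinearMap.toContinuousLinearMap P (φ x))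
      ((ContinuousLinearEquiv.refl ℝ (Eucl 2) : Eucl 2 ≃L[ℝ] Eucl 2) : Eucl 2 →L[ℝ] Eucl 2)
      (c t) := by
    refine ((LinearMap.toContinuousLinearMap P).hasStrictFDerivAt.comp (c t) hs).congr_fderiv ?_
    ext1 v
    exact hP' v
  have hl := hc.eventually hg.eventually_left_inverse
  have hd := hg.to_localInverse.hasFDerivAt.comp_hasDerivAt t
    ((LinearMap.toContinuousLinearMap P).hasFDerivAt.comp_hasDerivAt t h)
  have := hd.congr_of_eventuallyEq (hl.mono fun s hs => hs.symm)
  rw [hP'] at this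
  exact this

variable {M : Type*} [TopologicalSpace M]

/-- Near `t` the curve `γ` is continuous and, seen in `ℝ⁴`, continuously differentiable with
derivative in the line field `L`. -/
structure IsLineCurveAt (f : M → Eucl 4) (L : M → Set (Eucl 4)) (γ : ℝ → M) (t : ℝ) : Prop where
  cont : ContinuousAt γ t
  diff : DifferentiableAt ℝ (f ∘ γ) t
  mem : deriv (f ∘ γ) t ∈ L (γ t)
  cont_deriv : ContinuousAt (deriv (f ∘ γ)) t

theorem IsLineCurveAt.congr {f : M → Eucl 4} {L : M → Set (Eucl 4)} {γ γ' : ℝ → M} {t : ℝ}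
    (h : IsLineCurveAt f L γ t) (he : γ' =ᶠ[𝓝 t] γ) : IsLineCurveAt f L γ' t := by
  have hf : f ∘ γ' =ᶠ[𝓝 t] f ∘ γ := he.fun_comp f
  refine ⟨h.cont.congr he.symm, h.diff.congr_of_eventuallyEq hf, ?_,
    h.cont_deriv.congr hf.deriv.symm⟩
  rw [hf.deriv_eq, he.eq_of_nhds]
  exact h.mem

theorem deriv_comp_affine {g : ℝ → Eucl 4} (r c t : ℝ) :
    deriv (fun s => g (r * s + c)) t = r • deriv g (r * t + c) := by
  have h := deriv_comp_mul_left r (fun s => g (s + c)) t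
  rw [deriv_comp_add_const] at h
  exact h

theorem IsLineCurveAt.comp_affine {f : M → Eucl 4} {L : M → Set (Eucl 4)} {γ : ℝ → M} {r c t : ℝ}
    (h : IsLineCurveAt f L γ (r * t + c)) (hr : r = 1 ∨ r = -1)
    (hL : ∀ p, ∀ a ∈ L p, -a ∈ L p) : IsLineCurveAt f L (fun s => γ (r * s + c)) t := by
  have hc : ContinuousAt (fun s : ℝ => r * s + c) t := by fun_prop
  have hd : deriv (f ∘ fun s => γ (r * s + c)) = fun s => r • deriv (f ∘ γ) (r * s + c) :=
    funext fun s => deriv_comp_affine (g := f ∘ γ) r c s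
  refine ⟨ContinuousAt.comp (f := fun s : ℝ => r * s + c) h.cont hc, ?_, ?_, ?_⟩
  · exact DifferentiableAt.comp (f := fun s : ℝ => r * s + c) t h.diff (by fun_prop)
  · rw [hd]
    rcases hr with rfl | rfl
    · simpa using h.mem
    · simpa using hL _ _ h.mem
  · rw [hd]
    exact (ContinuousAt.comp (f := fun s : ℝ => r * s + c) h.cont_deriv hc).const_smul r

variable [ChartedSpace (Eucl 2) M] {f : M → Eucl 4} {L₁ L₂ : M → Set (Eucl 4)}

namespace FrameChart

variable {p : M} {a b : Eucl 4} {e : OpenPartialHomeomorph M (Eucl 2)} {U : Set (Eucl 2)}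
  {X₁ X₂ : Eucl 2 → Eucl 4} {x₁ x₂ : Eucl 2 → Eucl 2}

theorem eventually_mem (hc : FrameChart f L₁ L₂ p a b e U X₁ X₂ x₁ x₂) {γ : ℝ → M} {t : ℝ}
    (hγ : ContinuousAt γ t) (hs : γ t ∈ e.source) (hU : e (γ t) ∈ U) :
    ∀ᶠ s in 𝓝 t, γ s ∈ e.source ∧ e (γ s) ∈ U :=
  (hγ.eventually (e.open_source.mem_nhds hs)).and
    ((((e.continuousAt hs).comp hγ).eventually (hc.frame.isOpen.mem_nhds hU)))

/-- A curve tangent to the first line field is an integral curve of one of the two lifts. -/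
theorem eventually_hasDerivAt (hc : FrameChart f L₁ L₂ p a b e U X₁ X₂ x₁ x₂) {γ : ℝ → M} {t : ℝ}
    (hγ : ∀ᶠ s in 𝓝 t, IsLineCurveAt f L₁ γ s) (hs : γ t ∈ e.source) (hU : e (γ t) ∈ U)
    (hd : deriv (f ∘ γ) t = X₁ (e (γ t))) :
    ∀ᶠ s in 𝓝 t, γ s ∈ e.source ∧ e (γ s) ∈ U ∧ deriv (f ∘ γ) s = X₁ (e (γ s)) ∧
      HasDerivAt (e ∘ γ) (x₁ (e (γ s))) s := by
  have ht := hγ.self_of_nhds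
  -- The velocity is ±X₁ at every nearby time; the sign is read off from this continuous inner
  -- product, which is positive at t.
  have hcont : ContinuousAt (fun s => ⟪deriv (f ∘ γ) s, X₁ (e (γ s))⟫) t :=
    ht.cont_deriv.inner
      (ContinuousAt.comp (f := e ∘ γ) (hc.frame.smooth_left.continuousOn.continuousAt
        (hc.frame.isOpen.mem_nhds hU)) ((e.continuousAt hs).comp ht.cont))
  have hpos : ∀ᶠ s in 𝓝 t, 0 < ⟪deriv (f ∘ γ) s, X₁ (e (γ s))⟫ := by
    apply hcont.eventually (lt_mem_nhds _)
    simp only []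
    rw [hd, real_inner_self_eq_norm_sq, hc.frame.norm_left _ hU]
    norm_num
  filter_upwards [hpos, hγ, (hc.eventually_mem ht.cont hs hU).eventually_nhds] with s h₁ h₂ h₃
  obtain ⟨h₄, h₅⟩ := h₃.self_of_nhds
  have hX : deriv (f ∘ γ) s = X₁ (e (γ s)) := by
    have := h₂.mem
    rw [← e.left_inv h₄, hc.lines_left _ h₅] at this
    rcases this with h | h
    · exact h
    · rw [h, inner_neg_left, real_inner_self_eq_norm_sq, hc.frame.norm_left _ h₅] at h₁
      norm_num at h₁
  refine ⟨h₄, h₅, hX, ?_⟩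
  apply hasDerivAt_of_comp_immersion hc.frame.isOpen hc.frame.smooth
    ((e.continuousAt h₄).comp h₂.cont) h₅ (hc.frame.inj _ h₅)
  have hdd := h₂.diff.hasDerivAt
  rw [hX] at hdd
  have hl : fderiv ℝ (f ∘ e.symm) ((e ∘ γ) s) (x₁ (e (γ s))) = X₁ (e (γ s)) :=
    hc.frame.lift_left _ h₅
  rw [hl]
  refine hdd.congr_of_eventuallyEq ?_
  filter_upwards [h₃] with r hr
  simp [e.left_inv hr.1]

theorem neg_mem (hc : FrameChart f L₁ L₂ p a b e U X₁ X₂ x₁ x₂) {v : Eucl 4} (hv : v ∈ L₁ p) :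
    -v ∈ L₁ p := by
  have := hc.lines_left _ hc.mem
  rw [e.left_inv hc.mem_source] at this
  rw [this] at hv ⊢
  rcases hv with rfl | rfl
  · right; rfl
  · left; rw [neg_neg]

/-- The Picard-Lindelöf flow near p provides one lifetime ε for all starting points in a
neighbourhood. This uniformity is what later allows a curve to be continued past a limit point. -/
theorem exists_curve (hc : FrameChart f L₁ L₂ p a b e U X₁ X₂ x₁ x₂) :
    ∃ N ∈ 𝓝 p, ∃ ε > 0, ∀ q ∈ N, q ∈ e.source ∧ e q ∈ U ∧ ∃ γ : ℝ → M, γ 0 = q ∧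
      deriv (f ∘ γ) 0 = X₁ (e q) ∧ ∀ t ∈ Set.Ioo (-ε) ε, IsLineCurveAt f L₁ γ t := by
  have hcd : ContDiffAt ℝ 1 x₁ (e p) :=
    (hc.frame.smooth_vec_left.contDiffAt (hc.frame.isOpen.mem_nhds hc.mem)).of_le (by simp)
  obtain ⟨ε₀, hε₀, a', r, K, K', hr, hpl⟩ := IsPicardLindelof.of_contDiffAt_one hcd
  obtain ⟨α, hα, hαc⟩ := (hpl 0).exists_forall_mem_closedBall_eq_hasDerivWithinAt_continuousOn
  have hnhds : Metric.closedBall (e p) r ×ˢ Set.Icc (0 - ε₀) (0 + ε₀) ∈ 𝓝 (e p, (0 : ℝ)) :=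
    prod_mem_nhds (Metric.closedBall_mem_nhds _ hr) (Icc_mem_nhds (by linarith) (by linarith))
  have hαp : α (e p, 0) = e p := (hα (e p) (Metric.mem_closedBall_self hr.le)).1
  have hev : ∀ᶠ z in 𝓝 (e p, (0 : ℝ)), α z ∈ U := by
    apply (hαc.continuousAt hnhds).eventually (hc.frame.isOpen.mem_nhds _)
    rw [hαp]; exact hc.mem
  obtain ⟨N₀, hN₀, T, hT, hNT⟩ := mem_nhds_prod_iff.1 (Filter.inter_mem hev hnhds)
  obtain ⟨ε, hε, hεT⟩ := Metric.mem_nhds_iff.1 hT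
  refine ⟨e.source ∩ (e ⁻¹' (N₀ ∩ U)), Filter.inter_mem (e.open_source.mem_nhds hc.mem_source)
    ((e.continuousAt hc.mem_source) (Filter.inter_mem hN₀ (hc.frame.isOpen.mem_nhds hc.mem))),
    ε, hε, ?_⟩
  rintro q ⟨hqs, hqN, hqU⟩
  refine ⟨hqs, hqU, fun t => e.symm (α (e q, t)), ?_⟩
  have hIoo : Set.Ioo (-ε) ε ⊆ T := by
    intro t ht
    apply hεT
    rw [Metric.mem_ball, Real.dist_eq, sub_zero, abs_lt]
    exact ht
  have hmem : ∀ t ∈ Set.Ioo (-ε) ε, α (e q, t) ∈ U ∧ e q ∈ Metric.closedBall (e p) r ∧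
      t ∈ Set.Icc (0 - ε₀) (0 + ε₀) := fun t ht => by
    have := hNT (Set.mk_mem_prod hqN (hIoo ht))
    exact ⟨this.1, this.2.1, this.2.2⟩
  have h0 : (0 : ℝ) ∈ Set.Ioo (-ε) ε := ⟨by linarith, hε⟩
  have hderiv : ∀ t ∈ Set.Ioo (-ε) ε, HasDerivAt (fun t => α (e q, t)) (x₁ (α (e q, t))) t := by
    intro t ht
    have h1 := (hα (e q) (hmem t ht).2.1).2 t (hmem t ht).2.2
    apply h1.hasDerivAt
    filter_upwards [Ioo_mem_nhds ht.1 ht.2] with s hs using (hmem s hs).2.2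
  have hfd : ∀ t ∈ Set.Ioo (-ε) ε,
      HasDerivAt (f ∘ fun t => e.symm (α (e q, t))) (X₁ (α (e q, t))) t := by
    intro t ht
    have h1 := (hc.frame.smooth.differentiableAt_of_isOpen hc.frame.isOpen
      (hmem t ht).1).hasFDerivAt.comp_hasDerivAt t (hderiv t ht)
    rwa [hc.frame.lift_left _ (hmem t ht).1] at h1
  have hq0 : α (e q, 0) = e q := (hα (e q) (hmem 0 h0).2.1).1
  refine ⟨by simp only [hq0, e.left_inv hqs], ?_, ?_⟩
  · rw [(hfd 0 h0).deriv, hq0]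
  · intro t ht
    have hev : deriv (f ∘ fun t => e.symm (α (e q, t))) =ᶠ[𝓝 t] fun t => X₁ (α (e q, t)) := by
      filter_upwards [Ioo_mem_nhds ht.1 ht.2] with s hs using (hfd s hs).deriv
    refine ⟨?_, (hfd t ht).differentiableAt, ?_, ?_⟩
    · exact ContinuousAt.comp (f := fun t => α (e q, t))
        (e.symm.continuousAt (hc.subset (hmem t ht).1)) (hderiv t ht).continuousAt
    · rw [(hfd t ht).deriv, hc.lines_left _ (hmem t ht).1]
      exact Or.inl rfl
    · refine ContinuousAt.congr ?_ hev.symm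
      exact ContinuousAt.comp (f := fun t => α (e q, t)) (hc.frame.smooth_left.continuousOn.continuousAt
        (hc.frame.isOpen.mem_nhds (hmem t ht).1)) (hderiv t ht).continuousAt

end FrameChart

namespace IsFrameSystem

theorem neg_mem (h : IsFrameSystem f L₁ L₂) (p : M) (a : Eucl 4) (ha : a ∈ L₁ p) : -a ∈ L₁ p := by
  obtain ⟨b, hb⟩ := h.nonempty_right p
  obtain ⟨e, U, X₁, X₂, x₁, x₂, hc⟩ := h.exists_chart p a ha b hb
  exact hc.neg_mem ha

theorem eq_or_eq_neg (h : IsFrameSystem f L₁ L₂) {p : M} {a a' : Eucl 4} (ha : a ∈ L₁ p)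
    (ha' : a' ∈ L₁ p) : a' = a ∨ a' = -a := by
  obtain ⟨b, hb⟩ := h.nonempty_right p
  obtain ⟨e, U, X₁, X₂, x₁, x₂, hc⟩ := h.exists_chart p a ha b hb
  have := hc.lines_left _ hc.mem
  rw [e.left_inv hc.mem_source, hc.left] at this
  rwa [this] at ha'

theorem norm_eq_one (h : IsFrameSystem f L₁ L₂) {p : M} {a : Eucl 4} (ha : a ∈ L₁ p) :
    ‖a‖ = 1 := by
  obtain ⟨b, hb⟩ := h.nonempty_right p
  obtain ⟨e, U, X₁, X₂, x₁, x₂, hc⟩ := h.exists_chart p a ha b hb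
  rw [← hc.left, hc.frame.norm_left _ hc.mem]

theorem inner_eq_zero (h : IsFrameSystem f L₁ L₂) {p : M} {a b : Eucl 4} (ha : a ∈ L₁ p)
    (hb : b ∈ L₂ p) : ⟪a, b⟫ = 0 := by
  obtain ⟨e, U, X₁, X₂, x₁, x₂, hc⟩ := h.exists_chart p a ha b hb
  rw [← hc.left, ← hc.right, hc.frame.ortho _ hc.mem]

theorem exists_curve (h : IsFrameSystem f L₁ L₂) (p : M) :
    ∃ N ∈ 𝓝 p, ∃ ε > 0, ∀ q ∈ N, ∀ a ∈ L₁ q, ∃ γ : ℝ → M, γ 0 = q ∧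
      deriv (f ∘ γ) 0 = a ∧ ∀ t ∈ Set.Ioo (-ε) ε, IsLineCurveAt f L₁ γ t := by
  obtain ⟨a, ha⟩ := h.nonempty_left p
  obtain ⟨b, hb⟩ := h.nonempty_right p
  obtain ⟨e, U, X₁, X₂, x₁, x₂, hc⟩ := h.exists_chart p a ha b hb
  obtain ⟨N, hN, ε, hε, hcurve⟩ := hc.exists_curve
  refine ⟨N, hN, ε, hε, fun q hq a' ha' => ?_⟩
  obtain ⟨hqs, hqU, γ, hγ0, hγd, hγ⟩ := hcurve q hq
  rw [← e.left_inv hqs, hc.lines_left _ hqU] at ha'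
  rcases ha' with rfl | rfl
  · exact ⟨γ, hγ0, hγd, hγ⟩
  · refine ⟨fun s => γ (-1 * s + 0), by simpa using hγ0, ?_, fun t ht => ?_⟩
    · have := deriv_comp_affine (g := f ∘ γ) (-1) 0 0
      simp only [mul_zero, add_zero, hγd, neg_smul, one_smul] at this
      simpa [Function.comp_def] using this
    · exact (hγ _ ⟨by linarith [ht.2], by linarith [ht.1]⟩).comp_affine (Or.inr rfl) h.neg_mem

theorem eventuallyEq_curve (h : IsFrameSystem f L₁ L₂) {γ γ' : ℝ → M} {t : ℝ}
    (hγ : ∀ᶠ s in 𝓝 t, IsLineCurveAt f L₁ γ s) (hγ' : ∀ᶠ s in 𝓝 t, IsLineCurveAt f L₁ γ' s)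
    (h0 : γ t = γ' t) (hd : deriv (f ∘ γ) t = deriv (f ∘ γ') t) : γ =ᶠ[𝓝 t] γ' := by
  obtain ⟨b, hb⟩ := h.nonempty_right (γ t)
  obtain ⟨e, U, X₁, X₂, x₁, x₂, hc⟩ := h.exists_chart (γ t) _ hγ.self_of_nhds.mem b hb
  have h₁ := hc.eventually_hasDerivAt hγ hc.mem_source hc.mem hc.left.symm
  have h₂ := hc.eventually_hasDerivAt hγ' (h0 ▸ hc.mem_source) (h0 ▸ hc.mem)
    (by rw [← hd, ← h0, hc.left])
  have hcd : ContDiffAt ℝ 1 x₁ (e (γ t)) :=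
    (hc.frame.smooth_vec_left.contDiffAt (hc.frame.isOpen.mem_nhds hc.mem)).of_le (by simp)
  obtain ⟨K, S, hS, hK⟩ := hcd.exists_lipschitzOnWith
  have m₁ := ((e.continuousAt hc.mem_source).comp hγ.self_of_nhds.cont).eventually hS
  have m₂ := ((e.continuousAt (h0 ▸ hc.mem_source)).comp hγ'.self_of_nhds.cont).eventually
    (h0 ▸ hS)
  have := ODE_solution_unique_of_eventually (v := fun _ => x₁) (s := fun _ => S) (K := K)
    (f := e ∘ γ) (g := e ∘ γ') (t₀ := t) (Filter.Eventually.of_forall fun _ => hK)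
    (by filter_upwards [h₁, m₁] with s a b using ⟨a.2.2.2, b⟩)
    (by filter_upwards [h₂, m₂] with s a b using ⟨a.2.2.2, b⟩) (by simp [h0])
  filter_upwards [this, h₁, h₂] with s hs a b
  exact e.injOn a.1 b.1 hs

/-- The set of times near which the curves coincide is open by definition. It is closed in the
interval because positions and velocities are continuous, so local uniqueness applies at a limit
time as well. -/
theorem eqOn_curve [T2Space M] (h : IsFrameSystem f L₁ L₂) {γ γ' : ℝ → M} {J : Set ℝ}
    (hJ : IsOpen J) (hJc : IsPreconnected J)
    (hγ : ∀ s ∈ J, IsLineCurveAt f L₁ γ s) (hγ' : ∀ s ∈ J, IsLineCurveAt f L₁ γ' s)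
    {t : ℝ} (ht : t ∈ J) (h0 : γ t = γ' t) (hd : deriv (f ∘ γ) t = deriv (f ∘ γ') t) :
    ∀ s ∈ J, γ s = γ' s := by
  have key : ∀ t ∈ J, γ t = γ' t → deriv (f ∘ γ) t = deriv (f ∘ γ') t → γ =ᶠ[𝓝 t] γ' :=
    fun t ht => h.eventuallyEq_curve
      (by filter_upwards [hJ.mem_nhds ht] with s hs using hγ s hs)
      (by filter_upwards [hJ.mem_nhds ht] with s hs using hγ' s hs)
  have hsub : J ⊆ {t | γ =ᶠ[𝓝 t] γ'} := by
    apply hJc.subset_of_closure_inter_subset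
    · exact isOpen_setOfPred_eventually_nhds
    · exact ⟨t, ht, key t ht h0 hd⟩
    · rintro s ⟨hs, hsJ⟩
      rw [mem_closure_iff_frequently] at hs
      refine key s hsJ ?_ ?_
      · exact tendsto_nhds_unique_of_frequently_eq (hγ s hsJ).cont (hγ' s hsJ).cont
          (hs.mono fun r hr => hr.self_of_nhds)
      · exact tendsto_nhds_unique_of_frequently_eq (hγ s hsJ).cont_deriv (hγ' s hsJ).cont_deriv
          (hs.mono fun r hr => (Filter.EventuallyEq.fun_comp hr f).deriv_eq)
  exact fun s hs => (hsub hs).self_of_nhds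

end IsFrameSystem

end LineCurves

/-! ### Completeness of the curves tangent to a line field -/

section Completeness

variable {M : Type*} [TopologicalSpace M] [ChartedSpace (Eucl 2) M] {f : M → Eucl 4}
  {L₁ L₂ : M → Set (Eucl 4)}

/-- Curves tangent to `L` that are defined on a bounded interval have limit points at its end. -/
def HasCurveEnds (f : M → Eucl 4) (L : M → Set (Eucl 4)) : Prop :=
  ∀ (γ : ℝ → M) (c d : ℝ), c < d → (∀ t ∈ Set.Ioo c d, IsLineCurveAt f L γ t) →
    ∃ q, MapClusterPt q (𝓝[<] d) γ

/-- `HasCurveEnds` is the only consequence of completeness that is used. Compactness gives it at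
once, so no argument that compact surfaces are complete is required. -/
theorem hasCurveEnds_of_compactSpace [CompactSpace M] (L : M → Set (Eucl 4)) :
    HasCurveEnds f L := fun γ _ d _ _ => by
  obtain ⟨q, hq⟩ := exists_clusterPt_of_compactSpace (Filter.map γ (𝓝[<] d))
  exact ⟨q, hq⟩

namespace IsFrameSystem

theorem contMDiffAt_curve [IsManifold (𝓡 2) ∞ M] (h : IsFrameSystem f L₁ L₂) {γ : ℝ → M} {t : ℝ}
    (hγ : ∀ᶠ s in 𝓝 t, IsLineCurveAt f L₁ γ s) : ContMDiffAt 𝓘(ℝ, ℝ) (𝓡 2) 1 γ t := by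
  obtain ⟨b, hb⟩ := h.nonempty_right (γ t)
  obtain ⟨e, U, X₁, X₂, x₁, x₂, hc⟩ := h.exists_chart (γ t) _ hγ.self_of_nhds.mem b hb
  have h₁ := hc.eventually_hasDerivAt hγ hc.mem_source hc.mem hc.left.symm
  have hcd : ContDiffAt ℝ 1 (e ∘ γ) t := by
    rw [contDiffAt_one_iff]
    refine ⟨fun s => ContinuousLinearMap.toSpanSingleton ℝ (x₁ (e (γ s))), _, h₁, ?_,
      fun s hs => hs.2.2.2.hasFDerivAt⟩
    refine Continuous.comp_continuousOn (g := fun v : Eucl 2 =>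
      ContinuousLinearMap.toSpanSingleton ℝ v) ?_ ?_
    · exact (ContinuousLinearMap.toSpanSingletonCLE (𝕜 := ℝ) (E := Eucl 2)).continuous
    · intro s hs
      exact (ContinuousAt.comp (f := e ∘ γ) (hc.frame.smooth_vec_left.continuousOn.continuousAt
        (hc.frame.isOpen.mem_nhds hs.2.1)) hs.2.2.2.continuousAt).continuousWithinAt
  have he : ContMDiffAt (𝓡 2) (𝓡 2) 1 e.symm ((e ∘ γ) t) :=
    (((contMDiffOn_symm_of_mem_maximalAtlas hc.atlas).contMDiffAt
      (e.open_target.mem_nhds (hc.subset hc.mem)))).of_le (by simp)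
  refine (he.comp t hcd.contMDiffAt).congr_of_eventuallyEq ?_
  filter_upwards [h₁] with s hs
  simp [e.left_inv hs.1]

/-- The curve has unit speed in ℝ⁴, so its length is its parameter length. -/
theorem inducedEDist_curve_le [IsManifold (𝓡 2) ∞ M] (h : IsFrameSystem f L₁ L₂)
    (hf : IsSmoothImmersion 2 f) {γ : ℝ → M} {s t : ℝ} (hst : s ≤ t)
    (hγ : ∀ r ∈ Set.Icc s t, ∀ᶠ r' in 𝓝 r, IsLineCurveAt f L₁ γ r') :
    inducedEDist f (γ s) (γ t) ≤ ENNReal.ofReal (t - s) := by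
  unfold inducedEDist
  letI : ∀ x : M, ENorm (TangentSpace (𝓡 2) x) := fun x =>
    ⟨fun v => ‖(show Eucl 4 from mfderiv (𝓡 2) 𝓘(ℝ, Eucl 4) f x v)‖ₑ⟩
  haveI : ∀ x : M, ENormSMulClass ℝ (TangentSpace (𝓡 2) x) := fun x => ⟨fun r v => by
    change ‖(show Eucl 4 from mfderiv (𝓡 2) 𝓘(ℝ, Eucl 4) f x (r • v))‖ₑ =
      ‖r‖ₑ * ‖(show Eucl 4 from mfderiv (𝓡 2) 𝓘(ℝ, Eucl 4) f x v)‖ₑ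
    rw [map_smul]
    exact enorm_smul r (show Eucl 4 from mfderiv (𝓡 2) 𝓘(ℝ, Eucl 4) f x v)⟩
  have hC : ContMDiffOn 𝓘(ℝ, ℝ) (𝓡 2) 1 γ (Set.Icc s t) :=
    fun r hr => (h.contMDiffAt_curve (hγ r hr)).contMDiffWithinAt
  refine (Manifold.riemannianEDist_le_pathELength hC rfl rfl hst).trans ?_
  rw [Manifold.pathELength_eq_lintegral_mfderiv_Icc, ← Real.volume_Icc,
    ← MeasureTheory.setLIntegral_one]
  apply MeasureTheory.setLIntegral_mono' measurableSet_Icc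
  intro r hr
  have hr' := (hγ r hr).self_of_nhds
  have h1 : mfderiv (𝓡 2) 𝓘(ℝ, Eucl 4) f (γ r) (mfderiv 𝓘(ℝ, ℝ) (𝓡 2) γ r 1) =
      deriv (f ∘ γ) r := by
    have := mfderiv_comp r ((hf.1 (γ r)).mdifferentiableAt (by simp))
      ((h.contMDiffAt_curve (hγ r hr)).mdifferentiableAt (by simp))
    rw [mfderiv_eq_fderiv] at this
    rw [← fderiv_apply_one_eq_deriv, this]
    rfl
  change ‖(show Eucl 4 from mfderiv (𝓡 2) 𝓘(ℝ, Eucl 4) f (γ r)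
    (mfderiv 𝓘(ℝ, ℝ) (𝓡 2) γ r 1))‖ₑ ≤ 1
  rw [h1, ← ofReal_norm]
  simp only [h.norm_eq_one hr'.mem]
  simp

theorem inducedEDist_curve_le_abs [IsManifold (𝓡 2) ∞ M] (h : IsFrameSystem f L₁ L₂)
    (hf : IsSmoothImmersion 2 f) {γ : ℝ → M} {c d s t : ℝ} (hs : s ∈ Set.Ioo c d)
    (ht : t ∈ Set.Ioo c d) (hγ : ∀ r ∈ Set.Ioo c d, IsLineCurveAt f L₁ γ r) :
    inducedEDist f (γ s) (γ t) ≤ ENNReal.ofReal |t - s| := by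
  rcases le_total s t with hst | hst
  · rw [abs_of_nonneg (by linarith)]
    refine h.inducedEDist_curve_le hf hst fun r hr => ?_
    filter_upwards [Ioo_mem_nhds (hs.1.trans_le hr.1) (hr.2.trans_lt ht.2)] with r' hr'
      using hγ r' hr'
  · rw [abs_of_nonpos (by linarith)]
    have := h.inducedEDist_curve_le hf (γ := fun r => γ (-1 * r + 0)) (neg_le_neg hst)
      fun r hr => by
        filter_upwards [Ioo_mem_nhds (a := -d) (b := -c) (by linarith [hr.1, hs.2])
          (by linarith [hr.2, ht.1])] with r' hr'
        exact (hγ _ ⟨by linarith [hr'.2], by linarith [hr'.1]⟩).comp_affine (Or.inr rfl) h.neg_mem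
    convert this using 2 <;> ring_nf

/-- Distances along the curve are bounded by parameter differences, so a sequence of times
increasing to d has a Cauchy image, whose limit is a cluster point of the curve. -/
theorem hasCurveEnds_of_isCompleteSurface [IsManifold (𝓡 2) ∞ M] (h : IsFrameSystem f L₁ L₂)
    (hf : IsSmoothImmersion 2 f) (hM : IsCompleteSurface f) : HasCurveEnds f L₁ := by
  intro γ c d hcd hγ
  -- The denominator n + 2 keeps every term, including the first, strictly between c and d.
  let τ : ℕ → ℝ := fun n => d - (d - c) / (n + 2)
  have hτ : ∀ n, τ n ∈ Set.Ioo c d := fun n => by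
    have h1 : 0 < (d - c) / ((n : ℝ) + 2) := div_pos (by linarith) (by positivity)
    have h2 : (d - c) / ((n : ℝ) + 2) < d - c :=
      div_lt_self (by linarith) (by have : (0 : ℝ) ≤ n := n.cast_nonneg; linarith)
    exact ⟨by simp only [τ]; linarith, by simp only [τ]; linarith⟩
  have hlim : Filter.Tendsto τ Filter.atTop (𝓝 d) := by
    have : Filter.Tendsto (fun n : ℕ => (d - c) / ((n : ℝ) + 2)) Filter.atTop (𝓝 0) :=
      Filter.Tendsto.div_atTop tendsto_const_nhds
        (Filter.tendsto_atTop_add_const_right _ _ tendsto_natCast_atTop_atTop)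
    simpa using tendsto_const_nhds.sub this
  obtain ⟨q, hq⟩ := hM (γ ∘ τ) fun ε hε => by
    have hcau := hlim.cauchySeq
    obtain ⟨δ, hδ, hδε⟩ := ENNReal.lt_iff_exists_nnreal_btwn.1 hε
    have hδ' : 0 < (δ : ℝ) := by exact_mod_cast hδ
    obtain ⟨N, hN⟩ := Metric.cauchySeq_iff.1 hcau δ hδ'
    refine ⟨N, fun m hm n hn => lt_of_le_of_lt (h.inducedEDist_curve_le_abs hf (hτ m) (hτ n) hγ)
      (lt_of_le_of_lt ?_ hδε)⟩
    rw [← ENNReal.ofReal_coe_nnreal]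
    apply ENNReal.ofReal_le_ofReal
    have := hN n hn m hm
    rw [Real.dist_eq] at this
    exact this.le
  refine ⟨q, ?_⟩
  have hlim' : Filter.Tendsto τ Filter.atTop (𝓝[<] d) :=
    tendsto_nhdsWithin_iff.2 ⟨hlim, Filter.Eventually.of_forall fun n => (hτ n).2⟩
  exact MapClusterPt.of_comp hlim' hq.mapClusterPt

/-- Near a limit point q all curves live for a time ε. Restarting from a point γ(t₁) close to q,
with d − ε/2 < t₁ < d, reaches beyond d. Choosing t₁ after m leaves the old curve untouched before
m. -/
theorem extend_right [T2Space M] (h : IsFrameSystem f L₁ L₂) (hE : HasCurveEnds f L₁)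
    {γ : ℝ → M} {c m d : ℝ} (hγ : ∀ t ∈ Set.Ioo c d, IsLineCurveAt f L₁ γ t)
    (hm : m ∈ Set.Ioo c d) :
    ∃ γ' : ℝ → M, ∃ d' > d, (∀ t ∈ Set.Ioo c d', IsLineCurveAt f L₁ γ' t) ∧
      ∀ t < m, γ' t = γ t := by
  obtain ⟨q, hq⟩ := hE γ c d (hm.1.trans hm.2) hγ
  obtain ⟨N, hN, ε, hε, hcurve⟩ := h.exists_curve q
  have hfr := hq.frequently hN
  have hev : ∀ᶠ t in 𝓝[<] d, t ∈ Set.Ioo (max m (d - ε / 2)) d :=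
    Ioo_mem_nhdsLT (max_lt hm.2 (by linarith))
  obtain ⟨t₁, ht₁N, ht₁⟩ := (hfr.and_eventually hev).exists
  have hmt : m < t₁ := (le_max_left _ _).trans_lt ht₁.1
  have hdt : d - ε / 2 < t₁ := (le_max_right _ _).trans_lt ht₁.1
  have ht₁' : t₁ ∈ Set.Ioo c d := ⟨hm.1.trans hmt, ht₁.2⟩
  obtain ⟨η, hη0, hηd, hη⟩ := hcurve _ ht₁N _ (hγ t₁ ht₁').mem
  let η' : ℝ → M := fun t => η (1 * t + -t₁)
  have hη' : ∀ t ∈ Set.Ioo (t₁ - ε) (t₁ + ε), IsLineCurveAt f L₁ η' t := fun t ht =>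
    (hη _ ⟨by linarith [ht.1], by linarith [ht.2]⟩).comp_affine (Or.inl rfl) h.neg_mem
  have hη'0 : η' t₁ = γ t₁ := by simp only [η']; rw [← hη0]; congr 1; ring
  have hη'd : deriv (f ∘ η') t₁ = deriv (f ∘ γ) t₁ := by
    have := deriv_comp_affine (g := f ∘ η) 1 (-t₁) t₁
    rw [one_smul, one_mul, add_neg_cancel, hηd] at this
    exact this
  have hglue : γ =ᶠ[𝓝 t₁] η' := by
    apply h.eventuallyEq_curve _ _ hη'0.symm hη'd.symm
    · filter_upwards [Ioo_mem_nhds ht₁'.1 ht₁'.2] with t ht using hγ t ht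
    · filter_upwards [Ioo_mem_nhds (a := t₁ - ε) (b := t₁ + ε) (by linarith) (by linarith)]
        with t ht using hη' t ht
  refine ⟨fun t => if t ≤ t₁ then γ t else η' t, t₁ + ε, by linarith, fun t ht => ?_,
    fun t ht => if_pos (ht.trans hmt).le⟩
  rcases lt_trichotomy t t₁ with hlt | rfl | hgt
  · refine (hγ t ⟨ht.1, hlt.trans ht₁.2⟩).congr ?_
    filter_upwards [Iio_mem_nhds hlt] with s hs using if_pos (le_of_lt hs)
  · refine (hγ t ht₁').congr ?_
    filter_upwards [hglue] with s hs
    split_ifs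
    · rfl
    · exact hs.symm
  · refine (hη' t ⟨by linarith, ht.2⟩).congr ?_
    filter_upwards [Ioi_mem_nhds hgt] with s hs using if_neg (not_le.2 hs)

theorem extend_left [T2Space M] (h : IsFrameSystem f L₁ L₂) (hE : HasCurveEnds f L₁)
    {γ : ℝ → M} {c m d : ℝ} (hγ : ∀ t ∈ Set.Ioo c d, IsLineCurveAt f L₁ γ t)
    (hm : m ∈ Set.Ioo c d) :
    ∃ γ' : ℝ → M, ∃ c' < c, (∀ t ∈ Set.Ioo c' d, IsLineCurveAt f L₁ γ' t) ∧
      ∀ t > m, γ' t = γ t := by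
  obtain ⟨γ', d', hd', hγ', he⟩ := h.extend_right hE (γ := fun t => γ (-1 * t + 0)) (c := -d)
    (d := -c) (m := -m) (fun t ht => (hγ _ ⟨by linarith [ht.2], by linarith [ht.1]⟩).comp_affine
      (Or.inr rfl) h.neg_mem) ⟨by linarith [hm.2], by linarith [hm.1]⟩
  refine ⟨fun t => γ' (-1 * t + 0), -d', by linarith, fun t ht =>
    (hγ' _ ⟨by linarith [ht.2], by linarith [ht.1]⟩).comp_affine (Or.inr rfl) h.neg_mem,
    fun t ht => ?_⟩
  simp only []
  rw [he _ (by linarith)]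
  congr 1; ring

theorem exists_global_curve [T2Space M] (h : IsFrameSystem f L₁ L₂) (hE : HasCurveEnds f L₁)
    {q : M} {a : Eucl 4} (ha : a ∈ L₁ q) :
    ∃ γ : ℝ → M, (∀ t, IsLineCurveAt f L₁ γ t) ∧ γ 0 = q ∧ deriv (f ∘ γ) 0 = a := by
  -- The radii of symmetric intervals carrying a curve with the given initial data. By uniqueness
  -- these curves agree on overlaps and glue to `g`.
  let D : Set ℝ := {b | 0 < b ∧ ∃ γ : ℝ → M, (∀ t ∈ Set.Ioo (-b) b, IsLineCurveAt f L₁ γ t) ∧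
    γ 0 = q ∧ deriv (f ∘ γ) 0 = a}
  have hDne : D.Nonempty := by
    obtain ⟨N, hN, ε, hε, hcurve⟩ := h.exists_curve q
    obtain ⟨γ, h0, hd, hγ⟩ := hcurve q (mem_of_mem_nhds hN) a ha
    exact ⟨ε, hε, γ, hγ, h0, hd⟩
  have hpos : ∀ b ∈ D, 0 < b := fun b hb => hb.1
  have hex : ∀ b : ℝ, ∃ γ : ℝ → M, b ∈ D → (∀ t ∈ Set.Ioo (-b) b, IsLineCurveAt f L₁ γ t) ∧
      γ 0 = q ∧ deriv (f ∘ γ) 0 = a := fun b => by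
    by_cases hb : b ∈ D
    · exact ⟨hb.2.choose, fun _ => hb.2.choose_spec⟩
    · exact ⟨fun _ => q, fun h => absurd h hb⟩
  choose Γ hΓ using hex
  have hagree : ∀ b ∈ D, ∀ b' ∈ D, ∀ t, |t| < b → |t| < b' → Γ b t = Γ b' t := by
    intro b hb b' hb' t ht ht'
    have h1 := hΓ b hb
    have h2 := hΓ b' hb'
    refine h.eqOn_curve (J := Set.Ioo (-(min b b')) (min b b')) isOpen_Ioo isPreconnected_Ioo
      (fun s hs => h1.1 s ?_) (fun s hs => h2.1 s ?_) (t := 0) ?_ (h1.2.1.trans h2.2.1.symm)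
      (h1.2.2.trans h2.2.2.symm) t (abs_lt.1 (lt_min ht ht'))
    · exact ⟨by linarith [min_le_left b b', hs.1], hs.2.trans_le (min_le_left _ _)⟩
    · exact ⟨by linarith [min_le_right b b', hs.1], hs.2.trans_le (min_le_right _ _)⟩
    · have := lt_min hb.1 hb'.1
      exact ⟨by linarith, this⟩
  have hgx : ∀ t : ℝ, ∃ b : ℝ, (∃ b' ∈ D, |t| < b') → b ∈ D ∧ |t| < b := fun t => by
    by_cases ht : ∃ b' ∈ D, |t| < b'
    · obtain ⟨b', hb', hlt⟩ := ht
      exact ⟨b', fun _ => ⟨hb', hlt⟩⟩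
    · exact ⟨0, fun h => absurd h ht⟩
  choose β hβ using hgx
  let g : ℝ → M := fun t => Γ (β t) t
  have hg : ∀ b ∈ D, ∀ t, |t| < b → g t = Γ b t := fun b hb t ht =>
    have := hβ t ⟨b, hb, ht⟩
    hagree _ this.1 b hb t this.2 ht
  have hgev : ∀ b ∈ D, ∀ t, |t| < b → g =ᶠ[𝓝 t] Γ b := fun b hb t ht => by
    filter_upwards [continuous_abs.continuousAt.eventually (gt_mem_nhds ht)] with s hs
      using hg b hb s hs
  have hgl : ∀ b ∈ D, ∀ t, |t| < b → IsLineCurveAt f L₁ g t := fun b hb t ht =>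
    ((hΓ b hb).1 t (abs_lt.1 ht)).congr (hgev b hb t ht)
  have hg0 : g 0 = q ∧ deriv (f ∘ g) 0 = a := by
    obtain ⟨b, hb⟩ := hDne
    have hb0 : |(0 : ℝ)| < b := by simpa using hb.1
    exact ⟨(hg b hb 0 hb0).trans (hΓ b hb).2.1,
      (Filter.EventuallyEq.fun_comp (hgev b hb 0 hb0) f).deriv_eq.trans (hΓ b hb).2.2⟩
  by_cases hbdd : BddAbove D
  swap
  · refine ⟨g, fun t => ?_, hg0⟩
    obtain ⟨b, hb, hlt⟩ := not_bddAbove_iff.1 hbdd |t|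
    exact hgl b hb t hlt
  exfalso
  -- If the radii were bounded, the glued curve on (−B, B) could be extended past both ends without
  -- changing it near 0, which gives a larger admissible radius.
  set B := sSup D
  have hB : 0 < B := by
    obtain ⟨b, hb⟩ := hDne
    exact hb.1.trans_le (le_csSup hbdd hb)
  have hgB : ∀ t ∈ Set.Ioo (-B) B, IsLineCurveAt f L₁ g t := fun t ht => by
    obtain ⟨b, hb, hlt⟩ := exists_lt_of_lt_csSup hDne (abs_lt.2 ht)
    exact hgl b hb t hlt
  obtain ⟨g₁, d, hd, hg₁, he₁⟩ := h.extend_right hE hgB (m := B / 2) ⟨by linarith, by linarith⟩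
  obtain ⟨g₂, c, hc, hg₂, he₂⟩ := h.extend_left hE hg₁ (m := -(B / 2))
    ⟨by linarith, by linarith⟩
  have hev : g₂ =ᶠ[𝓝 0] g := by
    filter_upwards [Ioo_mem_nhds (a := -(B / 2)) (b := B / 2) (by linarith) (by linarith)]
      with t ht
    rw [he₂ t ht.1, he₁ t ht.2]
  have hmem : min d (-c) ∈ D := by
    refine ⟨lt_min (by linarith) (by linarith), g₂, fun t ht => hg₂ t ?_,
      hev.self_of_nhds.trans hg0.1, (Filter.EventuallyEq.fun_comp hev f).deriv_eq.trans hg0.2⟩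
    exact ⟨by linarith [ht.1, min_le_right d (-c)], ht.2.trans_le (min_le_left _ _)⟩
  have := le_csSup hbdd hmem
  have h2 : B < min d (-c) := lt_min (by linarith) (by linarith)
  linarith

end IsFrameSystem

end Completeness

/-! ### Complete line fields are flat -/

section Flatness

/-- While k > 0 the quantity 1/k + t is constant, so a solution positive at t₀ would have 1/k = 0 at
time t₀ + 1/k(t₀). Negative values reduce to positive ones through s ↦ −k(−s). -/
theorem eq_zero_of_riccati {k : ℝ → ℝ} (hk : ∀ t, HasDerivAt k (k t ^ 2) t) (t : ℝ) : k t = 0 := by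
  have key : ∀ k : ℝ → ℝ, (∀ t, HasDerivAt k (k t ^ 2) t) → ∀ t₀, ¬ 0 < k t₀ := by
    intro k hk t₀ h0
    have hmono : Monotone k := monotone_of_hasDerivAt_nonneg hk fun t => sq_nonneg _
    have hpos : ∀ t ≥ t₀, 0 < k t := fun t ht => h0.trans_le (hmono ht)
    have hconst : ∀ t ∈ Set.Icc t₀ (t₀ + (k t₀)⁻¹), (k t)⁻¹ + t = (k t₀)⁻¹ + t₀ := by
      have hd : ∀ t ≥ t₀, HasDerivAt (fun t => (k t)⁻¹ + t) 0 t := by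
        intro t ht
        have h1 := ((hk t).fun_inv (hpos t ht).ne').add (hasDerivAt_id t)
        have h2 : -k t ^ 2 / k t ^ 2 + 1 = 0 := by
          rw [neg_div, div_self (pow_ne_zero 2 (hpos t ht).ne')]; ring
        rw [h2] at h1
        exact h1
      exact constant_of_has_deriv_right_zero
        (fun t ht => (hd t ht.1).continuousAt.continuousWithinAt)
        (fun t ht => (hd t ht.1).hasDerivWithinAt)
    have h1 := hconst (t₀ + (k t₀)⁻¹) ⟨by linarith [inv_pos.2 h0], le_rfl⟩
    have h2 := inv_pos.2 (hpos (t₀ + (k t₀)⁻¹) (by linarith [inv_pos.2 h0]))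
    linarith
  rcases lt_trichotomy (k t) 0 with h | h | h
  · exfalso
    refine key (fun s => -k (-s)) (fun s => ?_) (-t) (by simpa using h)
    have : HasDerivAt (fun s => -k (-s)) _ s := ((hk (-s)).scomp s (hasDerivAt_neg s)).neg
    convert this using 1
    simp
  · exact h
  · exact absurd h (key k hk t)

namespace MovingFrame

variable {φ X₁ X₂ : Eucl 2 → Eucl 4} {x₁ x₂ : Eucl 2 → Eucl 2} {U : Set (Eucl 2)} {x : Eucl 2}

theorem differentiableAt_left (h : MovingFrame φ X₁ X₂ x₁ x₂ U) (hx : x ∈ U) :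
    DifferentiableAt ℝ X₁ x := h.smooth_left.differentiableAt_of_isOpen h.isOpen hx

theorem eq_comb (h : MovingFrame φ X₁ X₂ x₁ x₂ U) (hx : x ∈ U) (v : Eucl 2) :
    v = ⟪X₁ x, fderiv ℝ φ x v⟫ • x₁ x + ⟪X₂ x, fderiv ℝ φ x v⟫ • x₂ x := by
  apply h.inj x hx
  rw [map_add, map_smul, map_smul, h.lift_left x hx, h.lift_right x hx]
  exact eq_comb_of_mem_plane (finrank_range_fderiv (h.inj x hx)) ⟨_, h.lift_left x hx⟩
    ⟨_, h.lift_right x hx⟩ (h.norm_left x hx) (h.norm_right x hx) (h.ortho x hx) ⟨v, rfl⟩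

theorem inner_deriv_left (h : MovingFrame φ X₁ X₂ x₁ x₂ U) (hx : x ∈ U) (v : Eucl 2) :
    ⟪X₁ x, fderiv ℝ X₁ x v⟫ = 0 := by
  have := inner_deriv_of_eventually_const (ContinuousLinearMap.id ℝ (Eucl 4))
    (h.differentiableAt_left hx) (h.differentiableAt_left hx) (c := 1) (by
      filter_upwards [h.isOpen.mem_nhds hx] with y hy
      simp [h.norm_left y hy]) v
  rw [ContinuousLinearMap.id_apply, ContinuousLinearMap.id_apply, real_inner_comm] at this
  linarith

theorem inner_deriv_right (h : MovingFrame φ X₁ X₂ x₁ x₂ U) (hx : x ∈ U) (v : Eucl 2) :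
    ⟪X₁ x, fderiv ℝ X₂ x v⟫ = -⟪fderiv ℝ X₁ x v, X₂ x⟫ := by
  have := inner_deriv_of_eventually_const (ContinuousLinearMap.id ℝ (Eucl 4))
    (h.differentiableAt_left hx) (h.swap.differentiableAt_left hx) (c := 0) (by
      filter_upwards [h.isOpen.mem_nhds hx] with y hy
      simp [h.ortho y hy]) v
  rw [ContinuousLinearMap.id_apply, ContinuousLinearMap.id_apply] at this
  linarith

/-- D₂X₁ is a multiple of X₂, with coefficient ⟨D₂X₁, X₂⟩ = −⟨X₁, D₂X₂⟩ by orthogonality of the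
frame. -/
theorem deriv_left_eq_zero (h : MovingFrame φ X₁ X₂ x₁ x₂ U) (hx : x ∈ U)
    (hg : ⟪fderiv ℝ X₂ x (x₂ x), X₁ x⟫ = 0) : fderiv ℝ X₁ x (x₂ x) = 0 := by
  obtain ⟨b, hb⟩ := h.deriv_left x hx
  have h1 := h.inner_deriv_right hx (x₂ x)
  rw [real_inner_comm, hg, hb, real_inner_smul_left, real_inner_self_eq_norm_sq,
    h.norm_right x hx] at h1
  rw [hb, show b = 0 by linarith, zero_smul]

end MovingFrame

variable {M : Type*} [TopologicalSpace M] [ChartedSpace (Eucl 2) M] {f : M → Eucl 4}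
  {L₁ L₂ : M → Set (Eucl 4)}

namespace FrameChart

variable {p : M} {a b : Eucl 4} {e : OpenPartialHomeomorph M (Eucl 2)} {U : Set (Eucl 2)}
  {X₁ X₂ : Eucl 2 → Eucl 4} {x₁ x₂ : Eucl 2 → Eucl 2}

/-- The acceleration of a curve tangent to the first line field. -/
theorem deriv_deriv_curve (hc : FrameChart f L₁ L₂ p a b e U X₁ X₂ x₁ x₂) {γ : ℝ → M}
    (hγ : ∀ᶠ s in 𝓝 0, IsLineCurveAt f L₁ γ s) (hs : γ 0 ∈ e.source) (hU : e (γ 0) ∈ U) :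
    deriv (deriv (f ∘ γ)) 0 = fderiv ℝ X₁ (e (γ 0)) (x₁ (e (γ 0))) := by
  have key : ∀ γ : ℝ → M, (∀ᶠ s in 𝓝 0, IsLineCurveAt f L₁ γ s) → γ 0 ∈ e.source → e (γ 0) ∈ U →
      deriv (f ∘ γ) 0 = X₁ (e (γ 0)) →
      deriv (deriv (f ∘ γ)) 0 = fderiv ℝ X₁ (e (γ 0)) (x₁ (e (γ 0))) := by
    intro γ hγ hs hU hd
    have h := hc.eventually_hasDerivAt hγ hs hU hd
    have he : deriv (f ∘ γ) =ᶠ[𝓝 0] X₁ ∘ (e ∘ γ) := h.mono fun s hs => hs.2.2.1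
    rw [he.deriv_eq]
    exact ((hc.frame.differentiableAt_left hU).hasFDerivAt.comp_hasDerivAt 0
      h.self_of_nhds.2.2.2).deriv
  have hm := hγ.self_of_nhds.mem
  have hl := hc.lines_left _ hU
  rw [e.left_inv hs] at hl
  rw [hl] at hm
  rcases hm with hm | hm
  · exact key γ hγ hs hU hm
  -- Time reversal changes the sign of the velocity but not the acceleration, so this case reduces
  -- to the one where the velocity is X₁.
  · have hneg : ∀ q, ∀ v ∈ L₁ q, q ∈ e.source → e q ∈ U → -v ∈ L₁ q := by
      intro q v hv hq hqU
      have := hc.lines_left _ hqU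
      rw [e.left_inv hq] at this
      rw [this] at hv ⊢
      rcases hv with rfl | rfl
      · exact Or.inr rfl
      · exact Or.inl (neg_neg _)
    have hd1 : deriv (f ∘ fun s => γ (-1 * s + 0)) = fun s => (-1 : ℝ) • deriv (f ∘ γ) (-1 * s + 0) :=
      funext fun s => deriv_comp_affine (g := f ∘ γ) (-1) 0 s
    have hd2 : deriv (deriv (f ∘ fun s => γ (-1 * s + 0))) 0 = deriv (deriv (f ∘ γ)) 0 := by
      rw [hd1, deriv_fun_const_smul_field]
      rw [deriv_comp_affine (g := deriv (f ∘ γ)) (-1) 0 0]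
      simp
    have h0 : (-1 : ℝ) * 0 + 0 = 0 := by norm_num
    have htend : Filter.Tendsto (fun s : ℝ => -1 * s + 0) (𝓝 0) (𝓝 0) := by
      have : ContinuousAt (fun s : ℝ => -1 * s + 0) 0 := by fun_prop
      simpa [ContinuousAt] using this
    have hev := hc.eventually_mem hγ.self_of_nhds.cont hs hU
    have := key (fun s => γ (-1 * s + 0)) ?_ (by rw [h0]; exact hs) (by rw [h0]; exact hU) ?_
    · rw [hd2] at this
      simpa only [h0] using this
    · filter_upwards [htend.eventually hγ, htend.eventually hev] with s hs1 hs2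
      have hc1 : ContinuousAt (fun s : ℝ => -1 * s + 0) s := by fun_prop
      refine ⟨ContinuousAt.comp (f := fun s : ℝ => -1 * s + 0) hs1.cont hc1,
        DifferentiableAt.comp (f := fun s : ℝ => -1 * s + 0) s hs1.diff (by fun_prop), ?_, ?_⟩
      · rw [hd1]
        simpa using hneg _ _ hs1.mem hs2.1 hs2.2
      · rw [hd1]
        exact (ContinuousAt.comp (f := fun s : ℝ => -1 * s + 0) hs1.cont_deriv hc1).const_smul (-1 : ℝ)
    · rw [hd1]
      rw [Set.mem_singleton_iff] at hm
      simp [hm]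

theorem recenter (hc : FrameChart f L₁ L₂ p a b e U X₁ X₂ x₁ x₂) {y : Eucl 2} (hy : y ∈ U) :
    FrameChart f L₁ L₂ (e.symm y) (X₁ y) (X₂ y) e U X₁ X₂ x₁ x₂ := by
  have := e.right_inv (hc.subset hy)
  exact ⟨hc.atlas, e.map_target (hc.subset hy), by rwa [this], hc.subset, hc.frame,
    by rw [this], by rw [this], hc.lines_left, hc.lines_right⟩

end FrameChart

namespace IsFrameSystem

/-- Along the complete curve of the second family through the point, the geodesic curvature of the
first family solves k' = k² for all time, and hence vanishes. -/
theorem geodesicCurvature_eq_zero [T2Space M] (h : IsFrameSystem f L₁ L₂) (hE : HasCurveEnds f L₂)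
    {p : M} {a b : Eucl 4} {e : OpenPartialHomeomorph M (Eucl 2)} {U : Set (Eucl 2)}
    {X₁ X₂ : Eucl 2 → Eucl 4} {x₁ x₂ : Eucl 2 → Eucl 2}
    (hc : FrameChart f L₁ L₂ p a b e U X₁ X₂ x₁ x₂) {y : Eucl 2} (hy : y ∈ U) :
    ⟪fderiv ℝ X₁ y (x₁ y), X₂ y⟫ = 0 := by
  have hX₂ : X₂ y ∈ L₂ (e.symm y) := by rw [hc.lines_right y hy]; exact Or.inl rfl
  obtain ⟨η, hη, hη0, hηd⟩ := h.swap.exists_global_curve hE hX₂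
  have hγ : ∀ t, ∃ γ : ℝ → M, γ 0 = η t ∧ ∀ᶠ s in 𝓝 0, IsLineCurveAt f L₁ γ s := by
    intro t
    obtain ⟨N, hN, ε, hε, hcurve⟩ := h.exists_curve (η t)
    obtain ⟨v, hv⟩ := h.nonempty_left (η t)
    obtain ⟨γ, h0, -, hγ⟩ := hcurve _ (mem_of_mem_nhds hN) v hv
    refine ⟨γ, h0, ?_⟩
    filter_upwards [Ioo_mem_nhds (a := -ε) (by linarith) hε] with s hs using hγ s hs
  choose γ hγ0 hγ using hγ
  -- A definition of the geodesic curvature independent of charts: the acceleration of any curve of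
  -- the first family through η(t) does not depend on its orientation, so no global choice of X₁ is
  -- needed.
  let k : ℝ → ℝ := fun t => ⟪deriv (deriv (f ∘ γ t)) 0, deriv (f ∘ η) t⟫
  have hloc : ∀ (t : ℝ) {p : M} {a b : Eucl 4} {e : OpenPartialHomeomorph M (Eucl 2)}
      {U : Set (Eucl 2)} {X₁ X₂ : Eucl 2 → Eucl 4} {x₁ x₂ : Eucl 2 → Eucl 2},
      FrameChart f L₁ L₂ p a b e U X₁ X₂ x₁ x₂ → η t ∈ e.source → e (η t) ∈ U →
      deriv (f ∘ η) t = X₂ (e (η t)) → k t = ⟪fderiv ℝ X₁ (e (η t)) (x₁ (e (η t))), X₂ (e (η t))⟫ := by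
    intro t p a b e U X₁ X₂ x₁ x₂ hc hs hU hd
    simp only [k, hd]
    rw [hc.deriv_deriv_curve (hγ t) (by rwa [hγ0]) (by rwa [hγ0]), hγ0]
  have hk : ∀ t, HasDerivAt k (k t ^ 2) t := by
    intro t
    obtain ⟨v, hv⟩ := h.nonempty_left (η t)
    obtain ⟨e, U, X₁, X₂, x₁, x₂, hc⟩ := h.exists_chart (η t) v hv _ (hη t).mem
    have hev := hc.swap.eventually_hasDerivAt (Filter.Eventually.of_forall hη) hc.mem_source
      hc.mem hc.right.symm
    have hkev : k =ᶠ[𝓝 t] (fun y => ⟪fderiv ℝ X₁ y (x₁ y), X₂ y⟫) ∘ (e ∘ η) := by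
      filter_upwards [hev] with s hs using hloc s hc hs.1 hs.2.1 hs.2.2.1
    have hF := hc.frame
    have dA : DifferentiableAt ℝ (fun y => ⟪fderiv ℝ X₁ y (x₁ y), X₂ y⟫) (e (η t)) :=
      (((hF.smooth_left.fderiv_of_isOpen hF.isOpen (m := ∞) (by simp)).clm_apply
        hF.smooth_vec_left).differentiableAt_of_isOpen hF.isOpen hc.mem).inner ℝ
        (hF.swap.differentiableAt_left hc.mem)
    have hd := (dA.hasFDerivAt.comp_hasDerivAt t hev.self_of_nhds.2.2.2)
    rw [hF.riccati_left _ hc.mem, ← hloc t hc hc.mem_source hc.mem hc.right.symm] at hd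
    exact hd.congr_of_eventuallyEq hkev
  have h0 := hloc 0 (hc.recenter hy) (by rw [hη0]; exact e.map_target (hc.subset hy))
    (by rw [hη0, e.right_inv (hc.subset hy)]; exact hy)
    (by rw [hηd, hη0, e.right_inv (hc.subset hy)])
  rw [eq_zero_of_riccati hk, hη0, e.right_inv (hc.subset hy)] at h0
  exact h0.symm

end IsFrameSystem

/-- A moving frame whose vectors are parallel along each other. -/
structure FlatFrame (φ X₁ X₂ : Eucl 2 → Eucl 4) (x₁ x₂ : Eucl 2 → Eucl 2)
    (U : Set (Eucl 2)) : Prop extends MovingFrame φ X₁ X₂ x₁ x₂ U where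
  deriv_left_zero : ∀ x ∈ U, fderiv ℝ X₁ x (x₂ x) = 0
  deriv_right_zero : ∀ x ∈ U, fderiv ℝ X₂ x (x₁ x) = 0
  geodesic_left : ∀ x ∈ U, ⟪fderiv ℝ X₁ x (x₁ x), X₂ x⟫ = 0
  geodesic_right : ∀ x ∈ U, ⟪fderiv ℝ X₂ x (x₂ x), X₁ x⟫ = 0

theorem FlatFrame.swap' {φ X₁ X₂ : Eucl 2 → Eucl 4} {x₁ x₂ : Eucl 2 → Eucl 2} {U : Set (Eucl 2)}
    (h : FlatFrame φ X₁ X₂ x₁ x₂ U) : FlatFrame φ X₂ X₁ x₂ x₁ U :=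
  ⟨h.toMovingFrame.swap, h.deriv_right_zero, h.deriv_left_zero, h.geodesic_right, h.geodesic_left⟩

theorem IsFrameSystem.flatFrame [T2Space M] (h : IsFrameSystem f L₁ L₂) (hE₁ : HasCurveEnds f L₁)
    (hE₂ : HasCurveEnds f L₂) {p : M} {a b : Eucl 4} {e : OpenPartialHomeomorph M (Eucl 2)}
    {U : Set (Eucl 2)} {X₁ X₂ : Eucl 2 → Eucl 4} {x₁ x₂ : Eucl 2 → Eucl 2}
    (hc : FrameChart f L₁ L₂ p a b e U X₁ X₂ x₁ x₂) :
    FlatFrame (f ∘ e.symm) X₁ X₂ x₁ x₂ U := by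
  have h1 := fun x (hx : x ∈ U) => h.geodesicCurvature_eq_zero hE₂ hc hx
  have h2 := fun x (hx : x ∈ U) => h.swap.geodesicCurvature_eq_zero hE₁ hc.swap hx
  exact ⟨hc.frame, fun x hx => hc.frame.deriv_left_eq_zero hx (h2 x hx),
    fun x hx => hc.frame.swap.deriv_left_eq_zero hx (h1 x hx), h1, h2⟩

end Flatness

/-! ### Product charts -/

section Boxes

/-- The open square of radius `r` around `z₀`. -/
def square (z₀ : Eucl 2) (r : ℝ) : Set (Eucl 2) := {z | |z 0 - z₀ 0| < r ∧ |z 1 - z₀ 1| < r}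

theorem isOpen_square (z₀ : Eucl 2) (r : ℝ) : IsOpen (square z₀ r) := by
  have : ∀ i : Fin 2, IsOpen {z : Eucl 2 | |z i - z₀ i| < r} := fun i =>
    isOpen_lt (by fun_prop) continuous_const
  exact (this 0).inter (this 1)

theorem mem_square_self (z₀ : Eucl 2) {r : ℝ} (hr : 0 < r) : z₀ ∈ square z₀ r := by
  simp [square, hr]

theorem convex_square (z₀ : Eucl 2) (r : ℝ) : Convex ℝ (square z₀ r) := by
  have : ∀ i : Fin 2, Convex ℝ {z : Eucl 2 | |z i - z₀ i| < r} := fun i => by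
    have h := (convex_ball (z₀ i) r).linear_preimage
      (EuclideanSpace.proj i : Eucl 2 →L[ℝ] ℝ).toLinearMap
    exact h
  exact (this 0).inter (this 1)

theorem exists_square_subset {S : Set (Eucl 2)} {z₀ : Eucl 2} (hS : S ∈ 𝓝 z₀) :
    ∃ r > 0, square z₀ r ⊆ S := by
  obtain ⟨ε, hε, hεS⟩ := Metric.mem_nhds_iff.1 hS
  refine ⟨ε / 2, by linarith, fun z hz => hεS ?_⟩
  rw [Metric.mem_ball, EuclideanSpace.dist_eq, Fin.sum_univ_two, Real.dist_eq, Real.dist_eq,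
    Real.sqrt_lt' hε]
  nlinarith [hz.1, hz.2, abs_nonneg (z 0 - z₀ 0), abs_nonneg (z 1 - z₀ 1)]

/-- The linear map `w ↦ w₀ • u + w₁ • v`. -/
noncomputable def planeMap {F : Type*} [NormedAddCommGroup F] [NormedSpace ℝ F] (u v : F) : Eucl 2 →L[ℝ] F :=
  (EuclideanSpace.proj 0 : Eucl 2 →L[ℝ] ℝ).smulRight u +
    (EuclideanSpace.proj 1 : Eucl 2 →L[ℝ] ℝ).smulRight v

@[simp]
theorem planeMap_apply {F : Type*} [NormedAddCommGroup F] [NormedSpace ℝ F] (u v : F)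
    (w : Eucl 2) : planeMap u v w = w 0 • u + w 1 • v := rfl

theorem eq_of_fderiv_segment_eq_zero {E F : Type*} [NormedAddCommGroup E] [NormedSpace ℝ E]
    [NormedAddCommGroup F] [NormedSpace ℝ F] {g : E → F} {z w : E} {s : Set E} (hs : Convex ℝ s)
    (hz : z ∈ s) (hw : w ∈ s) {g' : E → E →L[ℝ] F} (hg : ∀ y ∈ s, HasFDerivAt g (g' y) y)
    (h0 : ∀ y ∈ s, g' y (w - z) = 0) : g w = g z := by
  have hmem : ∀ t ∈ Set.Icc (0 : ℝ) 1, z + t • (w - z) ∈ s := fun t ht =>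
    hs.add_smul_sub_mem hz hw ht
  have hd : ∀ t ∈ Set.Icc (0 : ℝ) 1, HasDerivAt (fun t : ℝ => g (z + t • (w - z))) 0 t := by
    intro t ht
    have h1 : HasDerivAt (fun t : ℝ => z + t • (w - z)) (w - z) t := by
      simpa using ((hasDerivAt_id t).smul_const (w - z)).const_add z
    have h2 := (hg _ (hmem t ht)).comp_hasDerivAt t h1
    rwa [h0 _ (hmem t ht)] at h2
  have := constant_of_has_deriv_right_zero (f := fun t : ℝ => g (z + t • (w - z)))
    (fun t ht => (hd t ht).continuousAt.continuousWithinAt)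
    (fun t ht => (hd t ⟨ht.1, ht.2.le⟩).hasDerivWithinAt) 1 ⟨zero_le_one, le_rfl⟩
  simpa using this

namespace FlatFrame

variable {φ X₁ X₂ : Eucl 2 → Eucl 4} {x₁ x₂ : Eucl 2 → Eucl 2} {U : Set (Eucl 2)} {x : Eucl 2}

/-- In a flat frame the derivative of X₁ is normal to the surface in every direction, that is, X₁ is
parallel for the induced connection. -/
theorem inner_deriv_left_eq_zero (h : FlatFrame φ X₁ X₂ x₁ x₂ U) (hx : x ∈ U) (u w : Eucl 2) :
    ⟪fderiv ℝ X₁ x u, fderiv ℝ φ x w⟫ = 0 := by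
  rw [h.eq_comb hx u, h.eq_comb hx w]
  simp only [map_add, map_smul, h.lift_left x hx, h.lift_right x hx, h.deriv_left_zero x hx,
    inner_add_left, inner_add_right, real_inner_smul_left, real_inner_smul_right, smul_zero,
    inner_zero_left, h.geodesic_left x hx, real_inner_comm (X₁ x), h.inner_deriv_left hx]
  ring

/-- The one-form dual to `X₁` has a local primitive. -/
theorem exists_primitive (h : FlatFrame φ X₁ X₂ x₁ x₂ U) {c : Eucl 2} {ρ : ℝ}
    (hb : Metric.ball c ρ ⊆ U) : ∃ a : Eucl 2 → ℝ, ContDiffOn ℝ ∞ a (Metric.ball c ρ) ∧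
      ∀ y ∈ Metric.ball c ρ, HasFDerivAt a ((innerSL ℝ (X₁ y)).comp (fderiv ℝ φ y)) y := by
  set η : Eucl 2 → Eucl 2 →L[ℝ] ℝ := fun y => (innerSL ℝ (X₁ y)).comp (fderiv ℝ φ y)
  have sη : ContDiffOn ℝ ∞ η U :=
    ((innerSL ℝ).contDiff.comp_contDiffOn h.smooth_left).clm_comp
      (h.smooth.fderiv_of_isOpen h.isOpen (m := ∞) (by simp))
  have dη : ∀ y ∈ U, DifferentiableAt ℝ η y := fun y hy =>
    sη.differentiableAt_of_isOpen h.isOpen hy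
  have dφ : ∀ y ∈ U, DifferentiableAt ℝ (fderiv ℝ φ) y := fun y hy =>
    (h.smooth.fderiv_of_isOpen h.isOpen (m := ∞) (by simp)).differentiableAt_of_isOpen h.isOpen hy
  -- The derivative of X₁ is normal and drops out, leaving the symmetric second derivative of φ
  -- paired with X₁. Thus the form is closed, and on a ball it is exact.
  have hD : ∀ y ∈ U, ∀ u w, fderiv ℝ η y u w = ⟪X₁ y, fderiv ℝ (fderiv ℝ φ) y u w⟫ := by
    intro y hy u w
    have e1 : fderiv ℝ (fun z => η z w) y u = fderiv ℝ η y u w := by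
      rw [fderiv_clm_apply (dη y hy) (differentiableAt_const w)]
      simp
    have e2 : fderiv ℝ (fun z => ⟪X₁ z, fderiv ℝ φ z w⟫) y u =
        ⟪X₁ y, fderiv ℝ (fderiv ℝ φ) y u w⟫ := by
      rw [fderiv_inner_apply ℝ (h.differentiableAt_left hy)
        ((dφ y hy).clm_apply (differentiableAt_const w)), h.inner_deriv_left_eq_zero hy,
        fderiv_clm_apply (dφ y hy) (differentiableAt_const w)]
      simp
    rw [← e1, ← e2]
    rfl
  obtain ⟨a, ha⟩ := (convex_ball c ρ).exists_forall_hasFDerivAt_of_fderiv_symmetric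
    Metric.isOpen_ball (fun y hy => (dη y (hb hy)).differentiableWithinAt) fun y hy u w => by
      rw [hD y (hb hy), hD y (hb hy), h.smooth.fderiv_fderiv_comm h.isOpen (hb hy)]
  refine ⟨a, ?_, ha⟩
  rw [contDiffOn_infty_iff_fderiv_of_isOpen Metric.isOpen_ball]
  exact ⟨fun y hy => (ha y hy).differentiableAt.differentiableWithinAt,
    (sη.mono hb).congr fun y hy => (ha y hy).fderiv⟩

/-- Local coordinates in which the frame is the coordinate frame. -/
theorem exists_coordinates (h : FlatFrame φ X₁ X₂ x₁ x₂ U) (hx : x ∈ U) (z₀ : Eucl 2) :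
    ∃ g : OpenPartialHomeomorph (Eucl 2) (Eucl 2), x ∈ g.source ∧ g.source ⊆ U ∧ g x = z₀ ∧
      ContDiffOn ℝ ∞ g g.source ∧ ContDiffOn ℝ ∞ g.symm g.target ∧
      ∀ z ∈ g.target, HasFDerivAt g.symm (planeMap (x₁ (g.symm z)) (x₂ (g.symm z))) z := by
  obtain ⟨ρ, hρ, hb⟩ := Metric.isOpen_iff.1 h.isOpen x hx
  obtain ⟨a₁, s₁, d₁⟩ := h.exists_primitive hb
  obtain ⟨a₂, s₂, d₂⟩ := h.swap'.exists_primitive hb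
  let e₀ : Eucl 2 := EuclideanSpace.single 0 1
  let e₁ : Eucl 2 := EuclideanSpace.single 1 1
  let G : Eucl 2 → Eucl 2 := fun y => (a₁ y - a₁ x) • e₀ + (a₂ y - a₂ x) • e₁ + z₀
  let G' : Eucl 2 → Eucl 2 →L[ℝ] Eucl 2 := fun y =>
    ((innerSL ℝ (X₁ y)).comp (fderiv ℝ φ y)).smulRight e₀ +
    ((innerSL ℝ (X₂ y)).comp (fderiv ℝ φ y)).smulRight e₁
  have hG : ∀ y ∈ Metric.ball x ρ, HasFDerivAt G (G' y) y := fun y hy =>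
    ((((d₁ y hy).sub_const _).smul_const e₀).add (((d₂ y hy).sub_const _).smul_const e₁)).add_const _
  have sG : ContDiffOn ℝ ∞ G (Metric.ball x ρ) :=
    (((s₁.sub contDiffOn_const).smul contDiffOn_const).add
      ((s₂.sub contDiffOn_const).smul contDiffOn_const)).add contDiffOn_const
  have hleft : ∀ y ∈ Metric.ball x ρ, ∀ w, planeMap (x₁ y) (x₂ y) (G' y w) = w := by
    intro y hy w
    have e0 : (G' y w) 0 = ⟪X₁ y, fderiv ℝ φ y w⟫ := by simp [G', e₀, e₁]
    have e1 : (G' y w) 1 = ⟪X₂ y, fderiv ℝ φ y w⟫ := by simp [G', e₀, e₁]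
    rw [planeMap_apply, e0, e1]
    exact (h.eq_comb (hb hy) w).symm
  have hright : ∀ y ∈ Metric.ball x ρ, ∀ w, G' y (planeMap (x₁ y) (x₂ y) w) = w := by
    intro y hy
    have := mul_eq_one_comm.1 (show (planeMap (x₁ y) (x₂ y)).toLinearMap *
      (G' y).toLinearMap = 1 from LinearMap.ext fun w => hleft y hy w)
    exact fun w => LinearMap.congr_fun this w
  let A : ∀ y ∈ Metric.ball x ρ, Eucl 2 ≃L[ℝ] Eucl 2 := fun y hy =>
    ContinuousLinearEquiv.equivOfInverse (G' y) (planeMap (x₁ y) (x₂ y)) (hleft y hy) (hright y hy)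
  have hxb := Metric.mem_ball_self (x := x) hρ
  have hsm : ∀ y ∈ Metric.ball x ρ, ContDiffAt ℝ ∞ G y := fun y hy =>
    sG.contDiffAt (Metric.isOpen_ball.mem_nhds hy)
  let g₀ := (hsm x hxb).toOpenPartialHomeomorph G (f' := A x hxb) (hG x hxb) (by simp)
  let g := g₀.restrOpen (Metric.ball x ρ) Metric.isOpen_ball
  have hgs : g.source ⊆ Metric.ball x ρ := fun y hy => by
    rw [OpenPartialHomeomorph.restrOpen_source] at hy
    exact hy.2
  have hgt : ∀ z ∈ g.target, g.symm z ∈ Metric.ball x ρ := fun z hz => hgs (g.map_target hz)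
  refine ⟨g, ?_, hgs.trans hb, ?_, ?_, ?_, ?_⟩
  · rw [OpenPartialHomeomorph.restrOpen_source]
    exact ⟨(hsm x hxb).mem_toOpenPartialHomeomorph_source _ _, hxb⟩
  · change G x = z₀
    simp [G]
  · exact sG.mono hgs
  · intro z hz
    exact (g.contDiffAt_symm (f₀' := A _ (hgt z hz)) hz (hG _ (hgt z hz))
      (hsm _ (hgt z hz))).contDiffWithinAt
  · intro z hz
    exact g.hasFDerivAt_symm (f' := A _ (hgt z hz)) hz (hG _ (hgt z hz))

end FlatFrame

variable {M : Type*} [TopologicalSpace M] [ChartedSpace (Eucl 2) M] {f : M → Eucl 4}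
  {L₁ L₂ : M → Set (Eucl 4)}

/-- A chart centered at `z₀ = e p` in which `f` splits over a square: the coordinate curves are
tangent to the two line fields, with velocities `α` and `β`. -/
structure BoxChart (f : M → Eucl 4) (L₁ L₂ : M → Set (Eucl 4)) (z₀ : Eucl 2) (r : ℝ)
    (e : OpenPartialHomeomorph M (Eucl 2)) (α β : ℝ → Eucl 4) : Prop where
  smooth : ContMDiffOn (𝓡 2) (𝓡 2) ∞ e e.source
  smooth_symm : ContMDiffOn (𝓡 2) (𝓡 2) ∞ e.symm e.target
  pos : 0 < r
  subset : square z₀ r ⊆ e.target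
  hasFDerivAt : ∀ z ∈ square z₀ r, HasFDerivAt (f ∘ e.symm) (planeMap (α (z 0)) (β (z 1))) z
  cont_left : ∀ z ∈ square z₀ r, ContinuousAt α (z 0)
  cont_right : ∀ z ∈ square z₀ r, ContinuousAt β (z 1)
  mem_left : ∀ z ∈ square z₀ r, α (z 0) ∈ L₁ (e.symm z)
  mem_right : ∀ z ∈ square z₀ r, β (z 1) ∈ L₂ (e.symm z)

/-- In coordinates whose coordinate fields are x₁ and x₂, the equation D₂X₁ = 0 says that X₁ has no
derivative in the second coordinate, so it depends on the first alone over a square; similarly for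
X₂. These functions are the velocities α and β. -/
theorem IsFrameSystem.exists_boxChart [IsManifold (𝓡 2) ∞ M] [T2Space M]
    (h : IsFrameSystem f L₁ L₂) (hE₁ : HasCurveEnds f L₁)
    (hE₂ : HasCurveEnds f L₂) {p : M} {a b : Eucl 4} (ha : a ∈ L₁ p) (hb : b ∈ L₂ p)
    (z₀ : Eucl 2) : ∃ r e α β, BoxChart f L₁ L₂ z₀ r e α β ∧ p ∈ e.source ∧ e p = z₀ ∧
      α (z₀ 0) = a ∧ β (z₀ 1) = b := by
  obtain ⟨e, U, X₁, X₂, x₁, x₂, hc⟩ := h.exists_chart p a ha b hb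
  have hF := h.flatFrame hE₁ hE₂ hc
  obtain ⟨g, hxg, hgU, hgx, sg, sg', hg⟩ := hF.exists_coordinates hc.mem z₀
  have hgt : ∀ z ∈ g.target, g.symm z ∈ U := fun z hz => hgU (g.map_target hz)
  have hz₀ : z₀ ∈ g.target := hgx ▸ g.map_source hxg
  obtain ⟨r, hr, hsq⟩ := exists_square_subset (g.open_target.mem_nhds hz₀)
  have d₁ : ∀ z ∈ square z₀ r, HasFDerivAt (X₁ ∘ g.symm) ((fderiv ℝ X₁ (g.symm z)).comp
      (planeMap (x₁ (g.symm z)) (x₂ (g.symm z)))) z := fun z hz =>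
    (hF.differentiableAt_left (hgt z (hsq hz))).hasFDerivAt.comp z (hg z (hsq hz))
  have d₂ : ∀ z ∈ square z₀ r, HasFDerivAt (X₂ ∘ g.symm) ((fderiv ℝ X₂ (g.symm z)).comp
      (planeMap (x₁ (g.symm z)) (x₂ (g.symm z)))) z := fun z hz =>
    (hF.swap.differentiableAt_left (hgt z (hsq hz))).hasFDerivAt.comp z (hg z (hsq hz))
  let α : ℝ → Eucl 4 := fun s => X₁ (g.symm !₂[s, z₀ 1])
  let β : ℝ → Eucl 4 := fun t => X₂ (g.symm !₂[z₀ 0, t])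
  have m₁ : ∀ z ∈ square z₀ r, !₂[z 0, z₀ 1] ∈ square z₀ r := fun z hz =>
    ⟨by simpa using hz.1, by simpa using hr⟩
  have m₂ : ∀ z ∈ square z₀ r, !₂[z₀ 0, z 1] ∈ square z₀ r := fun z hz =>
    ⟨by simpa using hr, by simpa using hz.2⟩
  have hα : ∀ z ∈ square z₀ r, X₁ (g.symm z) = α (z 0) := fun z hz =>
    eq_of_fderiv_segment_eq_zero (g := X₁ ∘ g.symm) (convex_square z₀ r) (m₁ z hz) hz d₁
      fun y hy => by
        simp [hF.deriv_left_zero _ (hgt y (hsq hy))]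
  have hβ : ∀ z ∈ square z₀ r, X₂ (g.symm z) = β (z 1) := fun z hz =>
    eq_of_fderiv_segment_eq_zero (g := X₂ ∘ g.symm) (convex_square z₀ r) (m₂ z hz) hz d₂
      fun y hy => by
        simp [hF.deriv_right_zero _ (hgt y (hsq hy))]
  have hz₀' : z₀ ∈ square z₀ r := mem_square_self z₀ hr
  have hsymm0 : g.symm z₀ = e p := by rw [← hgx, g.left_inv hxg]
  refine ⟨r, e.trans g, α, β, ⟨?_, ?_, hr, ?_, ?_, ?_, ?_, ?_, ?_⟩, ?_, hgx, ?_, ?_⟩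
  · have h1 : ContMDiffOn (𝓡 2) (𝓡 2) ∞ g g.source := sg.contMDiffOn
    exact h1.comp ((contMDiffOn_of_mem_maximalAtlas hc.atlas).mono
      fun q hq => by simpa using hq.1) fun q hq => by simpa using hq.2
  · have h1 : ContMDiffOn (𝓡 2) (𝓡 2) ∞ g.symm g.target := sg'.contMDiffOn
    exact (contMDiffOn_symm_of_mem_maximalAtlas hc.atlas).comp (h1.mono
      fun q hq => by rw [OpenPartialHomeomorph.trans_target] at hq; exact hq.1)
      fun q hq => by rw [OpenPartialHomeomorph.trans_target] at hq; exact hq.2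
  · intro z hz
    rw [OpenPartialHomeomorph.trans_target]
    exact ⟨hsq hz, hc.subset (hgt z (hsq hz))⟩
  · intro z hz
    have := (hF.smooth.differentiableAt_of_isOpen hF.isOpen (hgt z (hsq hz))).hasFDerivAt.comp z
      (hg z (hsq hz))
    refine HasFDerivAt.congr_fderiv this ?_
    ext1 w
    simp [hF.lift_left _ (hgt z (hsq hz)), hF.lift_right _ (hgt z (hsq hz)), hα z hz, hβ z hz]
  · intro z hz
    exact ContinuousAt.comp (f := fun s : ℝ => (!₂[s, z₀ 1] : Eucl 2)) (g := X₁ ∘ g.symm)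
      (d₁ _ (m₁ z hz)).continuousAt (by fun_prop)
  · intro z hz
    exact ContinuousAt.comp (f := fun s : ℝ => (!₂[z₀ 0, s] : Eucl 2)) (g := X₂ ∘ g.symm)
      (d₂ _ (m₂ z hz)).continuousAt (by fun_prop)
  · intro z hz
    rw [← hα z hz]
    change _ ∈ L₁ (e.symm (g.symm z))
    rw [hc.lines_left _ (hgt z (hsq hz))]
    exact Or.inl rfl
  · intro z hz
    rw [← hβ z hz]
    change _ ∈ L₂ (e.symm (g.symm z))
    rw [hc.lines_right _ (hgt z (hsq hz))]
    exact Or.inl rfl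
  · rw [OpenPartialHomeomorph.trans_source]
    exact ⟨hc.mem_source, hxg⟩
  · rw [← hα z₀ hz₀', hsymm0, hc.left]
  · rw [← hβ z₀ hz₀', hsymm0, hc.right]

end Boxes

/-! ### The development of a complete surface -/

section Development

theorem hasDerivAt_row (s t : ℝ) :
    HasDerivAt (fun s : ℝ => (!₂[s, t] : Eucl 2)) !₂[1, 0] s := by
  have : (fun s : ℝ => (!₂[s, t] : Eucl 2)) = fun s : ℝ => s • (!₂[1, 0] : Eucl 2) + !₂[0, t] := by
    funext s; ext i; fin_cases i <;> simp
  rw [this]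
  simpa using ((hasDerivAt_id s).smul_const (!₂[1, 0] : Eucl 2)).add_const !₂[0, t]

theorem hasDerivAt_column (s t : ℝ) :
    HasDerivAt (fun t : ℝ => (!₂[s, t] : Eucl 2)) !₂[0, 1] t := by
  have : (fun t : ℝ => (!₂[s, t] : Eucl 2)) = fun t : ℝ => t • (!₂[0, 1] : Eucl 2) + !₂[s, 0] := by
    funext t; ext i; fin_cases i <;> simp
  rw [this]
  simpa using ((hasDerivAt_id t).smul_const (!₂[0, 1] : Eucl 2)).add_const !₂[s, 0]

theorem eta_plane (z : Eucl 2) : (!₂[z 0, z 1] : Eucl 2) = z := by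
  ext i; fin_cases i <;> rfl

theorem mem_square_iff {z₀ : Eucl 2} {r s t : ℝ} : (!₂[s, t] : Eucl 2) ∈ square z₀ r ↔
    s ∈ Set.Ioo (z₀ 0 - r) (z₀ 0 + r) ∧ t ∈ Set.Ioo (z₀ 1 - r) (z₀ 1 + r) := by
  simp only [square, Set.mem_ofPred_eq, abs_lt, Set.mem_Ioo]
  simp only [PiLp.toLp_apply, Matrix.cons_val_zero, Matrix.cons_val_one]
  constructor
  · rintro ⟨⟨h1, h2⟩, h3, h4⟩
    exact ⟨⟨by linarith, by linarith⟩, by linarith, by linarith⟩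
  · rintro ⟨⟨h1, h2⟩, h3, h4⟩
    exact ⟨⟨by linarith, by linarith⟩, by linarith, by linarith⟩

variable {M : Type*} [TopologicalSpace M] [ChartedSpace (Eucl 2) M] {f : M → Eucl 4}
  {L₁ L₂ : M → Set (Eucl 4)}

namespace BoxChart

variable {z₀ : Eucl 2} {r : ℝ} {e : OpenPartialHomeomorph M (Eucl 2)} {α β : ℝ → Eucl 4}

theorem hasDerivAt_row (h : BoxChart f L₁ L₂ z₀ r e α β) {s t : ℝ}
    (hz : (!₂[s, t] : Eucl 2) ∈ square z₀ r) :
    HasDerivAt (f ∘ fun s => e.symm !₂[s, t]) (α s) s := by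
  have := (h.hasFDerivAt _ hz).comp_hasDerivAt s (_root_.hasDerivAt_row s t)
  exact this.congr_deriv (by simp)

theorem hasDerivAt_column (h : BoxChart f L₁ L₂ z₀ r e α β) {s t : ℝ}
    (hz : (!₂[s, t] : Eucl 2) ∈ square z₀ r) :
    HasDerivAt (f ∘ fun t => e.symm !₂[s, t]) (β t) t := by
  have := (h.hasFDerivAt _ hz).comp_hasDerivAt t (_root_.hasDerivAt_column s t)
  exact this.congr_deriv (by simp)

theorem isLineCurveAt_row (h : BoxChart f L₁ L₂ z₀ r e α β) {s t : ℝ}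
    (hz : (!₂[s, t] : Eucl 2) ∈ square z₀ r) :
    IsLineCurveAt f L₁ (fun s => e.symm !₂[s, t]) s := by
  have hd : deriv (f ∘ fun s => e.symm !₂[s, t]) =ᶠ[𝓝 s] α := by
    filter_upwards [(_root_.hasDerivAt_row s t).continuousAt.eventually
      ((isOpen_square z₀ r).mem_nhds hz)] with s' hs' using (h.hasDerivAt_row hs').deriv
  refine ⟨?_, (h.hasDerivAt_row hz).differentiableAt, ?_, ?_⟩
  · exact ContinuousAt.comp (f := fun s : ℝ => (!₂[s, t] : Eucl 2))
      (e.symm.continuousAt (h.subset hz)) (_root_.hasDerivAt_row s t).continuousAt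
  · rw [hd.eq_of_nhds]
    exact h.mem_left _ hz
  · exact ContinuousAt.congr (h.cont_left _ hz) hd.symm

theorem isLineCurveAt_column (h : BoxChart f L₁ L₂ z₀ r e α β) {s t : ℝ}
    (hz : (!₂[s, t] : Eucl 2) ∈ square z₀ r) :
    IsLineCurveAt f L₂ (fun t => e.symm !₂[s, t]) t := by
  have hd : deriv (f ∘ fun t => e.symm !₂[s, t]) =ᶠ[𝓝 t] β := by
    filter_upwards [(_root_.hasDerivAt_column s t).continuousAt.eventually
      ((isOpen_square z₀ r).mem_nhds hz)] with s' hs' using (h.hasDerivAt_column hs').deriv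
  refine ⟨?_, (h.hasDerivAt_column hz).differentiableAt, ?_, ?_⟩
  · exact ContinuousAt.comp (f := fun t : ℝ => (!₂[s, t] : Eucl 2))
      (e.symm.continuousAt (h.subset hz)) (_root_.hasDerivAt_column s t).continuousAt
  · rw [hd.eq_of_nhds]
    exact h.mem_right _ hz
  · exact ContinuousAt.congr (h.cont_right _ hz) hd.symm

theorem recenter (h : BoxChart f L₁ L₂ z₀ r e α β) {z : Eucl 2} (hz : z ∈ square z₀ r) :
    ∃ r', BoxChart f L₁ L₂ z r' e α β := by
  obtain ⟨r', hr', hsub⟩ := exists_square_subset ((isOpen_square z₀ r).mem_nhds hz)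
  exact ⟨r', h.smooth, h.smooth_symm, hr', hsub.trans h.subset,
    fun w hw => h.hasFDerivAt w (hsub hw), fun w hw => h.cont_left w (hsub hw),
    fun w hw => h.cont_right w (hsub hw), fun w hw => h.mem_left w (hsub hw),
    fun w hw => h.mem_right w (hsub hw)⟩

end BoxChart

theorem BoxChart.eventually_row {z₀ : Eucl 2} {r : ℝ} {s t : ℝ}
    (hz : (!₂[s, t] : Eucl 2) ∈ square z₀ r) : ∀ᶠ s' in 𝓝 s, (!₂[s', t] : Eucl 2) ∈ square z₀ r :=
  (_root_.hasDerivAt_row s t).continuousAt.eventually ((isOpen_square z₀ r).mem_nhds hz)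

namespace IsFrameSystem

variable [T2Space M]

/-- Along curves of the first family the second line field is parallel. -/
theorem right_const [IsManifold (𝓡 2) ∞ M] (h : IsFrameSystem f L₁ L₂) (hE₁ : HasCurveEnds f L₁)
    (hE₂ : HasCurveEnds f L₂) {γ : ℝ → M} (hγ : ∀ t, IsLineCurveAt f L₁ γ t) (s t : ℝ) :
    L₂ (γ s) = L₂ (γ t) := by
  suffices hc : IsLocallyConstant (fun t => L₂ (γ t)) from hc.apply_eq_of_preconnectedSpace s t
  rw [IsLocallyConstant.iff_eventually_eq]
  intro t
  obtain ⟨b, hb⟩ := h.nonempty_right (γ t)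
  obtain ⟨r, e, α, β, hB, hs, he, hα, hβ⟩ := h.exists_boxChart hE₁ hE₂ (hγ t).mem hb !₂[t, 0]
  have hz := mem_square_self !₂[t, 0] hB.pos
  have hev := h.eventuallyEq_curve (Filter.Eventually.of_forall hγ)
    ((BoxChart.eventually_row hz).mono fun s hs => hB.isLineCurveAt_row hs)
    (by rw [← he, e.left_inv hs]) (by rw [(hB.hasDerivAt_row hz).deriv]; exact hα.symm)
  have hpair : ∀ {q : M} {v : Eucl 4}, v ∈ L₂ q → L₂ q = {v, -v} := by
    intro q v hv
    ext w
    refine ⟨fun hw => h.swap.eq_or_eq_neg hv hw, ?_⟩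
    rintro (rfl | rfl)
    · exact hv
    · exact h.swap.neg_mem _ _ hv
  filter_upwards [hev, BoxChart.eventually_row hz] with s hs hsq
  have := hB.mem_right _ hsq
  rw [hs, hpair hb]
  apply hpair
  rw [← hβ]
  exact this

/-- A curve that meets a complete curve of the same family runs along it. -/
theorem eq_or_reverse (h : IsFrameSystem f L₁ L₂) {G η : ℝ → M}
    (hG : ∀ t, IsLineCurveAt f L₁ G t) {J : Set ℝ} (hJ : IsOpen J) (hJc : IsPreconnected J)
    (hη : ∀ t ∈ J, IsLineCurveAt f L₁ η t) {t₀ t₁ : ℝ} (ht₀ : t₀ ∈ J) (h0 : η t₀ = G t₁) :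
    ∃ ε : ℝ, (ε = 1 ∨ ε = -1) ∧ ∀ t ∈ J, η t = G (ε * t + (t₁ - ε * t₀)) := by
  have h1 : deriv (f ∘ η) t₀ ∈ L₁ (G t₁) := h0 ▸ (hη t₀ ht₀).mem
  have key : ∀ ε : ℝ, (ε = 1 ∨ ε = -1) → deriv (f ∘ η) t₀ = ε • deriv (f ∘ G) t₁ →
      ∀ t ∈ J, η t = G (ε * t + (t₁ - ε * t₀)) := by
    intro ε hε hd
    have e0 : ε * t₀ + (t₁ - ε * t₀) = t₁ := by ring
    refine h.eqOn_curve (γ' := fun t => G (ε * t + (t₁ - ε * t₀))) hJ hJc hη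
      (fun s _ => (hG _).comp_affine hε h.neg_mem) ht₀ ?_ ?_
    · simp only [e0, h0]
    · have := deriv_comp_affine (g := f ∘ G) ε (t₁ - ε * t₀) t₀
      rw [e0, ← hd] at this
      exact this.symm
  rcases h.eq_or_eq_neg (hG t₁).mem h1 with h2 | h2
  · exact ⟨1, Or.inl rfl, key 1 (Or.inl rfl) (by rw [h2, one_smul])⟩
  · exact ⟨-1, Or.inr rfl, key (-1) (Or.inr rfl) (by rw [h2, neg_smul, one_smul])⟩

end IsFrameSystem

/-- A local diffeomorphism from the plane that carries the coordinate lines to the two families of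
curves; `α` and `β` are the velocities of the curves in `ℝ⁴`. -/
structure IsDevelopment (f : M → Eucl 4) (L₁ L₂ : M → Set (Eucl 4)) (F : Eucl 2 → M)
    (α β : ℝ → Eucl 4) : Prop where
  chart : ∀ z, ∃ e : OpenPartialHomeomorph M (Eucl 2), ContMDiffOn (𝓡 2) (𝓡 2) ∞ e e.source ∧
    ContMDiffOn (𝓡 2) (𝓡 2) ∞ e.symm e.target ∧ z ∈ e.target ∧ F =ᶠ[𝓝 z] e.symm
  hasFDerivAt : ∀ z, HasFDerivAt (f ∘ F) (planeMap (α (z 0)) (β (z 1))) z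
  mem_left : ∀ z, α (z 0) ∈ L₁ (F z)
  mem_right : ∀ z, β (z 1) ∈ L₂ (F z)
  cont_left : Continuous α
  cont_right : Continuous β

variable [T2Space M]

/-- F(s, t) is reached by running a complete curve γ of the first family for time s, and then for
time t the complete curve of the second family that starts at γ(s) with the fixed velocity b₀. The
work lies in showing that F agrees with the inverse of a box chart near every point, including
points far from the initial curve. -/
theorem IsFrameSystem.exists_development [IsManifold (𝓡 2) ∞ M] [Nonempty M]
    (h : IsFrameSystem f L₁ L₂)
    (hE₁ : HasCurveEnds f L₁) (hE₂ : HasCurveEnds f L₂) :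
    ∃ F α β, IsDevelopment f L₁ L₂ F α β := by
  obtain ⟨p₀⟩ := (inferInstance : Nonempty M)
  obtain ⟨a₀, ha₀⟩ := h.nonempty_left p₀
  obtain ⟨b₀, hb₀⟩ := h.nonempty_right p₀
  obtain ⟨γ, hγ, hγ0, -⟩ := h.exists_global_curve hE₁ ha₀
  -- The second line field is parallel along γ, so a single vector b₀ can serve as initial velocity
  -- everywhere, which makes the choice consistent in s.
  have hb : ∀ s, b₀ ∈ L₂ (γ s) := fun s => by
    rw [h.right_const hE₁ hE₂ hγ s 0, hγ0]; exact hb₀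
  choose C hC hC0 hCd using fun s => h.swap.exists_global_curve hE₂ (hb s)
  let F : Eucl 2 → M := fun z => C (z 0) (z 1)
  let α : ℝ → Eucl 4 := fun s => deriv (f ∘ γ) s
  let Good : Eucl 2 → Prop := fun z => ∃ r e α' β', BoxChart f L₁ L₂ z r e α' β' ∧
    F =ᶠ[𝓝 z] e.symm ∧ α' (z 0) = α (z 0)
  -- Agreement with the box on one row t', in position and vertical velocity, spreads to the whole
  -- box because each column is a curve of the second family and such curves are unique.
  have good_of_row : ∀ (s₀ t₀ : ℝ) (r : ℝ) (e : OpenPartialHomeomorph M (Eucl 2))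
      (α' β' : ℝ → Eucl 4), BoxChart f L₁ L₂ !₂[s₀, t₀] r e α' β' → α' s₀ = α s₀ →
      ∀ t' ∈ Set.Ioo (t₀ - r) (t₀ + r), (∀ᶠ s in 𝓝 s₀, C s t' = e.symm !₂[s, t'] ∧
        deriv (f ∘ C s) t' = β' t') → Good !₂[s₀, t₀] := by
    intro s₀ t₀ r e α' β' hB hα t' ht' hev
    refine ⟨r, e, α', β', hB, ?_, hα⟩
    have hs : ∀ᶠ s in 𝓝 s₀, s ∈ Set.Ioo (s₀ - r) (s₀ + r) :=
      Ioo_mem_nhds (by linarith [hB.pos]) (by linarith [hB.pos])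
    have hrow : ∀ᶠ s in 𝓝 s₀, ∀ t ∈ Set.Ioo (t₀ - r) (t₀ + r), C s t = e.symm !₂[s, t] := by
      filter_upwards [hev, hs] with s hs1 hs2
      refine h.swap.eqOn_curve (γ' := fun t => e.symm !₂[s, t]) isOpen_Ioo isPreconnected_Ioo
        (fun t _ => hC s t)
        (fun t ht => hB.isLineCurveAt_column (mem_square_iff.2 ⟨by simpa using hs2, by simpa using ht⟩))
        ht' hs1.1 ?_
      rw [hs1.2, (hB.hasDerivAt_column
        (mem_square_iff.2 ⟨by simpa using hs2, by simpa using ht'⟩)).deriv]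
    have c0 : Filter.Tendsto (fun z : Eucl 2 => z 0) (𝓝 !₂[s₀, t₀]) (𝓝 s₀) := by
      have : Continuous fun z : Eucl 2 => z 0 := by fun_prop
      simpa using this.tendsto !₂[s₀, t₀]
    have c1 : Filter.Tendsto (fun z : Eucl 2 => z 1) (𝓝 !₂[s₀, t₀]) (𝓝 t₀) := by
      have : Continuous fun z : Eucl 2 => z 1 := by fun_prop
      simpa using this.tendsto !₂[s₀, t₀]
    filter_upwards [c0.eventually hrow, c1.eventually
      (Ioo_mem_nhds (by linarith [hB.pos] : t₀ - r < t₀) (by linarith [hB.pos] : t₀ < t₀ + r))]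
      with z h1 h2
    have := h1 _ h2
    rwa [eta_plane] at this
  have good : ∀ s₀ t₀ : ℝ, Good !₂[s₀, t₀] := by
    intro s₀
    -- Fix the column s₀ and move along t₀. Openness is immediate; for closedness take a box centred
    -- at a limit point, oriented by α(s₀), and a good point in its central column. The two row
    -- curves there have the same position and velocity, so they agree, and `good_of_row` applies.
    have hclopen : IsClopen {t₀ : ℝ | Good !₂[s₀, t₀]} := by
      constructor
      · rw [← closure_subset_iff_isClosed]
        intro t₀ ht₀
        have ha : α s₀ ∈ L₁ (C s₀ t₀) := by
          rw [h.swap.right_const hE₂ hE₁ (hC s₀) t₀ 0, hC0]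
          exact (hγ s₀).mem
        obtain ⟨r, e, α', β', hB, hs, he, hα, hβ⟩ := h.exists_boxChart hE₁ hE₂ ha
          (hC s₀ t₀).mem !₂[s₀, t₀]
        have hz₀ := mem_square_self !₂[s₀, t₀] hB.pos
        have hcol : ∀ t ∈ Set.Ioo (t₀ - r) (t₀ + r), C s₀ t = e.symm !₂[s₀, t] := by
          refine h.swap.eqOn_curve (γ' := fun t => e.symm !₂[s₀, t]) isOpen_Ioo isPreconnected_Ioo
            (fun t _ => hC s₀ t) (fun t ht => hB.isLineCurveAt_column
              (mem_square_iff.2 ⟨by simp [hB.pos], by simpa using ht⟩))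
            (t := t₀) (by simp [hB.pos]) (by rw [← he, e.left_inv hs]) ?_
          rw [(hB.hasDerivAt_column hz₀).deriv]
          exact hβ.symm
        obtain ⟨t', ht'I, r', e', α'', β'', hB', hF', hα'⟩ := mem_closure_iff_nhds.1 ht₀ _
          (Ioo_mem_nhds (by linarith [hB.pos] : t₀ - r < t₀) (by linarith [hB.pos] : t₀ < t₀ + r))
        have hz' : (!₂[s₀, t'] : Eucl 2) ∈ square !₂[s₀, t₀] r :=
          mem_square_iff.2 ⟨by simp [hB.pos], by simpa using ht'I⟩
        have hz'' := mem_square_self !₂[s₀, t'] hB'.pos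
        have hcolev : ∀ᶠ s in 𝓝 s₀, F =ᶠ[𝓝 !₂[s, t']] e'.symm :=
          (_root_.hasDerivAt_row s₀ t').continuousAt.eventually hF'.eventually_nhds
        have hder : ∀ᶠ s in 𝓝 s₀, C s t' = e'.symm !₂[s, t'] ∧ deriv (f ∘ C s) t' = β'' t' := by
          filter_upwards [hcolev, BoxChart.eventually_row hz''] with s hs hsq
          have hCs : C s =ᶠ[𝓝 t'] fun t => e'.symm !₂[s, t] := by
            filter_upwards [(_root_.hasDerivAt_column s t').continuousAt.eventually hs] with t ht
            simpa [F] using ht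
          exact ⟨hCs.self_of_nhds, (Filter.EventuallyEq.fun_comp hCs f).deriv_eq.trans
            (hB'.hasDerivAt_column hsq).deriv⟩
        have hββ : β'' t' = β' t' := by
          rw [← hder.self_of_nhds.2, ← (hB.hasDerivAt_column hz').deriv]
          apply Filter.EventuallyEq.deriv_eq
          apply Filter.EventuallyEq.fun_comp (g := fun t => e.symm !₂[s₀, t]) _ f
          filter_upwards [Ioo_mem_nhds ht'I.1 ht'I.2] with t ht using hcol t ht
        have hrows : (fun s => e'.symm !₂[s, t']) =ᶠ[𝓝 s₀] fun s => e.symm !₂[s, t'] := by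
          apply h.eventuallyEq_curve
            ((BoxChart.eventually_row hz'').mono fun s hs => hB'.isLineCurveAt_row hs)
            ((BoxChart.eventually_row hz').mono fun s hs => hB.isLineCurveAt_row hs)
          · rw [← hder.self_of_nhds.1, hcol t' ht'I]
          · rw [(hB'.hasDerivAt_row hz'').deriv, (hB.hasDerivAt_row hz').deriv]
            exact hα'.trans hα.symm
        refine good_of_row s₀ t₀ r e α' β' hB hα t' ht'I ?_
        filter_upwards [hder, hrows] with s h1 h2
        exact ⟨h1.1.trans h2, h1.2.trans hββ⟩
      · rw [isOpen_iff_mem_nhds]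
        rintro t₀ ⟨r, e, α', β', hB, hF, hα⟩
        have hz₀ := mem_square_self !₂[s₀, t₀] hB.pos
        filter_upwards [(_root_.hasDerivAt_column s₀ t₀).continuousAt.eventually hF.eventually_nhds,
          (_root_.hasDerivAt_column s₀ t₀).continuousAt.eventually
            ((isOpen_square _ r).mem_nhds hz₀)] with t h1 h2
        obtain ⟨r', hB'⟩ := hB.recenter (z := !₂[s₀, t]) h2
        exact ⟨r', e, α', β', hB', h1, hα⟩
    have hne : {t₀ : ℝ | Good !₂[s₀, t₀]}.Nonempty := by
      refine ⟨0, ?_⟩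
      obtain ⟨r, e, α', β', hB, hs, he, hα, hβ⟩ := h.exists_boxChart hE₁ hE₂ (hγ s₀).mem
        (hb s₀) !₂[s₀, 0]
      have hz₀ := mem_square_self !₂[s₀, 0] hB.pos
      refine good_of_row s₀ 0 r e α' β' hB hα 0 (by simp [hB.pos]) ?_
      have hrows : γ =ᶠ[𝓝 s₀] fun s => e.symm !₂[s, 0] := by
        apply h.eventuallyEq_curve (Filter.Eventually.of_forall hγ)
          ((BoxChart.eventually_row hz₀).mono fun s hs => hB.isLineCurveAt_row hs)
        · rw [← he, e.left_inv hs]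
        · rw [(hB.hasDerivAt_row hz₀).deriv]
          exact hα.symm
      filter_upwards [hrows] with s hs
      exact ⟨(hC0 s).trans hs, (hCd s).trans hβ.symm⟩
    intro t₀
    exact Set.eq_univ_iff_forall.1 (hclopen.eq_univ hne) t₀
  have hgood : ∀ z, Good z := fun z => eta_plane z ▸ good (z 0) (z 1)
  have hderC : ∀ t s₀ : ℝ, ∀ r e α' β', BoxChart f L₁ L₂ !₂[s₀, t] r e α' β' →
      F =ᶠ[𝓝 !₂[s₀, t]] e.symm → ∀ᶠ s in 𝓝 s₀, deriv (f ∘ C s) t = β' t := by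
    intro t s₀ r e α' β' hB hF
    have hz := mem_square_self !₂[s₀, t] hB.pos
    filter_upwards [(_root_.hasDerivAt_row s₀ t).continuousAt.eventually hF.eventually_nhds,
      BoxChart.eventually_row hz] with s hs hsq
    have hCs : C s =ᶠ[𝓝 t] fun t => e.symm !₂[s, t] := by
      filter_upwards [(_root_.hasDerivAt_column s t).continuousAt.eventually hs] with t ht
      simpa [F] using ht
    exact (Filter.EventuallyEq.fun_comp hCs f).deriv_eq.trans (hB.hasDerivAt_column hsq).deriv
  -- Box charts show that the vertical velocity is locally independent of s, hence independent of s
  -- altogether; this yields a single function β.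
  have hconst : ∀ t s s' : ℝ, deriv (f ∘ C s) t = deriv (f ∘ C s') t := by
    intro t s s'
    suffices hc : IsLocallyConstant (fun s => deriv (f ∘ C s) t) from
      hc.apply_eq_of_preconnectedSpace s s'
    rw [IsLocallyConstant.iff_eventually_eq]
    intro s₀
    obtain ⟨r, e, α', β', hB, hF, -⟩ := good s₀ t
    have hev := hderC t s₀ r e α' β' hB hF
    filter_upwards [hev] with s hs
    rw [hs, hev.self_of_nhds]
  have hbox : ∀ z, ∃ r e α' β', BoxChart f L₁ L₂ z r e α' β' ∧ F =ᶠ[𝓝 z] e.symm ∧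
      α' (z 0) = α (z 0) ∧ β' (z 1) = deriv (f ∘ C 0) (z 1) := by
    intro z
    obtain ⟨r, e, α', β', hB, hF, hα⟩ := hgood z
    refine ⟨r, e, α', β', hB, hF, hα, ?_⟩
    rw [← (hderC (z 1) (z 0) r e α' β' (by rwa [eta_plane]) (by rwa [eta_plane])).self_of_nhds]
    exact hconst _ _ _
  refine ⟨F, α, fun t => deriv (f ∘ C 0) t, fun z => ?_, fun z => ?_, fun z => ?_, fun z => ?_,
    continuous_iff_continuousAt.2 fun s => (hγ s).cont_deriv,
    continuous_iff_continuousAt.2 fun t => (hC 0 t).cont_deriv⟩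
  all_goals
    obtain ⟨r, e, α', β', hB, hF, hα, hβ⟩ := hbox z
    have hz := mem_square_self z hB.pos
  · exact ⟨e, hB.smooth, hB.smooth_symm, hB.subset hz, hF⟩
  · rw [← hα, ← hβ]
    exact (hB.hasFDerivAt z hz).congr_of_eventuallyEq (hF.fun_comp f)
  · rw [← hα, hF.eq_of_nhds]
    exact hB.mem_left z hz
  · rw [← hβ, hF.eq_of_nhds]
    exact hB.mem_right z hz

namespace IsDevelopment

variable {F : Eucl 2 → M} {α β : ℝ → Eucl 4}

theorem continuous (hF : IsDevelopment f L₁ L₂ F α β) : Continuous F :=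
  continuous_iff_continuousAt.2 fun z => by
    obtain ⟨e, -, -, hz, he⟩ := hF.chart z
    exact (e.symm.continuousAt hz).congr he.symm

theorem hasDerivAt_row (hF : IsDevelopment f L₁ L₂ F α β) (s t : ℝ) :
    HasDerivAt (f ∘ fun s => F !₂[s, t]) (α s) s := by
  have := (hF.hasFDerivAt _).comp_hasDerivAt s (_root_.hasDerivAt_row s t)
  exact this.congr_deriv (by simp)

theorem hasDerivAt_column (hF : IsDevelopment f L₁ L₂ F α β) (s t : ℝ) :
    HasDerivAt (f ∘ fun t => F !₂[s, t]) (β t) t := by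
  have := (hF.hasFDerivAt _).comp_hasDerivAt t (_root_.hasDerivAt_column s t)
  exact this.congr_deriv (by simp)

theorem isLineCurveAt_row (hF : IsDevelopment f L₁ L₂ F α β) (s t : ℝ) :
    IsLineCurveAt f L₁ (fun s => F !₂[s, t]) s := by
  have hd : deriv (f ∘ fun s => F !₂[s, t]) = α := funext fun s => (hF.hasDerivAt_row s t).deriv
  refine ⟨ContinuousAt.comp (f := fun s : ℝ => (!₂[s, t] : Eucl 2)) hF.continuous.continuousAt
    (_root_.hasDerivAt_row s t).continuousAt, (hF.hasDerivAt_row s t).differentiableAt, ?_, ?_⟩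
  · rw [hd]; exact hF.mem_left !₂[s, t]
  · rw [hd]; exact hF.cont_left.continuousAt

theorem isLineCurveAt_column (hF : IsDevelopment f L₁ L₂ F α β) (s t : ℝ) :
    IsLineCurveAt f L₂ (fun t => F !₂[s, t]) t := by
  have hd : deriv (f ∘ fun t => F !₂[s, t]) = β :=
    funext fun t => (hF.hasDerivAt_column s t).deriv
  refine ⟨ContinuousAt.comp (f := fun t : ℝ => (!₂[s, t] : Eucl 2)) hF.continuous.continuousAt
    (_root_.hasDerivAt_column s t).continuousAt, (hF.hasDerivAt_column s t).differentiableAt, ?_, ?_⟩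
  · rw [hd]; exact hF.mem_right !₂[s, t]
  · rw [hd]; exact hF.cont_right.continuousAt

theorem inner_eq_zero (hF : IsDevelopment f L₁ L₂ F α β) (h : IsFrameSystem f L₁ L₂) (s t : ℝ) :
    ⟪α s, β t⟫ = 0 :=
  h.inner_eq_zero (hF.mem_left !₂[s, t]) (hF.mem_right !₂[s, t])

theorem norm_left (hF : IsDevelopment f L₁ L₂ F α β) (h : IsFrameSystem f L₁ L₂) (s : ℝ) :
    ‖α s‖ = 1 := h.norm_eq_one (hF.mem_left !₂[s, 0])

theorem norm_right (hF : IsDevelopment f L₁ L₂ F α β) (h : IsFrameSystem f L₁ L₂) (t : ℝ) :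
    ‖β t‖ = 1 := h.swap.norm_eq_one (hF.mem_right !₂[0, t])

/-- Complete curves through a common point have the same orientation. -/
theorem eq_add_of_eq {L₁ L₂ : M → Set (Eucl 4)} (h : IsFrameSystem f L₁ L₂) {G η : ℝ → M}
    {v : ℝ → Eucl 4} (hG : ∀ t, IsLineCurveAt f L₁ G t) (hη : ∀ t, IsLineCurveAt f L₁ η t)
    (hGd : ∀ t, deriv (f ∘ G) t = v t) (hηd : ∀ t, deriv (f ∘ η) t = v t)
    {s t : ℝ} (h0 : η t = G s) (u : ℝ) : η (t + u) = G (s + u) := by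
  obtain ⟨ε, hε, he⟩ := h.eq_or_reverse hG isOpen_univ isPreconnected_univ
    (fun t _ => hη t) (Set.mem_univ t) h0
  rcases hε with rfl | rfl
  · rw [he _ (Set.mem_univ _)]
    congr 1; ring
  -- If the curves ran in opposite directions, η(r) = G(s + t − r), then at the midpoint r = (s +
  -- t)/2 the unit vector v(r) would equal its own negative.
  · exfalso
    have hfun : η = fun r => G (-1 * r + (s - -1 * t)) := funext fun r => he r (Set.mem_univ r)
    have hd := hηd ((s + t) / 2)
    have h2 := deriv_comp_affine (g := f ∘ G) (-1) (s - -1 * t) ((s + t) / 2)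
    have h3 : deriv (f ∘ η) ((s + t) / 2) = (-1 : ℝ) • deriv (f ∘ G)
        (-1 * ((s + t) / 2) + (s - -1 * t)) := by
      rw [← h2, hfun]; rfl
    rw [h3, hGd, show -1 * ((s + t) / 2) + (s - -1 * t) = (s + t) / 2 by ring] at hd
    have hv : v ((s + t) / 2) = 0 := by
      rw [neg_smul, one_smul, neg_eq_iff_add_eq_zero, ← two_smul ℝ] at hd
      simpa using hd
    have hn := h.norm_eq_one (hη ((s + t) / 2)).mem
    rw [hηd, hv] at hn
    simp at hn

/-- All rows have velocity α and all columns have velocity β. Two rows through a common point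
therefore agree after a shift of the parameter, and then so do the columns through corresponding
points. -/
theorem translate (hF : IsDevelopment f L₁ L₂ F α β) (h : IsFrameSystem f L₁ L₂) {z w : Eucl 2}
    (hzw : F z = F w) (u : Eucl 2) : F (z + u) = F (w + u) := by
  have h1 : F !₂[z 0 + u 0, z 1] = F !₂[w 0 + u 0, w 1] :=
    eq_add_of_eq h (G := fun s => F !₂[s, w 1]) (η := fun s => F !₂[s, z 1])
      (fun s => hF.isLineCurveAt_row s _) (fun s => hF.isLineCurveAt_row s _)
      (fun s => (hF.hasDerivAt_row s _).deriv) (fun s => (hF.hasDerivAt_row s _).deriv)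
      (by simpa only [eta_plane] using hzw) (u 0)
  have h2 : F !₂[z 0 + u 0, z 1 + u 1] = F !₂[w 0 + u 0, w 1 + u 1] :=
    eq_add_of_eq h.swap (G := fun t => F !₂[w 0 + u 0, t]) (η := fun t => F !₂[z 0 + u 0, t])
      (fun s => hF.isLineCurveAt_column _ s) (fun s => hF.isLineCurveAt_column _ s)
      (fun s => (hF.hasDerivAt_column _ s).deriv) (fun s => (hF.hasDerivAt_column _ s).deriv)
      h1 (u 1)
  rw [← eta_plane (z + u), ← eta_plane (w + u)]
  exact h2

theorem isOpenMap (hF : IsDevelopment f L₁ L₂ F α β) : IsOpenMap F := by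
  rw [isOpenMap_iff_nhds_le]
  intro z
  obtain ⟨e, -, -, hz, he⟩ := hF.chart z
  rw [Filter.map_congr he, he.eq_of_nhds, e.symm.map_nhds_eq hz]

/-- The range is open. A box around a limit point q contains some F(z), and the row through this
point followed by a column leads to q. Both pieces run along rows and columns of F, which are
complete, so q lies in the range. -/
theorem surjective [IsManifold (𝓡 2) ∞ M] [ConnectedSpace M] (hF : IsDevelopment f L₁ L₂ F α β)
    (h : IsFrameSystem f L₁ L₂) (hE₁ : HasCurveEnds f L₁) (hE₂ : HasCurveEnds f L₂) :
    Function.Surjective F := by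
  rw [← Set.range_eq_univ]
  refine IsClopen.eq_univ ⟨?_, hF.isOpenMap.isOpen_range⟩ (Set.range_nonempty F)
  rw [← closure_subset_iff_isClosed]
  intro q hq
  obtain ⟨a, ha⟩ := h.nonempty_left q
  obtain ⟨b, hb⟩ := h.nonempty_right q
  obtain ⟨r, e, α', β', hB, hqs, he, -, -⟩ := h.exists_boxChart hE₁ hE₂ ha hb 0
  have hz₀ := mem_square_self 0 hB.pos
  have hnhds : e.source ∩ e ⁻¹' (square 0 r) ∈ 𝓝 q := Filter.inter_mem (e.open_source.mem_nhds hqs)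
    ((e.continuousAt hqs) (by rw [he]; exact (isOpen_square 0 r).mem_nhds hz₀))
  obtain ⟨_, ⟨hs, hsq⟩, z, rfl⟩ := mem_closure_iff_nhds.1 hq _ hnhds
  set w := e (F z)
  have hw : w ∈ square 0 r := hsq
  have hw' := hw
  rw [← eta_plane w, mem_square_iff] at hw'
  have h00 : (0 : ℝ) ∈ Set.Ioo ((0 : Eucl 2) 0 - r) ((0 : Eucl 2) 0 + r) := by simp [hB.pos]
  have h01 : (0 : ℝ) ∈ Set.Ioo ((0 : Eucl 2) 1 - r) ((0 : Eucl 2) 1 + r) := by simp [hB.pos]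
  obtain ⟨ε, -, hε⟩ := h.eq_or_reverse (G := fun s => F !₂[s, z 1])
    (η := fun s => e.symm !₂[s, w 1]) (fun s => hF.isLineCurveAt_row s _) isOpen_Ioo
    isPreconnected_Ioo (fun s hs => hB.isLineCurveAt_row (mem_square_iff.2 ⟨hs, hw'.2⟩))
    (t₀ := w 0) (t₁ := z 0) hw'.1 (by simp only [eta_plane]; exact e.left_inv hs)
  have h1 := hε 0 h00
  set z' : Eucl 2 := !₂[ε * 0 + (z 0 - ε * w 0), z 1] with hz'
  obtain ⟨ε', -, hε'⟩ := h.swap.eq_or_reverse (G := fun t => F !₂[z' 0, t])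
    (η := fun t => e.symm !₂[0, t]) (fun s => hF.isLineCurveAt_column _ s) isOpen_Ioo
    isPreconnected_Ioo (fun s hs => hB.isLineCurveAt_column (mem_square_iff.2 ⟨h00, hs⟩))
    (t₀ := w 1) (t₁ := z' 1) hw'.2 (by simp only [eta_plane]; exact h1)
  have h2 := hε' 0 h01
  have h3 : e.symm !₂[0, 0] = q := by
    rw [show (!₂[0, 0] : Eucl 2) = 0 by ext i; fin_cases i <;> rfl, ← he, e.left_inv hqs]
  exact ⟨_, h2.symm.trans h3⟩

end IsDevelopment

end Development

/-! ### Surjective local diffeomorphisms -/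

section LocalDiffeos

variable {EA EB EC HA HB HC A B C : Type*}
  [NormedAddCommGroup EA] [NormedSpace ℝ EA] [TopologicalSpace HA] [TopologicalSpace A]
  [ChartedSpace HA A] {I : ModelWithCorners ℝ EA HA}
  [NormedAddCommGroup EB] [NormedSpace ℝ EB] [TopologicalSpace HB] [TopologicalSpace B]
  [ChartedSpace HB B] {J : ModelWithCorners ℝ EB HB}
  [NormedAddCommGroup EC] [NormedSpace ℝ EC] [TopologicalSpace HC] [TopologicalSpace C]
  [ChartedSpace HC C] {K : ModelWithCorners ℝ EC HC}

variable (I J) in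
/-- A smooth surjection with smooth local inverses. -/
structure IsLocalDiffeoOnto (p : A → B) : Prop where
  smooth : ContMDiff I J ∞ p
  surj : Function.Surjective p
  inverse : ∀ a, ∃ τ : B → A, τ (p a) = a ∧ (∀ᶠ b in 𝓝 (p a), ContMDiffAt J I ∞ τ b) ∧
    (∀ᶠ b in 𝓝 (p a), p (τ b) = b) ∧ ∀ᶠ a' in 𝓝 a, τ (p a') = a'

namespace IsLocalDiffeoOnto

variable {p : A → B} {q : A → C}

theorem isLocalDiffeomorph (hp : IsLocalDiffeoOnto I J p) : IsLocalDiffeomorph I J ∞ p := by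
  intro a
  obtain ⟨τ, hτ, h1, h2, h3⟩ := hp.inverse a
  obtain ⟨V, hV, hVo, haV⟩ := eventually_nhds_iff.1 (h1.and h2)
  obtain ⟨U, hU, hUo, haU⟩ := eventually_nhds_iff.1 h3
  have cτ : ContinuousOn τ V := fun b hb => (hV b hb).1.continuousAt.continuousWithinAt
  refine ⟨{ toFun := p
            invFun := τ
            source := U ∩ p ⁻¹' V
            target := V ∩ τ ⁻¹' U
            map_source' := fun x hx => ⟨hx.2, by rw [Set.mem_preimage, hU x hx.1]; exact hx.1⟩
            map_target' := fun y hy => ⟨hy.2, by rw [Set.mem_preimage, (hV y hy.1).2]; exact hy.1⟩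
            left_inv' := fun x hx => hU x hx.1
            right_inv' := fun y hy => (hV y hy.1).2
            open_source := hUo.inter (hVo.preimage hp.smooth.continuous)
            open_target := cτ.isOpen_inter_preimage hVo hUo
            contMDiffOn_toFun := hp.smooth.contMDiffOn
            contMDiffOn_invFun := fun y hy => (hV y hy.1).1.contMDiffWithinAt }, ⟨haU, haV⟩,
    fun x _ => rfl⟩

theorem contMDiff_of_comp (hp : IsLocalDiffeoOnto I J p) {g : B → C}
    (hg : ContMDiff I K ∞ (g ∘ p)) : ContMDiff J K ∞ g := by
  intro b
  obtain ⟨a, rfl⟩ := hp.surj b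
  obtain ⟨τ, hτ, h1, h2, h3⟩ := hp.inverse a
  refine ((hg (τ (p a))).comp (p a) h1.self_of_nhds).congr_of_eventuallyEq ?_
  filter_upwards [h2] with b hb
  simp [hb]

theorem of_comp (hp : IsLocalDiffeoOnto I J p) (hq : IsLocalDiffeoOnto I K q) {g : B → C}
    (hg : ∀ a, g (p a) = q a) : IsLocalDiffeoOnto J K g := by
  have hgp : g ∘ p = q := funext hg
  refine ⟨hp.contMDiff_of_comp (hgp ▸ hq.smooth), fun c => ?_, fun b => ?_⟩
  · obtain ⟨a, rfl⟩ := hq.surj c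
    exact ⟨p a, hg a⟩
  · obtain ⟨a, rfl⟩ := hp.surj b
    obtain ⟨σ, hσ, s1, s2, s3⟩ := hp.inverse a
    obtain ⟨τ, hτ, h1, h2, h3⟩ := hq.inverse a
    refine ⟨p ∘ τ, ?_, ?_, ?_, ?_⟩
    · simp [hg, hτ]
    · rw [hg]
      filter_upwards [h1] with c hc using (hp.smooth _).comp c hc
    · rw [hg]
      filter_upwards [h2] with c hc
      simp [hg, hc]
    · have hσt : Filter.Tendsto σ (𝓝 (p a)) (𝓝 a) := by
        have := s1.self_of_nhds.continuousAt
        rwa [ContinuousAt, hσ] at this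
      filter_upwards [s2, hσt.eventually h3] with b hb hb3
      rw [← hb, hg, Function.comp_apply, hb3]

/-- B and C are quotients of A with the same fibres, and smoothness of a map out of either one can
be tested after pulling back to A. -/
theorem exists_diffeomorph (hp : IsLocalDiffeoOnto I J p) (hq : IsLocalDiffeoOnto I K q)
    (h : ∀ a a', p a = p a' ↔ q a = q a') :
    ∃ Φ : Diffeomorph J K B C ∞, ∀ a, Φ (p a) = q a := by
  let φ : B → C := fun b => q (Function.surjInv hp.surj b)
  let ψ : C → B := fun c => p (Function.surjInv hq.surj c)
  have hφ : ∀ a, φ (p a) = q a := fun a => (h _ _).1 (Function.surjInv_eq hp.surj (p a))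
  have hψ : ∀ a, ψ (q a) = p a := fun a => (h _ _).2 (Function.surjInv_eq hq.surj (q a))
  have hl : ∀ b, ψ (φ b) = b := fun b => by
    obtain ⟨a, rfl⟩ := hp.surj b
    rw [hφ, hψ]
  have hr : ∀ c, φ (ψ c) = c := fun c => by
    obtain ⟨a, rfl⟩ := hq.surj c
    rw [hψ, hφ]
  have hφp : φ ∘ p = q := funext hφ
  have hψq : ψ ∘ q = p := funext hψ
  exact ⟨⟨⟨φ, ψ, hl, hr⟩, hp.contMDiff_of_comp (hφp ▸ hq.smooth),
    hq.contMDiff_of_comp (hψq ▸ hp.smooth)⟩, hφ⟩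

theorem comp {p : A → B} {r : B → C} (hr : IsLocalDiffeoOnto J K r) (hp : IsLocalDiffeoOnto I J p) :
    IsLocalDiffeoOnto I K (r ∘ p) := by
  refine ⟨hr.smooth.comp hp.smooth, hr.surj.comp hp.surj, fun a => ?_⟩
  obtain ⟨σ, hσ, s1, s2, s3⟩ := hp.inverse a
  obtain ⟨τ, hτ, h1, h2, h3⟩ := hr.inverse (p a)
  have ht : Filter.Tendsto τ (𝓝 (r (p a))) (𝓝 (p a)) := by
    have := h1.self_of_nhds.continuousAt
    rwa [ContinuousAt, hτ] at this
  refine ⟨σ ∘ τ, by simp [hτ, hσ], ?_, ?_, ?_⟩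
  · filter_upwards [h1, ht.eventually s1] with c hc hc' using hc'.comp c hc
  · filter_upwards [h2, ht.eventually s2] with c hc hc'
    simp [hc', hc]
  · filter_upwards [s3, hp.smooth.continuous.continuousAt.eventually h3] with a' h4 h5
    simp [h5, h4]

theorem of_continuousLinearEquiv (T : EA ≃L[ℝ] EB) :
    IsLocalDiffeoOnto 𝓘(ℝ, EA) 𝓘(ℝ, EB) T :=
  ⟨T.contDiff.contMDiff, T.surjective, fun _ => ⟨T.symm, T.symm_apply_apply _,
    Filter.Eventually.of_forall fun _ => T.symm.contDiff.contMDiff.contMDiffAt,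
    Filter.Eventually.of_forall fun _ => T.apply_symm_apply _,
    Filter.Eventually.of_forall fun _ => T.symm_apply_apply _⟩⟩

end IsLocalDiffeoOnto

theorem contMDiff_coord (i : Fin 2) : ContMDiff (𝓡 2) 𝓘(ℝ, ℝ) ∞ (fun z : Eucl 2 => z i) := by
  have : ContDiff ℝ ∞ (fun z : Eucl 2 => z i) := by fun_prop
  exact this.contMDiff

theorem contDiff_plane : ContDiff ℝ ∞ (fun x : ℝ × ℝ => (!₂[x.1, x.2] : Eucl 2)) := by
  rw [contDiff_euclidean]
  intro i
  fin_cases i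
  · exact contDiff_fst
  · exact contDiff_snd

/-- The product of two parametrizations of one-dimensional manifolds. -/
theorem IsLocalDiffeoOnto.prod {p₁ : ℝ → A} {p₂ : ℝ → B}
    (h₁ : IsLocalDiffeoOnto 𝓘(ℝ, ℝ) I p₁) (h₂ : IsLocalDiffeoOnto 𝓘(ℝ, ℝ) J p₂) :
    IsLocalDiffeoOnto (𝓡 2) (I.prod J) (fun z : Eucl 2 => (p₁ (z 0), p₂ (z 1))) := by
  refine ⟨(h₁.smooth.comp (contMDiff_coord 0)).prodMk (h₂.smooth.comp (contMDiff_coord 1)),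
    fun ⟨a, b⟩ => ?_, fun z => ?_⟩
  · obtain ⟨s, rfl⟩ := h₁.surj a
    obtain ⟨t, rfl⟩ := h₂.surj b
    exact ⟨!₂[s, t], rfl⟩
  · obtain ⟨σ, hσ, s1, s2, s3⟩ := h₁.inverse (z 0)
    obtain ⟨τ, hτ, t1, t2, t3⟩ := h₂.inverse (z 1)
    have c1 : Filter.Tendsto Prod.fst (𝓝 (p₁ (z 0), p₂ (z 1))) (𝓝 (p₁ (z 0))) :=
      continuous_fst.continuousAt
    have c2 : Filter.Tendsto Prod.snd (𝓝 (p₁ (z 0), p₂ (z 1))) (𝓝 (p₂ (z 1))) :=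
      continuous_snd.continuousAt
    refine ⟨fun x => !₂[σ x.1, τ x.2], ?_, ?_, ?_, ?_⟩
    · simp only [hσ, hτ, eta_plane]
    · filter_upwards [c1.eventually s1, c2.eventually t1] with x hx hy
      have h3 : ContMDiffAt (I.prod J) 𝓘(ℝ, ℝ × ℝ) ∞ (fun x : A × B => (σ x.1, τ x.2)) x :=
        (hx.comp x contMDiffAt_fst).prodMk_space (hy.comp x contMDiffAt_snd)
      exact ContMDiffAt.comp x (f := fun x : A × B => (σ x.1, τ x.2))
        contDiff_plane.contMDiff.contMDiffAt h3
    · filter_upwards [c1.eventually s2, c2.eventually t2] with x hx hy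
      simp [hx, hy]
    · have d0 : Filter.Tendsto (fun z : Eucl 2 => z 0) (𝓝 z) (𝓝 (z 0)) :=
        (contMDiff_coord 0).continuous.continuousAt
      have d1 : Filter.Tendsto (fun z : Eucl 2 => z 1) (𝓝 z) (𝓝 (z 1)) :=
        (contMDiff_coord 1).continuous.continuousAt
      filter_upwards [d0.eventually s3, d1.eventually t3] with w hx hy
      simp only [hx, hy, eta_plane]

theorem isLocalDiffeoOnto_line :
    IsLocalDiffeoOnto 𝓘(ℝ, ℝ) (𝓡 1) (fun s : ℝ => (WithLp.toLp 2 fun _ => s : Eucl 1)) := by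
  have h1 : ContDiff ℝ ∞ (fun s : ℝ => (WithLp.toLp 2 fun _ => s : Eucl 1)) := by
    rw [contDiff_euclidean]
    intro i
    fin_cases i
    exact contDiff_id
  have h2 : ContDiff ℝ ∞ (fun z : Eucl 1 => z 0) := by fun_prop
  have h3 : ∀ z : Eucl 1, (WithLp.toLp 2 fun _ => z 0) = z := fun z => by ext i; fin_cases i; rfl
  exact ⟨h1.contMDiff, fun z => ⟨z 0, h3 z⟩, fun s => ⟨fun z => z 0, rfl,
    Filter.Eventually.of_forall fun z => h2.contMDiff.contMDiffAt,
    Filter.Eventually.of_forall fun z => h3 z, Filter.Eventually.of_forall fun s => rfl⟩⟩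

attribute [local instance] finrank_real_complex_fact'

theorem contMDiffAt_circle_arg {z : Circle} (hz : (z : ℂ) ∈ Complex.slitPlane) :
    ContMDiffAt (𝓡 1) 𝓘(ℝ, ℝ) ∞ (fun z : Circle => Complex.arg (z : ℂ)) z := by
  have h1 : ContDiffAt ℝ ∞ (fun w : ℂ => (Complex.log w).im) (z : ℂ) := by
    have hl : ContDiffAt ℝ ∞ Complex.log (z : ℂ) :=
      (Complex.contDiffAt_log (n := ∞) hz).restrict_scalars ℝ
    exact Complex.imCLM.contDiff.contDiffAt.comp _ hl
  have h2 : ContMDiffAt (𝓡 1) 𝓘(ℝ, ℂ) ∞ (fun z : Circle => (z : ℂ)) z :=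
    (contMDiff_coe_sphere (n := 1) (E := ℂ)).contMDiffAt
  have h3 := ContMDiffAt.comp z (f := fun z : Circle => (z : ℂ)) h1.contMDiffAt h2
  simpa only [Function.comp_def, Complex.log_im] using h3

theorem isLocalDiffeoOnto_circleExp : IsLocalDiffeoOnto 𝓘(ℝ, ℝ) (𝓡 1) Circle.exp := by
  refine ⟨contMDiff_circleExp, fun z => ⟨Complex.arg z, Circle.exp_arg z⟩, fun a => ?_⟩
  have hmul : ContMDiff (𝓡 1) (𝓡 1) ∞ (fun z : Circle => z * (Circle.exp a)⁻¹) :=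
    contMDiff_mul_right
  have h1 : (1 : ℂ) ∈ Complex.slitPlane := Complex.one_mem_slitPlane
  have hev : ∀ᶠ z : Circle in 𝓝 (Circle.exp a),
      ((z * (Circle.exp a)⁻¹ : Circle) : ℂ) ∈ Complex.slitPlane := by
    have hc : Continuous fun z : Circle => ((z * (Circle.exp a)⁻¹ : Circle) : ℂ) :=
      continuous_subtype_val.comp hmul.continuous
    apply hc.continuousAt.eventually (Complex.isOpen_slitPlane.mem_nhds _)
    simpa using h1
  -- The rotation by −a carries the base point to 1, away from the cut of the argument.
  refine ⟨fun z => Complex.arg ((z * (Circle.exp a)⁻¹ : Circle) : ℂ) + a, ?_, ?_, ?_, ?_⟩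
  · simp
  · filter_upwards [hev] with z hz
    have h2 := ContMDiffAt.comp z (f := fun z : Circle => z * (Circle.exp a)⁻¹)
      (contMDiffAt_circle_arg hz) hmul.contMDiffAt
    exact h2.add contMDiffAt_const
  · refine Filter.Eventually.of_forall fun z => ?_
    rw [Circle.exp_add, Circle.exp_arg, inv_mul_cancel_right]
  · filter_upwards [Ioo_mem_nhds (a := a - Real.pi) (b := a + Real.pi) (by linarith [Real.pi_pos])
      (by linarith [Real.pi_pos])] with s hs
    rw [← Circle.exp_neg, ← Circle.exp_add, ← sub_eq_add_neg,
      Circle.arg_exp (by linarith [hs.1]) (by linarith [hs.2])]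
    ring

/-- The circle as the quotient of the line by the multiples of `l`. -/
theorem isLocalDiffeoOnto_circle {l : ℝ} (hl : l ≠ 0) :
    IsLocalDiffeoOnto 𝓘(ℝ, ℝ) (𝓡 1) (fun s : ℝ => Circle.exp (2 * Real.pi / l * s)) := by
  have hc : 2 * Real.pi / l ≠ 0 := div_ne_zero (by positivity) hl
  exact isLocalDiffeoOnto_circleExp.comp (IsLocalDiffeoOnto.of_continuousLinearEquiv
    (ContinuousLinearEquiv.smulLeft (R₁ := ℝ) (M₁ := ℝ) (Units.mk0 _ hc)))

theorem circle_exp_eq_iff {l : ℝ} (hl : l ≠ 0) (s t : ℝ) :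
    Circle.exp (2 * Real.pi / l * s) = Circle.exp (2 * Real.pi / l * t) ↔
      s - t ∈ AddSubgroup.zmultiples l := by
  rw [Circle.exp_eq_exp, AddSubgroup.mem_zmultiples_iff]
  have hpi := Real.pi_ne_zero
  constructor
  · rintro ⟨m, hm⟩
    refine ⟨m, ?_⟩
    rw [zsmul_eq_mul]
    field_simp at hm
    linarith
  · rintro ⟨m, hm⟩
    refine ⟨m, ?_⟩
    rw [zsmul_eq_mul] at hm
    field_simp
    linarith

end LocalDiffeos

/-! ### Coverings of a surface by a product of two curves -/

section PlaneCovers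

/-- A regular curve that is compatible with a parametrization of a one-dimensional manifold
descends to an immersion. -/
theorem exists_isSmoothImmersion {N : Type*} [TopologicalSpace N] [ChartedSpace (Eucl 1) N]
    {p : ℝ → N} (hp : IsLocalDiffeoOnto 𝓘(ℝ, ℝ) (𝓡 1) p) {h : ℝ → Eucl 4}
    (hs : ContDiff ℝ ∞ h) (hr : ∀ s, deriv h s ≠ 0) (hc : ∀ s t, p s = p t → h s = h t) :
    ∃ c : N → Eucl 4, (∀ s, c (p s) = h s) ∧ IsSmoothImmersion 1 c := by
  let c : N → Eucl 4 := fun x => h (Function.surjInv hp.surj x)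
  have hcp : ∀ s, c (p s) = h s := fun s => hc _ _ (Function.surjInv_eq hp.surj (p s))
  have hcs : ContMDiff (𝓡 1) 𝓘(ℝ, Eucl 4) ∞ c :=
    hp.contMDiff_of_comp ((funext hcp : c ∘ p = h) ▸ hs.contMDiff)
  refine ⟨c, hcp, hcs, fun x => ?_⟩
  obtain ⟨s, rfl⟩ := hp.surj x
  obtain ⟨τ, hτ, h1, h2, h3⟩ := hp.inverse s
  have n0 : (∞ : WithTop ℕ∞) ≠ 0 := by simp
  have dτ := (h1.self_of_nhds.mdifferentiableAt n0).hasMFDerivAt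
  have dp := (hp.smooth s).mdifferentiableAt n0 |>.hasMFDerivAt
  have dc := (hcs (p s)).mdifferentiableAt n0 |>.hasMFDerivAt
  have dh : HasMFDerivAt 𝓘(ℝ, ℝ) 𝓘(ℝ, Eucl 4) h s _ :=
    ((hs.differentiable n0) s).hasFDerivAt.hasMFDerivAt
  have e1 := hasMFDerivAt_unique (dc.comp s dp) ((funext hcp : c ∘ p = h) ▸ dh)
  have dp' : HasMFDerivAt 𝓘(ℝ, ℝ) (𝓡 1) p (τ (p s)) (mfderiv 𝓘(ℝ, ℝ) (𝓡 1) p s) := by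
    rw [hτ]; exact dp
  have e2 := hasMFDerivAt_unique ((dp'.comp (p s) dτ).congr_of_eventuallyEq
    (h2.mono fun b hb => hb.symm)) (hasMFDerivAt_id (p s))
  rw [injective_iff_map_eq_zero]
  intro v hv
  have hv' : mfderiv (𝓡 1) 𝓘(ℝ, Eucl 4) c (p s) v = 0 := hv
  have e3 : mfderiv 𝓘(ℝ, ℝ) (𝓡 1) p s (mfderiv (𝓡 1) 𝓘(ℝ, ℝ) τ (p s) v) = v :=
    DFunLike.congr_fun e2 v
  let w : ℝ := mfderiv (𝓡 1) 𝓘(ℝ, ℝ) τ (p s) v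
  have e4 : fderiv ℝ (c ∘ p) s w = 0 :=
    (DFunLike.congr_fun e1 w).symm.trans ((congrArg _ e3).trans hv')
  have e5 : w • deriv h s = 0 := by
    rw [← fderiv_apply_one_eq_deriv, ← map_smul, smul_eq_mul, mul_one, ← e4]
    exact congrArg (fun g => fderiv ℝ g s w) (funext hcp).symm
  have e6 : w = 0 := (smul_eq_zero.1 e5).resolve_right (hr s)
  exact e3.symm.trans ((congrArg (mfderiv 𝓘(ℝ, ℝ) (𝓡 1) p s) e6).trans (map_zero _))

/-- `F` exhibits the immersed surface `f` as a quotient of the product of the curves `h₁` in `V`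
and `h₂` in `Vᗮ`. -/
structure PlaneCover {M : Type*} [TopologicalSpace M] [ChartedSpace (Eucl 2) M]
    (f : M → Eucl 4) (F : Eucl 2 → M) (V : Submodule ℝ (Eucl 4)) (h₁ h₂ : ℝ → Eucl 4) :
    Prop where
  onto : IsLocalDiffeoOnto (𝓡 2) (𝓡 2) F
  translate : ∀ {z w}, F z = F w → ∀ u, F (z + u) = F (w + u)
  smooth₁ : ContDiff ℝ ∞ h₁
  smooth₂ : ContDiff ℝ ∞ h₂
  regular₁ : ∀ s, deriv h₁ s ≠ 0
  regular₂ : ∀ t, deriv h₂ t ≠ 0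
  mem₁ : ∀ s, h₁ s ∈ V
  mem₂ : ∀ t, h₂ t ∈ Vᗮ
  apply_eq : ∀ z, f (F z) = h₁ (z 0) + h₂ (z 1)

variable {M : Type*} [TopologicalSpace M] [ChartedSpace (Eucl 2) M] {f : M → Eucl 4}
  {F : Eucl 2 → M} {V : Submodule ℝ (Eucl 4)} {h₁ h₂ : ℝ → Eucl 4}

/-- A map of the plane whose partial derivatives lie in orthogonal subspaces is a sum of two
curves in these subspaces. -/
theorem exists_sum_of_hasFDerivAt_planeMap {G : Eucl 2 → Eucl 4} {α β : ℝ → Eucl 4}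
    (hG : ∀ z, HasFDerivAt G (planeMap (α (z 0)) (β (z 1))) z)
    (hα : ∀ s, α s ∈ V) (hβ : ∀ t, β t ∈ Vᗮ) :
    (∀ s, HasDerivAt (fun s => V.starProjection (G !₂[s, 0])) (α s) s) ∧
    (∀ t, HasDerivAt (fun t => Vᗮ.starProjection (G !₂[0, t])) (β t) t) ∧
    ∀ z, G z = V.starProjection (G !₂[z 0, 0]) + Vᗮ.starProjection (G !₂[0, z 1]) := by
  have row : ∀ (W : Submodule ℝ (Eucl 4)) (s t : ℝ),
      HasDerivAt (fun s => W.starProjection (G !₂[s, t])) (W.starProjection (α s)) s := by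
    intro W s t
    have := W.starProjection.hasFDerivAt.comp_hasDerivAt s
      ((hG _).comp_hasDerivAt s (hasDerivAt_row s t))
    exact this.congr_deriv (by simp)
  have col : ∀ (W : Submodule ℝ (Eucl 4)) (s t : ℝ),
      HasDerivAt (fun t => W.starProjection (G !₂[s, t])) (W.starProjection (β t)) t := by
    intro W s t
    have := W.starProjection.hasFDerivAt.comp_hasDerivAt t
      ((hG _).comp_hasDerivAt t (hasDerivAt_column s t))
    exact this.congr_deriv (by simp)
  have a1 : ∀ s, V.starProjection (α s) = α s := fun s =>
    Submodule.starProjection_eq_self_iff.2 (hα s)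
  have a2 : ∀ s, Vᗮ.starProjection (α s) = 0 := fun s =>
    (Submodule.starProjection_apply_eq_zero_iff _).2 (V.le_orthogonal_orthogonal (hα s))
  have b1 : ∀ t, Vᗮ.starProjection (β t) = β t := fun t =>
    Submodule.starProjection_eq_self_iff.2 (hβ t)
  have b2 : ∀ t, V.starProjection (β t) = 0 := fun t =>
    (Submodule.starProjection_apply_eq_zero_iff _).2 (hβ t)
  refine ⟨fun s => (row V s 0).congr_deriv (a1 s), fun t => (col Vᗮ 0 t).congr_deriv (b1 t),
    fun z => ?_⟩
  have c1 : V.starProjection (G !₂[z 0, z 1]) = V.starProjection (G !₂[z 0, 0]) :=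
    is_const_of_deriv_eq_zero (f := fun t => V.starProjection (G !₂[z 0, t]))
      (fun t => (col V _ t).differentiableAt) (fun t => (col V _ t).deriv.trans (b2 t)) _ _
  have c2 : Vᗮ.starProjection (G !₂[z 0, z 1]) = Vᗮ.starProjection (G !₂[0, z 1]) :=
    is_const_of_deriv_eq_zero (f := fun s => Vᗮ.starProjection (G !₂[s, z 1]))
      (fun s => (row Vᗮ s _).differentiableAt) (fun s => (row Vᗮ s _).deriv.trans (a2 s)) _ _
  rw [← c1, ← c2, Submodule.starProjection_add_starProjection_orthogonal, eta_plane]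

theorem IsDevelopment.isLocalDiffeoOnto {L₁ L₂ : M → Set (Eucl 4)} {α β : ℝ → Eucl 4}
    (hF : IsDevelopment f L₁ L₂ F α β) (hs : Function.Surjective F) :
    IsLocalDiffeoOnto (𝓡 2) (𝓡 2) F := by
  refine ⟨fun z => ?_, hs, fun z => ?_⟩
  · obtain ⟨e, -, he, hz, heF⟩ := hF.chart z
    exact (he.contMDiffAt (e.open_target.mem_nhds hz)).congr_of_eventuallyEq heF
  · obtain ⟨e, he, he', hz, heF⟩ := hF.chart z
    have hFz : F z = e.symm z := heF.self_of_nhds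
    have hm : e.symm z ∈ e.source := e.map_target hz
    have hc : e.source ∈ 𝓝 (e.symm z) := e.open_source.mem_nhds hm
    rw [hFz]
    refine ⟨e, e.right_inv hz, ?_, ?_, ?_⟩
    · filter_upwards [eventually_mem_nhds_iff.2 hc] with p hp using he.contMDiffAt hp
    · have ht : Filter.Tendsto e (𝓝 (e.symm z)) (𝓝 z) := by
        have := e.continuousAt hm
        rwa [ContinuousAt, e.right_inv hz] at this
      filter_upwards [ht.eventually heF, hc] with p h1 h2
      rw [h1, e.left_inv h2]
    · filter_upwards [heF, e.open_target.mem_nhds hz] with w h1 h2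
      rw [h1, e.right_inv h2]

/-- For arbitrary s and t the vectors α(s) and β(t) are velocities at the single point F(s, t),
hence orthogonal. So with V the span of all α(s), every β(t) lies in Vᗮ, and the local splitting
becomes a global orthogonal one. -/
theorem IsDevelopment.exists_planeCover [T2Space M] [ConnectedSpace M] [IsManifold (𝓡 2) ∞ M]
    {L₁ L₂ : M → Set (Eucl 4)} {α β : ℝ → Eucl 4} (hF : IsDevelopment f L₁ L₂ F α β)
    (hf : IsSmoothImmersion 2 f) (h : IsFrameSystem f L₁ L₂) (hE₁ : HasCurveEnds f L₁)
    (hE₂ : HasCurveEnds f L₂) : ∃ V h₁ h₂, PlaneCover f F V h₁ h₂ := by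
  have onto := hF.isLocalDiffeoOnto (hF.surjective h hE₁ hE₂)
  have hG : ContDiff ℝ ∞ (f ∘ F) := (hf.1.comp onto.smooth).contDiff
  let V : Submodule ℝ (Eucl 4) := Submodule.span ℝ (Set.range α)
  have hα : ∀ s, α s ∈ V := fun s => Submodule.subset_span (Set.mem_range_self s)
  have hβ : ∀ t, β t ∈ Vᗮ := fun t => by
    rw [Submodule.mem_orthogonal]
    intro v hv
    induction hv using Submodule.span_induction with
    | mem x hx =>
      obtain ⟨s, rfl⟩ := hx
      exact hF.inner_eq_zero h s t
    | zero => exact inner_zero_left _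
    | add x y _ _ hx hy => rw [inner_add_left, hx, hy, add_zero]
    | smul a x _ hx => rw [real_inner_smul_left, hx, mul_zero]
  obtain ⟨d1, d2, hsum⟩ := exists_sum_of_hasFDerivAt_planeMap hF.hasFDerivAt hα hβ
  have c1 : ContDiff ℝ ∞ (fun s : ℝ => (!₂[s, 0] : Eucl 2)) :=
    contDiff_plane.comp (contDiff_id.prodMk contDiff_const)
  have c2 : ContDiff ℝ ∞ (fun t : ℝ => (!₂[0, t] : Eucl 2)) :=
    contDiff_plane.comp (contDiff_const.prodMk contDiff_id)
  exact ⟨V, _, _, onto, fun hzw u => hF.translate h hzw u,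
    V.starProjection.contDiff.comp (hG.comp c1), Vᗮ.starProjection.contDiff.comp (hG.comp c2),
    fun s => by
      refine fun h0 => absurd ((d1 s).deriv.symm.trans h0) ?_
      rw [← ne_eq, ← norm_ne_zero_iff, hF.norm_left h]
      exact one_ne_zero,
    fun t => by
      refine fun h0 => absurd ((d2 t).deriv.symm.trans h0) ?_
      rw [← ne_eq, ← norm_ne_zero_iff, hF.norm_right h]
      exact one_ne_zero,
    fun s => V.starProjection_apply_mem _, fun t => Vᗮ.starProjection_apply_mem _, hsum⟩

theorem IsFrameSystem.exists_planeCover [T2Space M] [ConnectedSpace M] [IsManifold (𝓡 2) ∞ M]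
    {L₁ L₂ : M → Set (Eucl 4)} (h : IsFrameSystem f L₁ L₂) (hf : IsSmoothImmersion 2 f)
    (hE₁ : HasCurveEnds f L₁) (hE₂ : HasCurveEnds f L₂) :
    ∃ F V h₁ h₂, PlaneCover f F V h₁ h₂ := by
  obtain ⟨F, α, β, hF⟩ := h.exists_development hE₁ hE₂
  exact ⟨F, hF.exists_planeCover hf h hE₁ hE₂⟩

/-! ### The deck group of a plane cover -/

namespace PlaneCover

/-- Regards f ∘ F as a surface over ℝ² with trivial deck group, so that the product theorem also
covers the statement about coverings. -/
theorem pullback (hP : PlaneCover f F V h₁ h₂) :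
    PlaneCover (f ∘ F) id V h₁ h₂ :=
  { onto := IsLocalDiffeoOnto.of_continuousLinearEquiv (ContinuousLinearEquiv.refl ℝ (Eucl 2))
    translate := fun h u => congrArg (· + u) h
    smooth₁ := hP.smooth₁
    smooth₂ := hP.smooth₂
    regular₁ := hP.regular₁
    regular₂ := hP.regular₂
    mem₁ := hP.mem₁
    mem₂ := hP.mem₂
    apply_eq := hP.apply_eq }

/-- Quotients of the two factors with matching fibres give a product structure on the surface. -/
theorem exists_product (hP : PlaneCover f F V h₁ h₂)
    {M₁ M₂ : Type*} [TopologicalSpace M₁] [ChartedSpace (Eucl 1) M₁]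
    [TopologicalSpace M₂] [ChartedSpace (Eucl 1) M₂] {p₁ : ℝ → M₁} {p₂ : ℝ → M₂}
    (hp₁ : IsLocalDiffeoOnto 𝓘(ℝ, ℝ) (𝓡 1) p₁) (hp₂ : IsLocalDiffeoOnto 𝓘(ℝ, ℝ) (𝓡 1) p₂)
    (hfib : ∀ z w, F z = F w ↔ p₁ (z 0) = p₁ (w 0) ∧ p₂ (z 1) = p₂ (w 1)) :
    ∃ (f₁ : M₁ → Eucl 4) (f₂ : M₂ → Eucl 4)
      (Φ : Diffeomorph ((𝓡 1).prod (𝓡 1)) (𝓡 2) (M₁ × M₂) M ∞),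
      IsSmoothImmersion 1 f₁ ∧ (∀ x, f₁ x ∈ V) ∧ IsSmoothImmersion 1 f₂ ∧ (∀ y, f₂ y ∈ Vᗮ) ∧
      ∀ (x : M₁) (y : M₂), f (Φ (x, y)) = f₁ x + f₂ y := by
  have k₁ : ∀ s t, p₁ s = p₁ t → h₁ s = h₁ t := fun s t hst => by
    have := congrArg f ((hfib !₂[s, 0] !₂[t, 0]).2 ⟨hst, rfl⟩)
    rw [hP.apply_eq, hP.apply_eq] at this
    simpa using this
  have k₂ : ∀ s t, p₂ s = p₂ t → h₂ s = h₂ t := fun s t hst => by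
    have := congrArg f ((hfib !₂[0, s] !₂[0, t]).2 ⟨rfl, hst⟩)
    rw [hP.apply_eq, hP.apply_eq] at this
    simpa using this
  obtain ⟨f₁, e₁, i₁⟩ := exists_isSmoothImmersion hp₁ hP.smooth₁ hP.regular₁ k₁
  obtain ⟨f₂, e₂, i₂⟩ := exists_isSmoothImmersion hp₂ hP.smooth₂ hP.regular₂ k₂
  obtain ⟨Φ, hΦ⟩ := (hp₁.prod hp₂).exists_diffeomorph hP.onto fun z w => by
    rw [hfib, Prod.mk.injEq]
  refine ⟨f₁, f₂, Φ, i₁, fun x => ?_, i₂, fun y => ?_, fun x y => ?_⟩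
  · obtain ⟨s, rfl⟩ := hp₁.surj x
    rw [e₁]; exact hP.mem₁ s
  · obtain ⟨s, rfl⟩ := hp₂.surj y
    rw [e₂]; exact hP.mem₂ s
  · obtain ⟨s, rfl⟩ := hp₁.surj x
    obtain ⟨t, rfl⟩ := hp₂.surj y
    have := hΦ !₂[s, t]
    simp only [PiLp.toLp_apply, Matrix.cons_val_zero, Matrix.cons_val_one] at this
    rw [this, hP.apply_eq, e₁, e₂]
    rfl

/-- The deck group of the covering. -/
def deck (hP : PlaneCover f F V h₁ h₂) : AddSubgroup (Eucl 2) where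
  carrier := {u | F u = F 0}
  zero_mem' := rfl
  add_mem' := fun {a b} ha hb => by
    have := hP.translate (z := a) (w := 0) ha b
    rw [zero_add] at this
    exact this.trans hb
  neg_mem' := fun {a} ha => by
    have := hP.translate (z := a) (w := 0) ha (-a)
    rw [add_neg_cancel, zero_add] at this
    exact this.symm

theorem mem_deck (hP : PlaneCover f F V h₁ h₂) {u : Eucl 2} : u ∈ hP.deck ↔ F u = F 0 := Iff.rfl

theorem eq_iff (hP : PlaneCover f F V h₁ h₂) {z w : Eucl 2} : F z = F w ↔ z - w ∈ hP.deck := by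
  rw [mem_deck]
  constructor
  · intro h
    have := hP.translate h (-w)
    rwa [← sub_eq_add_neg, ← sub_eq_add_neg, sub_self] at this
  · intro h
    have := hP.translate h w
    rwa [sub_add_cancel, zero_add] at this

theorem eventually_mem_deck (hP : PlaneCover f F V h₁ h₂) :
    ∀ᶠ u in 𝓝 (0 : Eucl 2), u ∈ hP.deck → u = 0 := by
  obtain ⟨τ, h0, -, -, h⟩ := hP.onto.inverse 0
  filter_upwards [h] with u hu hd
  rw [← hu, hP.mem_deck.1 hd, h0]

end PlaneCover

end PlaneCovers

/-! ### Discrete groups of translations -/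

section Periods

theorem isDiscrete_of_isolated_zero {E : Type*} [AddCommGroup E] [TopologicalSpace E]
    [IsTopologicalAddGroup E] {G : AddSubgroup E} (h : ∀ᶠ u in 𝓝 (0 : E), u ∈ G → u = 0) :
    IsDiscrete (G : Set E) := by
  refine IsDiscrete.of_nhdsWithin fun x hx => ?_
  rw [Filter.le_pure_iff, mem_nhdsWithin_iff_eventually]
  have ht : Filter.Tendsto (fun y => y - x) (𝓝 x) (𝓝 0) := by
    have : ContinuousAt (fun y => y - x) x := by fun_prop
    rwa [ContinuousAt, sub_self] at this
  filter_upwards [ht.eventually h] with y hy hyG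
  exact sub_eq_zero.1 (hy (G.sub_mem hyG hx))

theorem AddSubgroup.exists_zmultiples_of_isolated_zero {K : AddSubgroup ℝ}
    (h : ∀ᶠ u in 𝓝 (0 : ℝ), u ∈ K → u = 0) : ∃ l, K = AddSubgroup.zmultiples l := by
  obtain ⟨ε, hε, hK⟩ := Metric.eventually_nhds_iff.1 h
  obtain ⟨l, hl⟩ := AddSubgroup.cyclic_of_isolated_zero (H := K) hε <| by
    rw [Set.disjoint_left]
    intro x hx hxε
    have : x = 0 := hK (by rw [Real.dist_eq, sub_zero, abs_of_pos hxε.1]; exact hxε.2) hx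
    exact hxε.1.ne' this
  exact ⟨l, by rw [AddSubgroup.zmultiples_eq_closure, hl]⟩

/-- The quotient of the line by a nontrivial discrete group is a circle. -/
theorem exists_circle_quotient {K : AddSubgroup ℝ} (h : ∀ᶠ u in 𝓝 (0 : ℝ), u ∈ K → u = 0)
    (hK : ∃ u ∈ K, u ≠ 0) : ∃ p : ℝ → Circle, IsLocalDiffeoOnto 𝓘(ℝ, ℝ) (𝓡 1) p ∧
      ∀ s t, p s = p t ↔ s - t ∈ K := by
  obtain ⟨l, rfl⟩ := AddSubgroup.exists_zmultiples_of_isolated_zero h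
  have hl : l ≠ 0 := by
    rintro rfl
    obtain ⟨u, hu, hu0⟩ := hK
    simp at hu
    exact hu0 hu
  exact ⟨_, isLocalDiffeoOnto_circle hl, circle_exp_eq_iff hl⟩

/-- The quotient of the line by a discrete group is a one-dimensional manifold. -/
theorem exists_line_quotient {K : AddSubgroup ℝ} (h : ∀ᶠ u in 𝓝 (0 : ℝ), u ∈ K → u = 0) :
    ∃ (N : Type) (_ : TopologicalSpace N) (_ : ChartedSpace (Eucl 1) N)
      (_ : IsManifold (𝓡 1) ∞ N) (p : ℝ → N), IsLocalDiffeoOnto 𝓘(ℝ, ℝ) (𝓡 1) p ∧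
      ∀ s t, p s = p t ↔ s - t ∈ K := by
  by_cases hK : ∃ u ∈ K, u ≠ 0
  · obtain ⟨p, hp⟩ := exists_circle_quotient h hK
    exact ⟨Circle, inferInstance, inferInstance, inferInstance, p, hp⟩
  · push Not at hK
    refine ⟨Eucl 1, inferInstance, inferInstance, inferInstance, _, isLocalDiffeoOnto_line,
      fun s t => ⟨fun hst => ?_, fun hst => ?_⟩⟩
    · have : s = t := congrArg (fun z : Eucl 1 => z 0) hst
      rw [this, sub_self]
      exact K.zero_mem
    · rw [sub_eq_zero.1 (hK _ hst)]

/-- A lattice in the plane is the image of `ℤ × ℤ` under a linear automorphism. -/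
theorem exists_continuousLinearEquiv_of_span_eq_top {G : AddSubgroup (Eucl 2)}
    (hd : IsDiscrete (G : Set (Eucl 2))) (hs : Submodule.span ℝ (G : Set (Eucl 2)) = ⊤) :
    ∃ A : Eucl 2 ≃L[ℝ] Eucl 2, ∀ z, A z ∈ G ↔
      z 0 ∈ AddSubgroup.zmultiples (1 : ℝ) ∧ z 1 ∈ AddSubgroup.zmultiples (1 : ℝ) := by
  let L : Submodule ℤ (Eucl 2) := AddSubgroup.toIntSubmodule G
  have : DiscreteTopology L := isDiscrete_iff_discreteTopology.1 hd
  have : IsZLattice ℝ L := ⟨hs⟩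
  have hfin : Module.finrank ℤ L = 2 := by
    rw [ZLattice.rank ℝ L, finrank_euclideanSpace_fin]
  let b : Module.Basis (Fin 2) ℤ L := Module.finBasisOfFinrankEq ℤ L hfin
  let B : Module.Basis (Fin 2) ℝ (Eucl 2) := b.ofZLatticeBasis ℝ L
  let A : Eucl 2 ≃L[ℝ] Eucl 2 :=
    ((EuclideanSpace.equiv (Fin 2) ℝ).toLinearEquiv.trans B.equivFun.symm).toContinuousLinearEquiv
  have hA : ∀ z i, B.repr (A z) i = z i := fun z i => by
    have : B.equivFun (A z) = z := B.equivFun.apply_symm_apply _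
    rw [← this, B.equivFun_apply]
  refine ⟨A, fun z => ?_⟩
  have h1 : A z ∈ G ↔ A z ∈ Submodule.span ℤ (Set.range B) := by
    rw [Module.Basis.ofZLatticeBasis_span]
    rfl
  rw [h1, B.mem_span_iff_repr_mem ℤ, Fin.forall_fin_two, hA, hA]
  simp [AddSubgroup.mem_zmultiples_iff]

theorem deriv_mem_of_forall_mem {W : Submodule ℝ (Eucl 4)} {h : ℝ → Eucl 4}
    (hh : Differentiable ℝ h) (hW : ∀ s, h s ∈ W) (s : ℝ) : deriv h s ∈ W := by
  have h1 : (fun s => W.starProjection (h s)) = h :=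
    funext fun s => Submodule.starProjection_eq_self_iff.2 (hW s)
  have h2 := W.starProjection.hasFDerivAt.comp_hasDerivAt s (hh s).hasDerivAt
  rw [Function.comp_def, h1] at h2
  rw [h2.deriv]
  exact W.starProjection_apply_mem _

/-- A closed regular curve is not contained in a line. -/
theorem two_le_finrank_of_closed {W : Submodule ℝ (Eucl 4)} {h : ℝ → Eucl 4}
    (hh : Differentiable ℝ h) (hW : ∀ s, h s ∈ W) (hr : ∀ s, deriv h s ≠ 0) {a b : ℝ}
    (hab : a ≠ b) (hc : h a = h b) : 2 ≤ Module.finrank ℝ W := by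
  wlog hlt : a < b generalizing a b
  · exact this hab.symm hc.symm (lt_of_le_of_ne (not_lt.1 hlt) hab.symm)
  by_contra! hlt2
  obtain ⟨v, hv⟩ := finrank_le_one_iff.1 (Nat.le_of_lt_succ hlt2)
  have hd : ∀ s, HasDerivAt (fun s => ⟪(v : Eucl 4), h s⟫) ⟪(v : Eucl 4), deriv h s⟫ s :=
    fun s => (innerSL ℝ (v : Eucl 4)).hasFDerivAt.comp_hasDerivAt s (hh s).hasDerivAt
  -- Rolle for the coordinate along a spanning vector v of the line: at s the derivative of h is
  -- orthogonal to v and also a multiple of v, hence zero.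
  obtain ⟨s, -, hs⟩ := exists_deriv_eq_zero hlt
    (fun s _ => (hd s).continuousAt.continuousWithinAt) (congrArg (fun x => ⟪(v : Eucl 4), x⟫) hc)
  rw [(hd s).deriv] at hs
  obtain ⟨c, hcv⟩ := hv ⟨_, deriv_mem_of_forall_mem hh hW s⟩
  have hcv' : c • (v : Eucl 4) = deriv h s := congrArg Subtype.val hcv
  apply hr s
  rw [← inner_self_eq_zero (𝕜 := ℝ)]
  nth_rewrite 1 [← hcv']
  rw [real_inner_smul_left, hs, mul_zero]

end Periods

/-! ### Product structures -/

namespace PlaneCover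

variable {M : Type*} [TopologicalSpace M] [ChartedSpace (Eucl 2) M] {f : M → Eucl 4}
  {F : Eucl 2 → M} {V : Submodule ℝ (Eucl 4)} {h₁ h₂ : ℝ → Eucl 4}

/-- A difference of values of h₁ that equals a difference of values of h₂ lies in V ∩ Vᗮ = 0. -/
theorem eq_and_eq_iff (hP : PlaneCover f F V h₁ h₂) {z w : Eucl 2} :
    f (F z) = f (F w) ↔ h₁ (z 0) = h₁ (w 0) ∧ h₂ (z 1) = h₂ (w 1) := by
  rw [hP.apply_eq, hP.apply_eq]
  constructor
  · intro h
    have h1 : h₁ (z 0) - h₁ (w 0) = h₂ (w 1) - h₂ (z 1) := by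
      rw [sub_eq_sub_iff_add_eq_add, h, add_comm]
    have h2 : h₁ (z 0) - h₁ (w 0) = 0 := by
      have hV := V.sub_mem (hP.mem₁ (z 0)) (hP.mem₁ (w 0))
      have hV' := Vᗮ.sub_mem (hP.mem₂ (w 1)) (hP.mem₂ (z 1))
      rw [← h1] at hV'
      exact Submodule.disjoint_def.1 V.orthogonal_disjoint _ hV hV'
    exact ⟨sub_eq_zero.1 h2, (sub_eq_zero.1 (h1 ▸ h2)).symm⟩
  · rintro ⟨h1, h2⟩
    rw [h1, h2]

/-- F is an open quotient map whose fibres are the orbits of a discrete group of translations. -/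
theorem isCoveringMap (hP : PlaneCover f F V h₁ h₂) : IsCoveringMap F := by
  have hq : Topology.IsQuotientMap F := hP.onto.isLocalDiffeomorph.isLocalHomeomorph.isOpenMap
    |>.isQuotientMap hP.onto.smooth.continuous hP.onto.surj
  refine (hq.isAddQuotientCoveringMap_of_addSubgroup hP.deck
    (isDiscrete_of_isolated_zero hP.eventually_mem_deck) fun {z w} => ?_).isCoveringMap
  rw [← sub_eq_add_neg, ← hP.eq_iff, eq_comm]

theorem isCoveredByExtrinsicProduct (hP : PlaneCover f F V h₁ h₂) :
    IsCoveredByExtrinsicProduct f := by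
  obtain ⟨f₁, f₂, Φ, h⟩ := hP.pullback.exists_product isLocalDiffeoOnto_line
    isLocalDiffeoOnto_line fun z w => ⟨fun h => by rw [show z = w from h]; exact ⟨rfl, rfl⟩,
      fun h => by
        have a : z 0 = w 0 := congrArg (fun z : Eucl 1 => z 0) h.1
        have b : z 1 = w 1 := congrArg (fun z : Eucl 1 => z 0) h.2
        rw [← eta_plane z, a, b, eta_plane]⟩
  exact ⟨F, hP.isCoveringMap, hP.onto.surj, hP.onto.isLocalDiffeomorph, V, Eucl 1, inferInstance,
    inferInstance, inferInstance, Eucl 1, inferInstance, inferInstance, inferInstance, f₁, f₂, Φ, h⟩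

/-- The translations along the first axis in the deck group. -/
def deckLeft (hP : PlaneCover f F V h₁ h₂) : AddSubgroup ℝ :=
  hP.deck.comap
    { toFun := fun s => !₂[s, 0]
      map_zero' := by ext i; fin_cases i <;> rfl
      map_add' := fun s t => by ext i; fin_cases i <;> simp }

/-- The translations along the second axis in the deck group. -/
def deckRight (hP : PlaneCover f F V h₁ h₂) : AddSubgroup ℝ :=
  hP.deck.comap
    { toFun := fun t => !₂[0, t]
      map_zero' := by ext i; fin_cases i <;> rfl
      map_add' := fun s t => by ext i; fin_cases i <;> simp }

theorem mem_deckLeft (hP : PlaneCover f F V h₁ h₂) {s : ℝ} :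
    s ∈ hP.deckLeft ↔ (!₂[s, 0] : Eucl 2) ∈ hP.deck := Iff.rfl

theorem mem_deckRight (hP : PlaneCover f F V h₁ h₂) {t : ℝ} :
    t ∈ hP.deckRight ↔ (!₂[0, t] : Eucl 2) ∈ hP.deck := Iff.rfl

theorem eventually_mem_deckLeft (hP : PlaneCover f F V h₁ h₂) :
    ∀ᶠ s in 𝓝 (0 : ℝ), s ∈ hP.deckLeft → s = 0 := by
  have hc : Filter.Tendsto (fun s : ℝ => (!₂[s, 0] : Eucl 2)) (𝓝 0) (𝓝 0) := by
    have h0 : (!₂[0, 0] : Eucl 2) = 0 := eta_plane 0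
    have := (hasDerivAt_row 0 0).continuousAt
    rwa [ContinuousAt, h0] at this
  filter_upwards [hc.eventually hP.eventually_mem_deck] with s hs hm
  exact congrArg (fun z : Eucl 2 => z 0) (hs hm)

theorem eventually_mem_deckRight (hP : PlaneCover f F V h₁ h₂) :
    ∀ᶠ t in 𝓝 (0 : ℝ), t ∈ hP.deckRight → t = 0 := by
  have hc : Filter.Tendsto (fun t : ℝ => (!₂[0, t] : Eucl 2)) (𝓝 0) (𝓝 0) := by
    have h0 : (!₂[0, 0] : Eucl 2) = 0 := eta_plane 0
    have := (hasDerivAt_column 0 0).continuousAt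
    rwa [ContinuousAt, h0] at this
  filter_upwards [hc.eventually hP.eventually_mem_deck] with s hs hm
  exact congrArg (fun z : Eucl 2 => z 1) (hs hm)

/-- If the surface has no self-intersections, its deck group is a product. -/
theorem eq_iff_of_injective (hP : PlaneCover f F V h₁ h₂) (hf : Function.Injective f)
    {z w : Eucl 2} : F z = F w ↔ z 0 - w 0 ∈ hP.deckLeft ∧ z 1 - w 1 ∈ hP.deckRight := by
  have h1 : ∀ s t, h₁ s = h₁ t ↔ s - t ∈ hP.deckLeft := fun s t => by
    have e : (!₂[s - t, 0] : Eucl 2) = !₂[s, 0] - !₂[t, 0] := by ext i; fin_cases i <;> simp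
    rw [mem_deckLeft, e, ← hP.eq_iff, ← hf.eq_iff, hP.eq_and_eq_iff]
    simp
  have h2 : ∀ s t, h₂ s = h₂ t ↔ s - t ∈ hP.deckRight := fun s t => by
    have e : (!₂[0, s - t] : Eucl 2) = !₂[0, s] - !₂[0, t] := by ext i; fin_cases i <;> simp
    rw [mem_deckRight, e, ← hP.eq_iff, ← hf.eq_iff, hP.eq_and_eq_iff]
    simp
  rw [← hf.eq_iff, hP.eq_and_eq_iff, h1, h2]

theorem isExtrinsicProduct (hP : PlaneCover f F V h₁ h₂) (hf : Function.Injective f) :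
    IsExtrinsicProduct f := by
  obtain ⟨M₁, _, _, _, p₁, hp₁, e₁⟩ := exists_line_quotient hP.eventually_mem_deckLeft
  obtain ⟨M₂, _, _, _, p₂, hp₂, e₂⟩ := exists_line_quotient hP.eventually_mem_deckRight
  obtain ⟨f₁, f₂, Φ, h⟩ := hP.exists_product hp₁ hp₂ fun z w => by
    rw [e₁, e₂, hP.eq_iff_of_injective hf]
  exact ⟨V, M₁, _, _, ‹_›, M₂, _, _, ‹_›, f₁, f₂, Φ, h⟩

/-! ### Compact surfaces -/

/-- A nonzero linear form that vanishes on the deck group would descend to an unbounded continuous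
function on a compact surface. -/
theorem exists_mem_deck_ne_zero [CompactSpace M] (hP : PlaneCover f F V h₁ h₂)
    {l : Eucl 2 →ₗ[ℝ] ℝ} (hl : l ≠ 0) : ∃ u ∈ hP.deck, l u ≠ 0 := by
  by_contra! h
  let g : M → ℝ := fun p => l (Function.surjInv hP.onto.surj p)
  have hg : ∀ z, g (F z) = l z := fun z => by
    have := h _ (hP.eq_iff.1 (Function.surjInv_eq hP.onto.surj (F z)))
    rwa [map_sub, sub_eq_zero] at this
  have hq : Topology.IsQuotientMap F := hP.onto.isLocalDiffeomorph.isLocalHomeomorph.isOpenMap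
    |>.isQuotientMap hP.onto.smooth.continuous hP.onto.surj
  have hc : Continuous g := by
    rw [hq.continuous_iff, show g ∘ F = l from funext hg]
    exact l.continuous_of_finiteDimensional
  obtain ⟨b, hb⟩ := (isCompact_range hc).bddAbove
  obtain ⟨z, hz⟩ := LinearMap.surjective hl (b + 1)
  have := hb (Set.mem_range_self (F z))
  rw [hg, hz] at this
  linarith

theorem span_deck_eq_top [CompactSpace M] (hP : PlaneCover f F V h₁ h₂) :
    Submodule.span ℝ (hP.deck : Set (Eucl 2)) = ⊤ := by
  by_contra h
  obtain ⟨l, hl, hle⟩ := Submodule.exists_le_ker_of_lt_top _ (lt_top_iff_ne_top.2 h)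
  obtain ⟨u, hu, hlu⟩ := hP.exists_mem_deck_ne_zero hl
  exact hlu (hle (Submodule.subset_span hu))

/-- The deck lattice need not be aligned with the coordinate axes, so a linear change of variables
to ℤ × ℤ comes first; it ignores the splitting of f. -/
theorem exists_torus_diffeomorph [CompactSpace M] (hP : PlaneCover f F V h₁ h₂) :
    Nonempty (Diffeomorph ((𝓡 1).prod (𝓡 1)) (𝓡 2) (Circle × Circle) M ∞) := by
  obtain ⟨A, hA⟩ := exists_continuousLinearEquiv_of_span_eq_top
    (isDiscrete_of_isolated_zero hP.eventually_mem_deck) hP.span_deck_eq_top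
  have hc := isLocalDiffeoOnto_circle one_ne_zero
  obtain ⟨Φ, -⟩ := (hc.prod hc).exists_diffeomorph
    (hP.onto.comp (IsLocalDiffeoOnto.of_continuousLinearEquiv A)) fun z w => by
      rw [Prod.mk.injEq, circle_exp_eq_iff one_ne_zero, circle_exp_eq_iff one_ne_zero,
        Function.comp_apply, Function.comp_apply, hP.eq_iff, ← map_sub, hA]
      rfl
  exact ⟨Φ⟩

theorem exists_coord_ne_zero [CompactSpace M] (hP : PlaneCover f F V h₁ h₂) (i : Fin 2) :
    ∃ u ∈ hP.deck, u i ≠ 0 :=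
  hP.exists_mem_deck_ne_zero (l := (EuclideanSpace.proj i : Eucl 2 →L[ℝ] ℝ).toLinearMap)
    fun h => by simpa using DFunLike.congr_fun h (EuclideanSpace.single i 1)

end PlaneCover

/-- The group of periods of a curve. -/
def periodGroup (h : ℝ → Eucl 4) : AddSubgroup ℝ where
  carrier := {u | ∀ s, h (s + u) = h s}
  zero_mem' := fun s => by rw [add_zero]
  add_mem' := fun {a b} ha hb s => by rw [← add_assoc, hb, ha]
  neg_mem' := fun {a} ha s => by rw [← ha, neg_add_cancel_right]

theorem eventually_mem_periodGroup {h : ℝ → Eucl 4} (hd : Differentiable ℝ h)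
    (hr : deriv h 0 ≠ 0) : ∀ᶠ u in 𝓝 (0 : ℝ), u ∈ periodGroup h → u = 0 := by
  have := (hd 0).hasDerivAt.eventually_ne (c := h 0) hr
  rw [eventually_nhdsWithin_iff] at this
  filter_upwards [this] with u hu hm
  by_contra hne
  exact hu hne (by simpa using hm 0)

namespace PlaneCover

variable {M : Type*} [TopologicalSpace M] [ChartedSpace (Eucl 2) M] {f : M → Eucl 4}
  {F : Eucl 2 → M} {V : Submodule ℝ (Eucl 4)} {h₁ h₂ : ℝ → Eucl 4}

theorem mem_periodGroup (hP : PlaneCover f F V h₁ h₂) {u : Eucl 2} (hu : u ∈ hP.deck) :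
    u 0 ∈ periodGroup h₁ ∧ u 1 ∈ periodGroup h₂ := by
  have h : ∀ z : Eucl 2, h₁ ((z + u) 0) = h₁ (z 0) ∧ h₂ ((z + u) 1) = h₂ (z 1) := fun z =>
    hP.eq_and_eq_iff.1 (congrArg f (hP.eq_iff.2 (by rwa [add_sub_cancel_left])))
  exact ⟨fun s => (h !₂[s, 0]).1, fun t => (h !₂[0, t]).2⟩

/-- Compactness provides deck translations with nonzero first and second coordinate, so both curves
close up. Each spans at least a plane, and the dimensions add up to four. -/
theorem finrank_eq_two [CompactSpace M] (hP : PlaneCover f F V h₁ h₂) :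
    Module.finrank ℝ V = 2 ∧ Module.finrank ℝ Vᗮ = 2 := by
  have n0 : (∞ : WithTop ℕ∞) ≠ 0 := by simp
  obtain ⟨u, hu, hu0⟩ := hP.exists_coord_ne_zero 0
  obtain ⟨v, hv, hv1⟩ := hP.exists_coord_ne_zero 1
  have h1 := two_le_finrank_of_closed (hP.smooth₁.differentiable n0) hP.mem₁ hP.regular₁
    (a := 0 + u 0) (b := 0) (by simpa using hu0) ((hP.mem_periodGroup hu).1 0)
  have h2 := two_le_finrank_of_closed (hP.smooth₂.differentiable n0) hP.mem₂ hP.regular₂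
    (a := 0 + v 1) (b := 0) (by simpa using hv1) ((hP.mem_periodGroup hv).2 0)
  have h3 := V.finrank_add_finrank_orthogonal
  rw [finrank_euclideanSpace_fin] at h3
  omega

/-- The coordinates of a deck translation are periods of h₁ and h₂, so the deck group lies in the
product of the two period groups, possibly as a proper subgroup. Therefore M only maps to the
product of the circles ℝ/periods; the map is a local diffeomorphism from a compact surface, hence a
covering. -/
theorem isImmersedProductTorus [T2Space M] [CompactSpace M] (hP : PlaneCover f F V h₁ h₂) :
    IsImmersedProductTorus f := by
  refine ⟨hP.exists_torus_diffeomorph, V, ?_⟩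
  have n0 : (∞ : WithTop ℕ∞) ≠ 0 := by simp
  obtain ⟨u, hu, hu0⟩ := hP.exists_coord_ne_zero 0
  obtain ⟨v, hv, hv1⟩ := hP.exists_coord_ne_zero 1
  obtain ⟨p₁, hp₁, e₁⟩ := exists_circle_quotient
    (eventually_mem_periodGroup (hP.smooth₁.differentiable n0) (hP.regular₁ 0))
    ⟨_, (hP.mem_periodGroup hu).1, hu0⟩
  obtain ⟨p₂, hp₂, e₂⟩ := exists_circle_quotient
    (eventually_mem_periodGroup (hP.smooth₂.differentiable n0) (hP.regular₂ 0))
    ⟨_, (hP.mem_periodGroup hv).2, hv1⟩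
  obtain ⟨c₁, k₁, i₁⟩ := exists_isSmoothImmersion hp₁ hP.smooth₁ hP.regular₁ fun s t hst => by
    simpa using (e₁ s t).1 hst t
  obtain ⟨c₂, k₂, i₂⟩ := exists_isSmoothImmersion hp₂ hP.smooth₂ hP.regular₂ fun s t hst => by
    simpa using (e₂ s t).1 hst t
  let π : M → Circle × Circle := fun p =>
    (p₁ (Function.surjInv hP.onto.surj p 0), p₂ (Function.surjInv hP.onto.surj p 1))
  have hπ : ∀ z, π (F z) = (p₁ (z 0), p₂ (z 1)) := fun z => by
    have := hP.mem_periodGroup (hP.eq_iff.1 (Function.surjInv_eq hP.onto.surj (F z)))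
    exact Prod.ext ((e₁ _ _).2 this.1) ((e₂ _ _).2 this.2)
  have hloc := hP.onto.of_comp (hp₁.prod hp₂) hπ
  refine ⟨c₁, c₂, π, ⟨hP.finrank_eq_two.1, i₁, fun z => ?_⟩, ⟨hP.finrank_eq_two.2, i₂, fun z => ?_⟩,
    isLocalHomeomorph_iff_isCoveringMap.1 hloc.isLocalDiffeomorph.isLocalHomeomorph,
    hloc.surj, hloc.isLocalDiffeomorph, fun p => ?_⟩
  · obtain ⟨s, rfl⟩ := hp₁.surj z
    rw [k₁]; exact hP.mem₁ s
  · obtain ⟨s, rfl⟩ := hp₂.surj z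
    rw [k₂]; exact hP.mem₂ s
  · obtain ⟨z, rfl⟩ := hP.onto.surj p
    rw [hπ, hP.apply_eq, k₁, k₂]

theorem isEmbeddedProductTorus [CompactSpace M] (hP : PlaneCover f F V h₁ h₂)
    (hf : IsSmoothImmersion 2 f) (hi : Function.Injective f) : IsEmbeddedProductTorus f := by
  refine ⟨(hf.1.continuous.isClosedEmbedding hi).isEmbedding, V, ?_⟩
  obtain ⟨u, hu, hu0⟩ := hP.exists_coord_ne_zero 0
  obtain ⟨v, hv, hv1⟩ := hP.exists_coord_ne_zero 1
  -- Injectivity turns the coordinates of the two deck translations into translations along the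
  -- axes, so both axis groups are nontrivial and their quotients are circles.
  rw [hP.mem_deck, hP.eq_iff_of_injective hi] at hu hv
  obtain ⟨p₁, hp₁, e₁⟩ := exists_circle_quotient hP.eventually_mem_deckLeft
    ⟨u 0, by simpa using hu.1, hu0⟩
  obtain ⟨p₂, hp₂, e₂⟩ := exists_circle_quotient hP.eventually_mem_deckRight
    ⟨v 1, by simpa using hv.2, hv1⟩
  obtain ⟨c₁, c₂, Φ, i₁, m₁, i₂, m₂, h⟩ := hP.exists_product hp₁ hp₂ fun z w => by
    rw [e₁, e₂, hP.eq_iff_of_injective hi]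
  refine ⟨c₁, c₂, Φ, ⟨hP.finrank_eq_two.1, i₁, m₁⟩, fun z w hzw => ?_,
    ⟨hP.finrank_eq_two.2, i₂, m₂⟩, fun z w hzw => ?_, h⟩
  -- With the other factor frozen, simplicity of each curve follows from injectivity of f ∘ Φ.
  · have h1 : f (Φ (z, 1)) = f (Φ (w, 1)) := by rw [h, h, hzw]
    exact (Prod.ext_iff.1 (Φ.injective (hi h1))).1
  · have h1 : f (Φ (1, z)) = f (Φ (1, w)) := by rw [h, h, hzw]
    exact (Prod.ext_iff.1 (Φ.injective (hi h1))).2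

end PlaneCover

theorem theorem1p1 {M : Type*} [TopologicalSpace M] [T2Space M] [SecondCountableTopology M]
    [ConnectedSpace M] [ChartedSpace (Eucl 2) M] [IsManifold (𝓡 2) ∞ M]
    (f : M → Eucl 4) (hf : IsSmoothImmersion 2 f)
    (Plane : Submodule ℝ (Eucl 4)) (hPlane : Module.finrank ℝ Plane = 2)
    (hangles : HasConstantPrincipalAngles f Plane) :
    (HasZeroGaussCurvature f ∧ HasFlatNormalBundle f) ∧
    (IsCompleteSurface f →
      IsCoveredByExtrinsicProduct f ∧ (Function.Injective f → IsExtrinsicProduct f)) ∧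
    (CompactSpace M →
      IsImmersedProductTorus f ∧ (Function.Injective f → IsEmbeddedProductTorus f)) := by
  refine ⟨curvatures_eq_zero hf hPlane hangles, fun hM => ?_, fun _ => ?_⟩
  · obtain ⟨L₁, L₂, h⟩ := exists_frameSystem hf hPlane hangles
    obtain ⟨F, V, h₁, h₂, hP⟩ := h.exists_planeCover hf (h.hasCurveEnds_of_isCompleteSurface hf hM)
      (h.swap.hasCurveEnds_of_isCompleteSurface hf hM)
    exact ⟨hP.isCoveredByExtrinsicProduct, hP.isExtrinsicProduct⟩
  · obtain ⟨L₁, L₂, h⟩ := exists_frameSystem hf hPlane hangles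
    obtain ⟨F, V, h₁, h₂, hP⟩ := h.exists_planeCover hf (hasCurveEnds_of_compactSpace L₁)
      (hasCurveEnds_of_compactSpace L₂)
    exact ⟨hP.isImmersedProductTorus, hP.isEmbeddedProductTorus hf⟩
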